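/- Let $\Bbbk$ be an algebraically closed field of characteristic different from $2$, and let $X,Y\subset\mathbb{A}^n$ be nonempty affine varieties over $\Bbbk$ (Zariski closed subsets, not necessarily irreducible). Let $\overline{X},\overline{Y}\subset\mathbb{P}^n$ be their projective closures and let $H_0=\{x_0=0\}$ be the hyperplane at infinity; suppose that $X$ and $Y$ are disjoint at infinity, i.e. $\overline{X}\cap\overline{Y}\cap H_0=\emptyset$. Let $z_0,z_1\in\Bbbk$ be distinct, and let $\tilde{X},\tilde{Y}\subset\mathbb{P}^{n+1}$ be the projective closures of $X\times\{z_0\}$ and $Y\times\{z_1\}\subset\mathbb{A}^{n+1}$. Let $J(\tilde{X},\tilde{Y})$ be their join, i.e. the Zariski closure of the union of the lines joining distinct points $x\in\tilde{X}$ and $y\in\tilde{Y}$. For $\alpha\in\Bbbk^\times$ let $\alpha X+Y\subset\mathbb{A}^n$ be the Minkowski sum, i.e. the Zariski closure of $\{\alpha x+y : x\in X,\ y\in Y\}$. Here the degree of a $d$-dimensional variety in $\mathbb{A}^m$ or $\mathbb{P}^m$ is the number of points in which it meets a general linear (respectively, in $\mathbb{A}^m$, affine-linear) subspace of dimension $m-d$.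 Then, for generic $\alpha\in\Bbbk^\times$ (that is, for all but finitely many $\alpha$), $$\deg(\alpha X+Y)=\deg J(\tilde{X},\tilde{Y}).$$ -/

import Mathlib

open scoped Pointwise LinearAlgebra.Projectivization

namespace MinkowskiJoin

variable {k : Type*} [Field k]

/-! ### Affine algebraic sets in `𝔸ⁿ = (Fin n → k)` -/

/-- `X ⊆ 𝔸ⁿ` is an affine variety (not necessarily irreducible): a common zero locus of
polynomials. -/
def IsAffineVariety {n : ℕ} (X : Set (Fin n → k)) : Prop :=
  ∃ I : Ideal (MvPolynomial (Fin n) k), X = MvPolynomial.zeroLocus k I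

/-- Zariski closure in `𝔸ⁿ`. -/
def zariskiClosure {n : ℕ} (X : Set (Fin n → k)) : Set (Fin n → k) :=
  MvPolynomial.zeroLocus k (MvPolynomial.vanishingIdeal k X)

/-- The Minkowski sum: the Zariski closure of `{x + y | x ∈ X, y ∈ Y}`. -/
def minkowskiSum {n : ℕ} (X Y : Set (Fin n → k)) : Set (Fin n → k) :=
  zariskiClosure (X + Y)

/-! ### Projective algebraic sets in `ℙᴺ = ℙ k (Fin (N + 1) → k)` -/

/-- The homogeneous vanishing ideal: the ideal generated by the homogeneous polynomials vanishing
on `Z`. By homogeneity the vanishing at a point does not depend on its representative. -/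
noncomputable def homogeneousVanishingIdeal {N : ℕ} (Z : Set (ℙ k (Fin (N + 1) → k))) :
    Ideal (MvPolynomial (Fin (N + 1)) k) :=
  Ideal.span {F | (∃ m : ℕ, F.IsHomogeneous m) ∧ ∀ p ∈ Z, MvPolynomial.eval p.rep F = 0}

/-- Zariski closure in `ℙᴺ`. -/
def projZariskiClosure {N : ℕ} (Z : Set (ℙ k (Fin (N + 1) → k))) :
    Set (ℙ k (Fin (N + 1) → k)) :=
  {p | ∀ F ∈ homogeneousVanishingIdeal Z, MvPolynomial.eval p.rep F = 0}

/-- The vector `(1, x₁, …, xₙ)`. -/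
def homogenize {n : ℕ} (x : Fin n → k) : Fin (n + 1) → k :=
  Fin.cons 1 x

theorem homogenize_ne_zero {n : ℕ} (x : Fin n → k) : homogenize x ≠ 0 :=
  fun h => one_ne_zero (congrFun h 0)

/-- The standard embedding `𝔸ⁿ → ℙⁿ`, `x ↦ [1 : x₁ : … : xₙ]`. -/
def toProj {n : ℕ} (x : Fin n → k) : ℙ k (Fin (n + 1) → k) :=
  Projectivization.mk k (homogenize x) (homogenize_ne_zero x)

/-- The projective closure in `ℙⁿ` of a subset of `𝔸ⁿ`. -/
def projectiveClosure {n : ℕ} (X : Set (Fin n → k)) : Set (ℙ k (Fin (n + 1) → k)) :=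
  projZariskiClosure (toProj '' X)

/-- The hyperplane at infinity `H₀ = {x₀ = 0}`. -/
def hyperplaneAtInfinity (k : Type*) [Field k] (n : ℕ) : Set (ℙ k (Fin (n + 1) → k)) :=
  {p | p.rep 0 = 0}

/-- `X` and `Y` are disjoint at infinity: their projective closures have no common point on the
hyperplane at infinity. -/
def DisjointAtInfinity {n : ℕ} (X Y : Set (Fin n → k)) : Prop :=
  projectiveClosure X ∩ projectiveClosure Y ∩ hyperplaneAtInfinity k n = ∅

/-- The setwise join: the union of the lines through distinct points `a ∈ A` and `b ∈ B`. -/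
def setJoin {N : ℕ} (A B : Set (ℙ k (Fin (N + 1) → k))) : Set (ℙ k (Fin (N + 1) → k)) :=
  {p | ∃ a ∈ A, ∃ b ∈ B, a ≠ b ∧ p.submodule ≤ a.submodule ⊔ b.submodule}

/-- The join: the Zariski closure of the setwise join. -/
def join {N : ℕ} (A B : Set (ℙ k (Fin (N + 1) → k))) : Set (ℙ k (Fin (N + 1) → k)) :=
  projZariskiClosure (setJoin A B)

/-- The slice `X × {z} ⊆ 𝔸ⁿ⁺¹`. -/
def slice {n : ℕ} (X : Set (Fin n → k)) (z : k) : Set (Fin (n + 1) → k) :=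
  (fun x => Fin.snoc (α := fun _ => k) x z) '' X

/-! ### Dimension and degree -/

/-- The affine variety `X` has dimension `d`: its coordinate ring has Krull dimension `d`. -/
def HasAffineDim {n : ℕ} (X : Set (Fin n → k)) (d : ℕ) : Prop :=
  ringKrullDim (MvPolynomial (Fin n) k ⧸ MvPolynomial.vanishingIdeal k X) = d

/-- The projective variety `Z` has dimension `d`: its homogeneous coordinate ring has Krull
dimension `d + 1`. -/
def HasProjDim {N : ℕ} (Z : Set (ℙ k (Fin (N + 1) → k))) (d : ℕ) : Prop :=
  ringKrullDim (MvPolynomial (Fin (N + 1)) k ⧸ homogeneousVanishingIdeal Z) = d + 1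

/-- `P` holds for a general linear subspace of codimension `c` in `ℙᴺ`, given as a linear subspace
of `kᴺ⁺¹`. A subspace of codimension `c` is the kernel of a `c × (N + 1)` matrix with linearly
independent rows, and `P` has to hold for all those matrices that lie outside the zero locus of
some nonzero polynomial in the entries. -/
def ForGeneralSubspace {N : ℕ} (c : ℕ) (P : Submodule k (Fin (N + 1) → k) → Prop) : Prop :=
  ∃ F : MvPolynomial (Fin c × Fin (N + 1)) k, F ≠ 0 ∧
    ∀ A : Matrix (Fin c) (Fin (N + 1)) k, LinearIndependent k A.row →
      MvPolynomial.eval (fun ij => A ij.1 ij.2) F ≠ 0 → P (LinearMap.ker A.mulVecLin)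

/-- The degree of `X ⊆ 𝔸ⁿ` is `δ`: with `d = dim X`, a general affine-linear subspace of dimension
`n - d` meets `X` in exactly `δ` points. The affine-linear subspace is the affine part
`{x | (1, x) ∈ W}` of a linear subspace of `ℙⁿ` of codimension `d`. -/
def HasAffineDegree {n : ℕ} (X : Set (Fin n → k)) (δ : ℕ) : Prop :=
  ∃ d : ℕ, HasAffineDim X d ∧
    ForGeneralSubspace (N := n) d fun W => {x ∈ X | homogenize x ∈ W}.encard = δ

/-- The degree of `Z ⊆ ℙᴺ` is `δ`: with `d = dim Z`, a general linear subspace of dimension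
`N - d` meets `Z` in exactly `δ` points. -/
def HasProjDegree {N : ℕ} (Z : Set (ℙ k (Fin (N + 1) → k))) (δ : ℕ) : Prop :=
  ∃ d : ℕ, HasProjDim Z d ∧
    ForGeneralSubspace d fun W => {p ∈ Z | p.submodule ≤ W}.encard = δ

end MinkowskiJoin

namespace MinkowskiJoin

universe u

/-! ### Counting points of fibres near a prime divisor of the base -/

section Spreading

open TensorProduct

/-! Both degrees count the points in a general fibre of a linear projection of one and the same
cone. Let C be the closure of the set of all vectors (s, r, s x + r y) with s, r nonzero, x in X and
y in Y (`sumCone`). The linear map (u₀, u₁, w) ↦ (u₀ + u₁, w, z₀ u₀ + z₁ u₁) is invertible because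
z₀ ≠ z₁, and it carries C to the affine cone over the join (`homogeneousVanishingIdeal_setJoin`). On
the other hand, the slice u₀ = α, u₁ = 1 of C is αX + Y. This is where disjointness at infinity
enters: if points a, b of the closed cones over X and Y have leading coordinates zero and a + b = 0,
then b = -a lies at infinity in both cones, so a = b = 0. Hence the product of the cones is finite
over C (`finite_sumToProd`), every point of C comes from a pair, and αX + Y is already closed
(`mem_zeroLocus_sumCone_iff`, `minkowskiSum_eq`).

Let dim C = d + 2. A section of the join by a general linear space of codimension d + 1, normalised
by one affine equation, is a fibre of a general linear map from C to affine (d + 2)-space. A section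
of αX + Y by a general affine space of codimension d is, up to scaling, a fibre of a map of the
special shape (u₀, u₁, ℓ₁(w), …, ℓ_d(w)). So it has to be shown that general maps of the special
shape and general maps without restriction have equally large fibres.

For this, `exists_good_projection` finds one ℓ such that (u₀, u₁, ℓ) is finite on C and unramified
at the generic points of C. Finiteness is possible because the locus u₀ = u₁ = 0 of C has
codimension at least two; unramifiedness because du₀ and du₁ are independent on every component, in
every characteristic. Let e be the generic rank of this projection A₀, and deform it to A₀ + tE.
Where a certain determinant is invertible, the family is finite. At the prime (t) the base is a
discrete valuation ring, and the coordinate ring has no t-torsion, so it is free there, of rank e.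
Freeness and unramifiedness spread to a dense open set of parameters, and the general fibre of the
deformed map has exactly e points (`exists_generic_encard`).

Taking E with all entries indeterminate gives the degree of the join; taking E supported in the
w-block gives the degree of αX + Y. In the second case the genericity condition depends on α through
a nonzero polynomial in one variable, so only finitely many α are lost. -/

theorem free_localizedModule_of_isSMulRegular {P M : Type u} [CommRing P] [IsDomain P]
    [IsNoetherianRing P] [AddCommGroup M] [Module P M] [Module.Finite P M] (t : P) (ht : Prime t)
    (hreg : IsSMulRegular M t) (p : Ideal P) [hp : p.IsPrime] (hpdef : p = Ideal.span {t}) :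
    Module.Free (Localization.AtPrime p) (LocalizedModule.AtPrime p M) := by
  -- The maximal ideal of the local ring at (t) is principal, so this ring is a discrete valuation
  -- ring, over which a finite torsion-free module is free. Torsion reduces to powers of t, which
  -- act injectively.
  have hmax : IsLocalRing.maximalIdeal (Localization.AtPrime p) =
      Ideal.span {algebraMap P (Localization.AtPrime p) t} := by
    rw [← Localization.AtPrime.map_eq_maximalIdeal, ← Set.image_singleton, ← Ideal.map_span]
    exact congrArg _ hpdef
  have hinj : Function.Injective (algebraMap P (Localization.AtPrime p)) :=
    IsLocalization.injective _ p.primeCompl_le_nonZeroDivisors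
  have ht0 : algebraMap P (Localization.AtPrime p) t ≠ 0 := by
    rw [Ne, map_eq_zero_iff _ hinj]; exact ht.ne_zero
  have hnf : ¬ IsField (Localization.AtPrime p) := by
    rw [IsLocalRing.isField_iff_maximalIdeal_eq, hmax, Ideal.span_singleton_eq_bot]
    exact ht0
  have hdvr : IsDiscreteValuationRing (Localization.AtPrime p) := by
    apply ((IsDiscreteValuationRing.TFAE (Localization.AtPrime p) hnf).out 0 4).mpr
    exact ⟨⟨_, hmax⟩⟩
  have hirr : Irreducible (algebraMap P (Localization.AtPrime p) t) :=
    (IsDiscreteValuationRing.irreducible_iff_uniformizer _).mpr hmax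
  have hreg' : ∀ x : LocalizedModule.AtPrime p M,
      algebraMap P (Localization.AtPrime p) t • x = 0 → x = 0 := by
    intro x hx
    rw [algebraMap_smul] at hx
    induction x using LocalizedModule.induction_on with
    | h m s =>
      rw [LocalizedModule.smul'_mk, ← LocalizedModule.zero_mk s, LocalizedModule.mk_eq] at hx
      obtain ⟨c, hc⟩ := hx
      rw [← LocalizedModule.zero_mk s, LocalizedModule.mk_eq]
      refine ⟨c, hreg ?_⟩
      simp only [smul_zero] at hc ⊢
      rw [← hc, smul_comm t c, smul_comm t s]
  have : Module.Flat (Localization.AtPrime p) (LocalizedModule.AtPrime p M) := by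
    rw [IsDedekindDomain.flat_iff_torsion_eq_bot, eq_bot_iff]
    intro x hx
    obtain ⟨a, ha⟩ := (Submodule.mem_torsion_iff x).mp hx
    obtain ⟨n, v, hv⟩ := IsDiscreteValuationRing.eq_unit_mul_pow_irreducible
      (nonZeroDivisors.ne_zero a.2) hirr
    have h1 : (algebraMap P (Localization.AtPrime p) t) ^ n • x = 0 := by
      have h2 : (a : Localization.AtPrime p) • x = 0 := ha
      rw [hv, mul_smul] at h2
      have h3 := congrArg (fun y => (↑v⁻¹ : Localization.AtPrime p) • y) h2
      simpa [smul_smul] using h3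
    rw [Submodule.mem_bot]
    clear ha hv
    induction n with
    | zero => simpa using h1
    | succ n ih => 
      apply ih
      apply hreg'
      rw [smul_smul, ← pow_succ']; exact h1
  have : Module.Finite (Localization.AtPrime p) (LocalizedModule.AtPrime p M) := inferInstance
  exact Module.free_of_flat_of_isLocalRing

/-- A finite unramified algebra over an algebraically closed field is a finite product of copies of
the field, and its points are the coordinate projections. -/
theorem card_algHom_eq_finrank {k A : Type u} [Field k] [IsAlgClosed k] [CommRing A] [Algebra k A]
    [Module.Finite k A] [Algebra.FormallyUnramified k A] :
    Nat.card (A →ₐ[k] k) = Module.finrank k A := by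
  have := Algebra.FormallyEtale.of_formallyUnramified_of_field k A
  let φ := Algebra.FormallyEtale.equivPiOfIsSepClosed k A
  have : IsArtinianRing A := isArtinian_of_tower k inferInstance
  have : Finite (PrimeSpectrum A) := inferInstance
  have := Fintype.ofFinite (PrimeSpectrum A)
  rw [φ.toLinearEquiv.finrank_eq, Module.finrank_fintype_fun_eq_card, ← Nat.card_eq_fintype_card]
  refine Nat.card_congr (Equiv.ofBijective
    (fun p => (Pi.evalAlgHom k (fun _ => k) p).comp φ.toAlgHom : PrimeSpectrum A → (A →ₐ[k] k)) ⟨?_, ?_⟩).symm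
  · intro p q h
    classical
    have h1 := DFunLike.congr_fun h (φ.symm (Pi.single p 1))
    simp at h1
    by_contra hne
    simp [Pi.single_eq_of_ne (Ne.symm hne)] at h1
  · intro ψ
    classical
    by_contra! hc
    let χ := ψ.comp φ.symm.toAlgHom
    -- The idempotents sum to 1, so some idempotent survives under χ; multiplying by it shows that χ
    -- is the corresponding projection.
    have : ∃ p, χ (Pi.single p 1) ≠ 0 := by
      by_contra! h0
      have h1 : (1 : PrimeSpectrum A → k) = ∑ p, Pi.single p 1 := by
        ext q; simp [Finset.sum_apply, Pi.single_apply]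
      have := congrArg χ h1
      rw [map_one, map_sum, Finset.sum_eq_zero (fun p _ => h0 p)] at this
      exact one_ne_zero this
    obtain ⟨p, hp⟩ := this
    apply hc p
    ext a
    have h2 : φ a * Pi.single p 1 = (φ a p) • (Pi.single p 1 : PrimeSpectrum A → k) := by
      ext q; by_cases h : q = p
      · subst h; simp
      · simp [Pi.single_eq_of_ne h]
    have h3 := congrArg χ h2
    rw [map_mul, map_smul, smul_eq_mul] at h3
    have h4 := mul_right_cancel₀ hp h3
    simpa [χ] using h4.symm

/-- Two open conditions hold at the prime (t): R is free there, and its differentials vanish there.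
Each holds away from one element outside (t), and f is the product of the two elements. Geometric
fibres over points where f is nonzero are thus reduced, with as many points as the rank. -/
theorem exists_card_algHom_eq_of_formallyUnramified_fiber {P R : Type u} [CommRing P] [IsDomain P]
    [IsNoetherianRing P] [CommRing R] [Algebra P R] [Module.Finite P R] (t : P) (ht : Prime t)
    (hreg : IsSMulRegular R t) (p : Ideal P) [hp : p.IsPrime] (hpdef : p = Ideal.span {t})
    [Algebra.FormallyUnramified p.ResidueField (p.ResidueField ⊗[P] R)] :
    ∃ f : P, ¬ t ∣ f ∧ ∀ (k : Type u) [Field k] [IsAlgClosed k] [Algebra P k],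
      algebraMap P k f ≠ 0 → Finite (R →ₐ[P] k) ∧ Nat.card (R →ₐ[P] k) =
        Module.finrank p.ResidueField (p.ResidueField ⊗[P] R) := by
  have hfree := free_localizedModule_of_isSMulRegular (M := R) t ht hreg p hpdef
  let _ := Algebra.TensorProduct.rightAlgebra (R := P) (A := p.ResidueField) (B := R)
  have hfp : Module.FinitePresentation P R := Module.finitePresentation_of_finite P R
  obtain ⟨r₁, hr₁, hfree₁, hrank₁⟩ := Module.FinitePresentation.exists_free_localizedModule_powers
    p.primeCompl (LocalizedModule.mkLinearMap p.primeCompl R) (Localization.AtPrime p)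
  have hΩfin : Module.Finite P (Ω[R⁄P]) := Module.Finite.trans R _
  -- The differentials, tensored with the residue field, are those of the unramified fibre, hence
  -- zero; by Nakayama something outside p annihilates them.
  have hsupp : (⟨p, hp⟩ : PrimeSpectrum P) ∉ Module.support P (Ω[R⁄P]) := by
    rw [Module.mem_support_iff_nontrivial_residueField_tensorProduct, not_nontrivial_iff_subsingleton]
    exact (KaehlerDifferential.tensorKaehlerEquivBase P p.ResidueField R
      (p.ResidueField ⊗[P] R)).toEquiv.subsingleton
  rw [Module.mem_support_iff_of_finite] at hsupp
  obtain ⟨r₂, hr₂, hr₂p⟩ := SetLike.not_le_iff_exists.mp hsupp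
  refine ⟨r₁ * r₂, ?_, ?_⟩
  · rw [← Ideal.mem_span_singleton, ← hpdef]
    exact fun h => (hp.mem_or_mem h).elim hr₁ hr₂p
  intro k _ _ _ hk
  rw [map_mul] at hk
  have hk₁ := left_ne_zero_of_mul hk
  have hk₂ := right_ne_zero_of_mul hk
  have hunr : Algebra.FormallyUnramified k (k ⊗[P] R) := by
    let _ := Algebra.TensorProduct.rightAlgebra (R := P) (A := k) (B := R)
    constructor
    refine (KaehlerDifferential.tensorKaehlerEquivBase P k R (k ⊗[P] R)).symm.toEquiv.subsingleton_congr.mpr ?_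
    refine ⟨fun x y => ?_⟩
    have hz : ∀ z : k ⊗[P] Ω[R⁄P], z = 0 := by
      intro z
      induction z with
      | zero => rfl
      | add a b ha hb => rw [ha, hb, add_zero]
      | tmul a b =>
        have : a = r₂ • (a * (algebraMap P k r₂)⁻¹) := by
          rw [Algebra.smul_def]; field_simp
        rw [this, TensorProduct.smul_tmul, Module.mem_annihilator.mp hr₂ b, TensorProduct.tmul_zero]
    rw [hz x, hz y]
  have hfink : Module.Finite k (k ⊗[P] R) := inferInstance
  have hcard := card_algHom_eq_finrank (k := k) (A := k ⊗[P] R)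
  have e := AlgHom.liftEquiv P k R k
  have hfinite : Finite (k ⊗[P] R →ₐ[k] k) := inferInstance
  refine ⟨Finite.of_equiv _ e.symm, ?_⟩
  rw [Nat.card_congr e, hcard]
  -- The rank of a fibre at any field-valued point of a localization over which R becomes free is
  -- the rank of that free module. This is used for k, over the locus where `r₁` is inverted, and
  -- for the residue field of p.
  have key : ∀ (Q : Type u) [CommRing Q] [Algebra P Q] (M' : Submonoid P) [IsLocalization M' Q]
     (N : Type u) [AddCommGroup N] [Module P N] [Module Q N] [IsScalarTower P Q N] (φ : R →ₗ[P] N) [IsLocalizedModule M' φ] [Module.Free Q N] (F : Type u) [Field F] [Algebra P F]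
     (h : ∀ m ∈ M', algebraMap P F m ≠ 0), Module.finrank F (F ⊗[P] R) = Module.finrank Q N := by
    intro Q _ _ M' _ N _ _ _ _ φ _ _ F _ _ h
    let : Algebra Q F := (IsLocalization.lift (M := M') (g := algebraMap P F) (fun m => (h m m.2).isUnit)).toAlgebra
    have : IsScalarTower P Q F := IsScalarTower.of_algebraMap_eq (fun x => by
      rw [RingHom.algebraMap_toAlgebra, IsLocalization.lift_eq])
    have hb : IsBaseChange Q φ := (isLocalizedModule_iff_isBaseChange M' Q φ).mp inferInstance
    have : Nontrivial Q := (algebraMap Q F).domain_nontrivial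
    rw [← (AlgebraTensorModule.cancelBaseChange P Q F F R).finrank_eq]
    have := hb.equiv
    rw [← Module.finrank_baseChange (R := F) (M' := N)]
    exact (LinearEquiv.baseChange Q F _ _ this).finrank_eq
  have hpow : ∀ m ∈ Submonoid.powers r₁, algebraMap P k m ≠ 0 := by
    rintro _ ⟨n, rfl⟩
    simpa using fun h => absurd h hk₁
  rw [key (Localization (.powers r₁)) (.powers r₁) (LocalizedModule.Away r₁ R)
    (LocalizedModule.mkLinearMap _ _) k hpow, hrank₁,
    key (Localization.AtPrime p) p.primeCompl (LocalizedModule p.primeCompl R)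
    (LocalizedModule.mkLinearMap _ _) p.ResidueField ?_]
  intro m hm h
  exact hm (by rwa [Ideal.algebraMap_residueField_eq_zero] at h)

end Spreading

/-! ### Krull dimension under integral maps and hypersurface sections -/

section KrullDim

theorem ringKrullDim_le_of_isIntegral {A B : Type*} [CommRing A] [CommRing B] (f : A →+* B)
    (hf : f.IsIntegral) : ringKrullDim B ≤ ringKrullDim A := by
  let _ := f.toAlgebra
  have : Algebra.IsIntegral A B := ⟨hf⟩
  refine Order.krullDim_le_of_strictMono (PrimeSpectrum.comap (algebraMap A B)) fun p q hpq => ?_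
  exact Ideal.IsIntegral.comap_lt_comap (R := A) (I := p.asIdeal) (J := q.asIdeal) hpq

theorem ringKrullDim_le_of_isIntegral_of_comap_surjective {A B : Type*} [CommRing A] [CommRing B]
    (f : A →+* B) (hf : f.IsIntegral) (hs : Function.Surjective (PrimeSpectrum.comap f)) :
    ringKrullDim A ≤ ringKrullDim B := by
  let _ := f.toAlgebra
  have : Algebra.IsIntegral A B := ⟨hf⟩
  refine iSup_le fun l => ?_
  obtain ⟨P, hP⟩ := hs l.head
  have : P.asIdeal.LiesOver l.head.asIdeal := ⟨by rw [← hP]; rfl⟩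
  obtain ⟨L, hL, -⟩ := Ideal.exists_ltSeries_of_hasGoingUp l P.asIdeal
  rw [← hL]
  exact le_iSup (fun p : LTSeries (PrimeSpectrum B) => (p.length : WithBot ℕ∞)) L

theorem ringKrullDim_eq_of_isIntegral_of_injective {A B : Type*} [CommRing A] [CommRing B]
    (f : A →+* B) (hf : f.IsIntegral) (hi : Function.Injective f) :
    ringKrullDim A = ringKrullDim B :=
  le_antisymm (ringKrullDim_le_of_isIntegral_of_comap_surjective f hf (hf.comap_surjective hi))
    (ringKrullDim_le_of_isIntegral f hf)

/-- A chain of primes over J and x starts above a minimal prime r of J. If x is not in r, the chain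
can be prolonged downwards by r; if x is in r, then r is maximal and the chain has length zero. -/
theorem ringKrullDim_quotient_sup_span_singleton_le {S : Type*} [CommRing S] (J : Ideal S) (x : S)
    (d : ℕ) (hd : ringKrullDim (S ⧸ J) ≤ (d + 1 : ℕ))
    (h : ∀ p ∈ J.minimalPrimes, x ∈ p → p.IsMaximal) :
    ringKrullDim (S ⧸ (J ⊔ Ideal.span {x})) ≤ d := by
  rw [ringKrullDim_quotient] at hd ⊢
  refine iSup_le fun l => ?_
  have hsub : ∀ p : PrimeSpectrum S, p ∈ PrimeSpectrum.zeroLocus ((J ⊔ Ideal.span {x} : Ideal S) : Set S) →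
      J ≤ p.asIdeal ∧ x ∈ p.asIdeal := by
    intro p hp
    have hp : (J ⊔ Ideal.span {x} : Ideal S) ≤ p.asIdeal := hp
    exact ⟨le_sup_left.trans hp, hp (Ideal.mem_sup_right (Ideal.mem_span_singleton_self x))⟩
  let L : LTSeries (PrimeSpectrum.zeroLocus (J : Set S)) :=
    l.map (fun p => ⟨p.1, (hsub p.1 p.2).1⟩) fun _ _ h => h
  obtain ⟨r, hrm, hr⟩ := Ideal.exists_minimalPrimes_le (hsub _ l.head.2).1
  have hrp : r.IsPrime := hrm.1.1
  by_cases hx : x ∈ r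
  · have hmax := h r hrm hx
    have : l.length = 0 := by
      by_contra hne
      have hlt : l.head < l.last := by
        exact l.strictMono (Fin.pos_iff_ne_zero.mpr fun h0 => hne (by simpa using congrArg Fin.val h0) :
          (0 : Fin (l.length + 1)) < Fin.last l.length)
      have h1 : r < l.last.1.asIdeal := lt_of_le_of_lt hr hlt
      exact l.last.1.2.ne_top (hmax.out.2 _ h1)
    rw [this]; exact_mod_cast Nat.zero_le d
  · have hlt : (⟨⟨r, hrp⟩, hrm.1.2⟩ : PrimeSpectrum.zeroLocus (J : Set S)) < L.head :=
      lt_of_le_of_ne hr fun heq => hx (by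
        have h2 : r = l.head.1.asIdeal := congrArg (fun q => q.1.asIdeal) heq
        rw [h2]; exact (hsub _ l.head.2).2)
    have h3 : (((L.cons _ hlt).length : ℕ) : WithBot ℕ∞) ≤ (d + 1 : ℕ) :=
      (le_iSup (fun p : LTSeries (PrimeSpectrum.zeroLocus (J : Set S)) =>
        (p.length : WithBot ℕ∞)) _).trans hd
    rw [RelSeries.cons_length] at h3
    have h4 : l.length + 1 ≤ d + 1 := by exact_mod_cast h3
    exact_mod_cast (by omega : l.length ≤ d)

end KrullDim

/-! ### Homogeneous ideals and linear forms without common zeros on the cone -/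

section Graded
open MvPolynomial

variable {k : Type u} [Field k] {σ ι : Type*}

/-- An ideal of a polynomial ring is homogeneous: it contains the homogeneous components of its
elements. -/
def IsHomogeneousIdeal (I : Ideal (MvPolynomial σ k)) : Prop :=
  ∀ f ∈ I, ∀ m, homogeneousComponent m f ∈ I

/-- Every monomial of degree `m + 1` is, modulo `I`, a combination of the `L i` whose coefficients
are forms of degree `m`. -/
def GeneratesInDegree [Fintype ι] (I : Ideal (MvPolynomial σ k)) (L : ι → MvPolynomial σ k)
    (m : ℕ) : Prop :=
  ∀ μ : σ →₀ ℕ, μ.degree = m + 1 → ∃ p : ι → MvPolynomial σ k, (∀ i, (p i).IsHomogeneous m) ∧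
    monomial μ 1 - ∑ i, L i * p i ∈ I

theorem homogeneousComponent_mul_of_isHomogeneous_one {L p : MvPolynomial σ k}
    (hL : L.IsHomogeneous 1) (m : ℕ) :
    homogeneousComponent (m + 1) (L * p) = L * homogeneousComponent m p := by
  conv_lhs => rw [← sum_homogeneousComponent p, Finset.mul_sum, map_sum]
  have h1 : ∀ i, homogeneousComponent (m + 1) (L * homogeneousComponent i p) =
      if i = m then L * homogeneousComponent m p else 0 := by
    intro i
    rw [homogeneousComponent_of_mem (m := m + 1) (n := i + 1)
      (by rw [add_comm]; exact hL.mul (homogeneousComponent_isHomogeneous i p))]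
    by_cases h : i = m
    · simp [h]
    · rw [if_neg (by omega), if_neg h]
  simp_rw [h1]
  rw [Finset.sum_ite_eq']
  split_ifs with h
  · rfl
  · rw [homogeneousComponent_eq_zero, mul_zero]
    simpa using h

/-- This is the projective Nullstellensatz: linear forms that vanish together only at the vertex
generate, modulo I, a power of the irrelevant ideal. Taking homogeneous components makes the
coefficients homogeneous. -/
theorem exists_generatesInDegree [IsAlgClosed k] [Finite σ] [Fintype ι]
    {I : Ideal (MvPolynomial σ k)} (hI : IsHomogeneousIdeal I) {L : ι → MvPolynomial σ k}
    (hL : ∀ i, (L i).IsHomogeneous 1)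
    (h0 : ∀ v ∈ zeroLocus k I, (∀ i, eval v (L i) = 0) → v = 0) :
    ∃ m, GeneratesInDegree I L m := by
  set J := I ⊔ Ideal.span (Set.range L) with hJ
  have hrad : Ideal.span (Set.range (X : σ → MvPolynomial σ k)) ≤ J.radical := by
    rw [Ideal.span_le]
    rintro _ ⟨j, rfl⟩
    rw [← vanishingIdeal_zeroLocus_eq_radical (K := k)]
    intro v hv
    have h1 : v = 0 := by
      refine h0 v (fun f hf => hv f (Ideal.mem_sup_left hf)) fun i => ?_
      simpa using hv _ (Ideal.mem_sup_right (Ideal.subset_span ⟨i, rfl⟩))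
    simp [h1]
  obtain ⟨m, hm⟩ := Ideal.exists_pow_le_of_le_radical_of_fg hrad
    ⟨(Set.finite_range X).toFinset, by simp⟩
  -- Degree m already suffices for membership; degree m + 1 is used so that the coefficients have
  -- the natural degree m even when m = 0.
  refine ⟨m, fun μ hμ => ?_⟩
  have hmem : monomial μ (1 : k) ∈ J := by
    apply hm
    have h2 : monomial μ (1 : k) ∈ Ideal.span (Set.range (X : σ → MvPolynomial σ k)) ^ (m + 1) := by
      rw [← hμ, monomial_eq, C_1, one_mul, Finsupp.prod, Finsupp.degree_apply, ← Finset.prod_pow_eq_pow_sum]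
      exact Ideal.prod_mem_prod fun i _ => Ideal.pow_mem_pow (Ideal.subset_span (Set.mem_range_self i)) _
    exact Ideal.pow_le_pow_right (Nat.le_succ m) h2
  obtain ⟨a, ha, b, hb, hab⟩ := Submodule.mem_sup.mp hmem
  obtain ⟨c, rfl⟩ := (Ideal.mem_span_range_iff_exists_fun).mp hb
  refine ⟨fun i => homogeneousComponent m (c i), fun i => homogeneousComponent_isHomogeneous _ _, ?_⟩
  have h3 := congrArg (homogeneousComponent (m + 1)) hab
  have h4 : homogeneousComponent (m + 1) (monomial μ (1 : k)) = monomial μ 1 := by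
    rw [homogeneousComponent_of_mem (isHomogeneous_monomial _ hμ), if_pos rfl]
  rw [h4, map_add, map_sum] at h3
  rw [← h3]
  simp_rw [mul_comm (c _) (L _), homogeneousComponent_mul_of_isHomogeneous_one (hL _)]
  simpa using hI a ha _

end Graded

/-! ### A finiteness criterion by monomials -/

section Finite
open MvPolynomial

/-- If the monomials of degree `m` in generators `v` of an algebra are combinations of monomials of
smaller degree, then the algebra is finite. -/
theorem module_finite_of_monomial_mem {A T σ : Type*} [CommRing A] [CommRing T] [Algebra A T]
    [Finite σ] (v : σ → T) (hv : Function.Surjective (aeval v : MvPolynomial σ A →ₐ[A] T)) (m : ℕ)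
    (h : ∀ μ : σ →₀ ℕ, μ.degree = m → aeval v (monomial μ (1 : A)) ∈
      Submodule.span A ((fun ν => aeval v (monomial ν (1 : A))) '' {ν : σ →₀ ℕ | ν.degree < m})) :
    Module.Finite A T := by
  set N := Submodule.span A
    ((fun ν => aeval v (monomial ν (1 : A))) '' {ν : σ →₀ ℕ | ν.degree < m}) with hN
  have hfin : {ν : σ →₀ ℕ | ν.degree < m}.Finite := Finsupp.finite_of_degree_le m |>.subset fun ν hν => (le_of_lt hν : ν.degree ≤ m)
  have hmem : ∀ ν : σ →₀ ℕ, ν.degree ≤ m → aeval v (monomial ν (1 : A)) ∈ N := by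
    intro ν hν
    rcases hν.lt_or_eq with hlt | heq
    · exact Submodule.subset_span ⟨ν, hlt, rfl⟩
    · exact h ν heq
  -- A span that contains 1 and is stable under multiplication by the generators is the whole
  -- algebra.
  have hmul : ∀ (j : σ), ∀ x ∈ N, x * v j ∈ N := by
    intro j x hx
    induction hx using Submodule.span_induction with
    | mem x hx =>
      obtain ⟨ν, hν, rfl⟩ := hx
      have : aeval v (monomial ν (1 : A)) * v j = aeval v (monomial (ν + Finsupp.single j 1) (1 : A)) := by
        rw [← aeval_X (R := A) v j, ← map_mul, X, monomial_mul, one_mul]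
      simp only [this]
      apply hmem
      have hν : ν.degree < m := hν
      rw [map_add, Finsupp.degree_single]
      omega
    | zero => simp
    | add x y _ _ hx hy => rw [add_mul]; exact N.add_mem hx hy
    | smul a x _ hx => rw [smul_mul_assoc]; exact N.smul_mem a hx
  have htop : N = ⊤ := by
    rw [eq_top_iff]
    rintro x -
    obtain ⟨p, rfl⟩ := hv x
    induction p using MvPolynomial.induction_on with
    | C a =>
      have := N.smul_mem a (hmem 0 (by simp))
      rwa [← map_smul, smul_monomial, smul_eq_mul, mul_one] at this
    | add p q hp hq => rw [map_add]; exact N.add_mem hp hq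
    | mul_X p j hp => rw [map_mul, aeval_X]; exact hmul j _ hp
  exact ⟨htop ▸ Submodule.fg_span (hfin.image _)⟩

end Finite

/-! ### Families of projections degenerating to a given one at t = 0 -/

section Family
open MvPolynomial TensorProduct

/-- At t = 0 the perturbed functions `L'` become the original ones, so over a field in which t is
zero the fibre of the family is a base change of the unperturbed algebra. -/
theorem nonempty_algEquiv_fiber {k : Type u} [Field k] {ι : Type} {S : Type u}
    [CommRing S] [Algebra k S] [Algebra (MvPolynomial ι k) S]
    [IsScalarTower k (MvPolynomial ι k) S] {Q : Type u} [CommRing Q] [Algebra k Q] (t : Q)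
    (L' μ : ι → Q ⊗[k] S)
    (hL' : ∀ i, L' i = 1 ⊗ₜ algebraMap (MvPolynomial ι k) S (X i) + t • μ i)
    [Algebra (MvPolynomial ι Q) (Q ⊗[k] S)]
    (hR : ∀ x, algebraMap (MvPolynomial ι Q) (Q ⊗[k] S) x = aeval L' x)
    {κ : Type u} [Field κ] [Algebra (MvPolynomial ι Q) κ] [Algebra (MvPolynomial ι k) κ]
    [Algebra k κ] [IsScalarTower k (MvPolynomial ι k) κ] [IsScalarTower k (MvPolynomial ι Q) κ]
    (hκ : ∀ x, algebraMap (MvPolynomial ι k) κ x =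
      algebraMap (MvPolynomial ι Q) κ (map (algebraMap k Q) x))
    (ht : algebraMap (MvPolynomial ι Q) κ (C t) = 0) :
    Nonempty (κ ⊗[MvPolynomial ι Q] (Q ⊗[k] S) ≃ₐ[κ] κ ⊗[MvPolynomial ι k] S) := by
  let φ : Q ⊗[k] S →ₐ[k] κ ⊗[MvPolynomial ι k] S := Algebra.TensorProduct.lift
    ((Algebra.TensorProduct.includeLeft : κ →ₐ[k] κ ⊗[MvPolynomial ι k] S).comp
      ((IsScalarTower.toAlgHom k (MvPolynomial ι Q) κ).comp
        (IsScalarTower.toAlgHom k Q (MvPolynomial ι Q))))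
    ((Algebra.TensorProduct.includeRight :
      S →ₐ[MvPolynomial ι k] κ ⊗[MvPolynomial ι k] S).restrictScalars k)
    (fun _ _ => Commute.all _ _)
  have hφ : ∀ (q : Q) (s : S), φ (q ⊗ₜ s) = algebraMap (MvPolynomial ι Q) κ (C q) ⊗ₜ s := fun q s => by
    simp [φ, algebraMap_eq]
  have hφP : ∀ x : MvPolynomial ι Q, φ (algebraMap (MvPolynomial ι Q) (Q ⊗[k] S) x) =
      algebraMap (MvPolynomial ι Q) κ x ⊗ₜ 1 := by
    intro x
    have hφQ : ∀ q : Q, φ (algebraMap Q (Q ⊗[k] S) q) =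
        algebraMap (MvPolynomial ι Q) κ (C q) ⊗ₜ 1 := fun q => by
      rw [Algebra.TensorProduct.algebraMap_apply, hφ]; rfl
    have hφX : ∀ i, φ (L' i) = algebraMap (MvPolynomial ι Q) κ (X i) ⊗ₜ 1 := fun i => by
      rw [hL', map_add, Algebra.smul_def, map_mul, hφQ, ht,
        TensorProduct.zero_tmul, zero_mul, add_zero, hφ, C_1, map_one,
        Algebra.algebraMap_eq_smul_one, ← TensorProduct.smul_tmul, Algebra.smul_def, hκ, map_X,
        mul_one]
    rw [hR]
    induction x using MvPolynomial.induction_on with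
    | C a => rw [aeval_C, hφQ]
    | add p q hp hq => rw [map_add, map_add, hp, hq, map_add, TensorProduct.add_tmul]
    | mul_X p i hp =>
      rw [map_mul, map_mul, hp, map_mul, aeval_X, hφX, Algebra.TensorProduct.tmul_mul_tmul, mul_one]
  let φP : Q ⊗[k] S →ₐ[MvPolynomial ι Q] κ ⊗[MvPolynomial ι k] S :=
    { φ.toRingHom with commutes' := hφP }
  let F : κ ⊗[MvPolynomial ι Q] (Q ⊗[k] S) →ₐ[κ] κ ⊗[MvPolynomial ι k] S :=
    Algebra.TensorProduct.lift (Algebra.ofId κ _) φP (fun _ _ => Commute.all _ _)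
  have hF : ∀ (a : κ) (q : Q) (s : S), F (a ⊗ₜ (q ⊗ₜ s)) =
      (a * algebraMap (MvPolynomial ι Q) κ (C q)) ⊗ₜ s := fun a q s => by
    change algebraMap κ (κ ⊗[MvPolynomial ι k] S) a * φ (q ⊗ₜ s) = _
    rw [hφ, Algebra.TensorProduct.algebraMap_apply, Algebra.TensorProduct.tmul_mul_tmul, one_mul]
    rfl
  let ψ' : S →+* κ ⊗[MvPolynomial ι Q] (Q ⊗[k] S) :=
    (Algebra.TensorProduct.includeRight :
        Q ⊗[k] S →ₐ[MvPolynomial ι Q] κ ⊗[MvPolynomial ι Q] (Q ⊗[k] S)).toRingHom.comp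
      (Algebra.TensorProduct.includeRight : S →ₐ[k] Q ⊗[k] S).toRingHom
  have hψ' : ∀ s, ψ' s = 1 ⊗ₜ (1 ⊗ₜ s) := fun s => rfl
  have hQ1 : ∀ (a : κ) (x : MvPolynomial ι Q) (y : Q ⊗[k] S),
      a ⊗ₜ[MvPolynomial ι Q] (algebraMap (MvPolynomial ι Q) (Q ⊗[k] S) x * y) =
      (a * algebraMap (MvPolynomial ι Q) κ x) ⊗ₜ y := fun a x y => by
    rw [← Algebra.smul_def, ← TensorProduct.smul_tmul, Algebra.smul_def, mul_comm]
  have hRC : ∀ q : Q, algebraMap (MvPolynomial ι Q) (Q ⊗[k] S) (C q) = q ⊗ₜ 1 := fun q => by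
    rw [hR, aeval_C]; rfl
  have hψP : ∀ x : MvPolynomial ι k, ψ' (algebraMap (MvPolynomial ι k) S x) =
      algebraMap κ (κ ⊗[MvPolynomial ι Q] (Q ⊗[k] S)) (algebraMap (MvPolynomial ι k) κ x) := by
    intro x
    induction x using MvPolynomial.induction_on with
    | C a =>
      have h2 : (1 : Q) ⊗ₜ[k] algebraMap (MvPolynomial ι k) S (C a) =
          algebraMap (MvPolynomial ι Q) (Q ⊗[k] S) (C (algebraMap k Q a)) * 1 := by
        rw [mul_one, hRC, ← algebraMap_eq, ← IsScalarTower.algebraMap_apply,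
          Algebra.algebraMap_eq_smul_one, Algebra.algebraMap_eq_smul_one, TensorProduct.smul_tmul]
      rw [hψ', h2, hQ1, one_mul, hκ, map_C]
      rfl
    | add p q hp hq => rw [map_add, map_add, hp, hq, map_add, map_add]
    | mul_X p i hp =>
      rw [map_mul, map_mul, hp, map_mul, map_mul]
      congr 1
      have h1 : (1 : Q) ⊗ₜ[k] algebraMap (MvPolynomial ι k) S (X i) =
          algebraMap (MvPolynomial ι Q) (Q ⊗[k] S) (X i) * 1 -
          algebraMap (MvPolynomial ι Q) (Q ⊗[k] S) (C t) * μ i := by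
        rw [mul_one, hR, aeval_X, hL', hR, aeval_C, Algebra.smul_def, add_sub_cancel_right]
      rw [hψ', h1, TensorProduct.tmul_sub, hQ1, hQ1, ht, mul_zero, TensorProduct.zero_tmul,
        sub_zero, one_mul, hκ, map_X]
      rfl
  let ψ : S →ₐ[MvPolynomial ι k] κ ⊗[MvPolynomial ι Q] (Q ⊗[k] S) :=
    { ψ' with commutes' := hψP }
  let B : κ ⊗[MvPolynomial ι k] S →ₐ[κ] κ ⊗[MvPolynomial ι Q] (Q ⊗[k] S) :=
    Algebra.TensorProduct.lift (Algebra.ofId κ _) ψ (fun _ _ => Commute.all _ _)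
  have hB : ∀ (a : κ) (s : S), B (a ⊗ₜ s) = a ⊗ₜ (1 ⊗ₜ s) := fun a s => by
    change algebraMap κ (κ ⊗[MvPolynomial ι Q] (Q ⊗[k] S)) a * ψ' s = _
    rw [hψ', Algebra.TensorProduct.algebraMap_apply, Algebra.TensorProduct.tmul_mul_tmul, mul_one,
      one_mul]
    rfl
  refine ⟨AlgEquiv.ofAlgHom F B (AlgHom.ext fun x => ?_) (AlgHom.ext fun x => ?_)⟩
  · induction x with
    | zero => simp
    | add x y hx hy => rw [map_add, hx, hy, map_add]
    | tmul a s =>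
      rw [AlgHom.comp_apply, hB, hF, C_1, map_one, mul_one]; rfl
  · induction x with
    | zero => simp
    | add x y hx hy => rw [map_add, hx, hy, map_add]
    | tmul a y =>
      induction y with
      | zero => simp
      | add x y hx hy => rw [TensorProduct.tmul_add, map_add, hx, hy, map_add]
      | tmul q s =>
        rw [AlgHom.comp_apply, hF, hB, ← hQ1, hRC, Algebra.TensorProduct.tmul_mul_tmul, mul_one,
          one_mul]
        rfl

/-- Such a κ is an extension of the fraction field of the polynomial ring, and neither rank nor
unramifiedness changes under field extension. -/
theorem formallyUnramified_and_finrank_of_injective {k : Type u} [Field k] {ι : Type} {S : Type u}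
    [CommRing S] [Algebra (MvPolynomial ι k) S]
    [Algebra.FormallyUnramified (FractionRing (MvPolynomial ι k))
      (FractionRing (MvPolynomial ι k) ⊗[MvPolynomial ι k] S)]
    (κ : Type u) [Field κ] [Algebra (MvPolynomial ι k) κ]
    (hinj : Function.Injective (algebraMap (MvPolynomial ι k) κ)) :
    Algebra.FormallyUnramified κ (κ ⊗[MvPolynomial ι k] S) ∧
    Module.finrank κ (κ ⊗[MvPolynomial ι k] S) = Module.finrank (FractionRing (MvPolynomial ι k))
      (FractionRing (MvPolynomial ι k) ⊗[MvPolynomial ι k] S) := by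
  set K := FractionRing (MvPolynomial ι k)
  let _ : Algebra K κ := (IsFractionRing.lift hinj).toAlgebra
  have : IsScalarTower (MvPolynomial ι k) K κ := IsScalarTower.of_algebraMap_eq fun x => by
    rw [RingHom.algebraMap_toAlgebra, IsFractionRing.lift_algebraMap]
  let e := Algebra.TensorProduct.cancelBaseChange (MvPolynomial ι k) K κ κ S
  refine ⟨Algebra.FormallyUnramified.of_equiv e, ?_⟩
  rw [← e.toLinearEquiv.finrank_eq, Module.finrank_baseChange]

/-- The generic rank of the projection at t = 0 is also the number of points in the general fibre of
the family: the spreading result applies at the prime (t) of the polynomial ring over Q, where the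
fibre is the unperturbed one. -/
theorem exists_card_fiber {k : Type u} [Field k] [IsAlgClosed k] {ι : Type} [Finite ι] {S : Type u}
    [CommRing S] [Algebra k S] [Algebra (MvPolynomial ι k) S]
    [IsScalarTower k (MvPolynomial ι k) S]
    [Algebra.FormallyUnramified (FractionRing (MvPolynomial ι k))
      (FractionRing (MvPolynomial ι k) ⊗[MvPolynomial ι k] S)]
    {Q : Type u} [CommRing Q] [IsDomain Q] [IsNoetherianRing Q] [Algebra k Q] (t : Q) (ht : Prime t)
    (L' μ : ι → Q ⊗[k] S)
    (hL' : ∀ i, L' i = 1 ⊗ₜ algebraMap (MvPolynomial ι k) S (X i) + t • μ i)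
    (hfin : (aeval L' : MvPolynomial ι Q →ₐ[Q] Q ⊗[k] S).toRingHom.Finite) :
    ∃ f : MvPolynomial ι Q, f ≠ 0 ∧ ∀ (q : Q →ₐ[k] k) (c : ι → k), eval₂ (q : Q →+* k) c f ≠ 0 →
      {ψ : S →ₐ[k] k | ∀ i, Algebra.TensorProduct.lift q ψ (fun _ _ => Commute.all _ _) (L' i) = c i}.encard =
      Module.finrank (FractionRing (MvPolynomial ι k))
        (FractionRing (MvPolynomial ι k) ⊗[MvPolynomial ι k] S) := by
  let P := MvPolynomial ι Q
  let P₀ := MvPolynomial ι k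
  let R := Q ⊗[k] S
  let _ : Algebra P R := (aeval L' : MvPolynomial ι Q →ₐ[Q] Q ⊗[k] S).toRingHom.toAlgebra
  have halgPR : ∀ x : P, algebraMap P R x = aeval L' x := fun x => rfl
  have : Module.Finite P R := hfin
  have htC : Prime (C t : P) := (prime_C_iff ι).mpr ht
  let p : Ideal P := Ideal.span {C t}
  have hp : p.IsPrime := (Ideal.span_singleton_prime htC.ne_zero).mpr htC
  -- Q ⊗ S is flat over the domain Q because S is flat over the field k; hence t is regular on it.
  have hreg : IsSMulRegular R (C t : P) := by
    have h1 : IsSMulRegular R t := by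
      have h0 := IsSMulRegular.of_flat (S := R) (x := t) (IsRegular.of_ne_zero ht.ne_zero).left
      intro x y hxy
      exact h0 (by simpa [Algebra.smul_def] using hxy)
    intro x y hxy
    apply h1
    have h2 : ∀ z : R, (C t : P) • z = t • z := fun z => by
      rw [Algebra.smul_def, halgPR, aeval_C, Algebra.smul_def]
    simpa [h2] using hxy
  let _ : Algebra P₀ P := (map (algebraMap k Q)).toAlgebra
  let κ := p.ResidueField
  let _ : Algebra P₀ κ := ((algebraMap P κ).comp (algebraMap P₀ P)).toAlgebra
  have hP₀κ : ∀ x : P₀, algebraMap P₀ κ x = algebraMap P κ (map (algebraMap k Q) x) := fun x => rfl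
  -- A nonzero polynomial with coefficients in k has a coefficient that is a unit of Q, so the prime
  -- t cannot divide it.
  have hinj : Function.Injective (algebraMap P₀ κ) := by
    rw [injective_iff_map_eq_zero]
    intro x hx
    rw [hP₀κ, Ideal.algebraMap_residueField_eq_zero, Ideal.mem_span_singleton] at hx
    obtain ⟨y, hy⟩ := hx
    by_contra hne
    obtain ⟨s, hs⟩ := ne_zero_iff.mp hne
    have h1 := congrArg (coeff s) hy
    rw [coeff_map, coeff_C_mul] at h1
    apply ht.not_isUnit
    apply isUnit_of_dvd_unit (Dvd.intro _ h1.symm)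
    exact (IsUnit.mk0 _ hs).map (algebraMap k Q)
  have htκ : algebraMap P κ (C t) = 0 := by
    rw [Ideal.algebraMap_residueField_eq_zero]; exact Ideal.mem_span_singleton_self _
  have : IsScalarTower P₀ P κ := IsScalarTower.of_algebraMap_eq fun x => rfl
  have : IsScalarTower k P₀ κ := IsScalarTower.of_algebraMap_eq fun x => by
    rw [hP₀κ, algebraMap_eq, map_C, IsScalarTower.algebraMap_apply k P κ]
    rfl
  obtain ⟨e⟩ := nonempty_algEquiv_fiber (S := S) t L' μ hL' halgPR hP₀κ htκ
  obtain ⟨hunr, hrank⟩ := formallyUnramified_and_finrank_of_injective (S := S) κ hinj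
  have hunr' : Algebra.FormallyUnramified κ (κ ⊗[P] R) := Algebra.FormallyUnramified.of_equiv e.symm
  obtain ⟨f, hf, hcard⟩ := exists_card_algHom_eq_of_formallyUnramified_fiber (C t : P) htC hreg p rfl
  refine ⟨f, fun h0 => hf (h0 ▸ dvd_zero _), fun q c hqc => ?_⟩
  let _ : Algebra P k := (eval₂Hom (q : Q →+* k) c).toAlgebra
  obtain ⟨hfinite, hc⟩ := hcard k hqc
  rw [← hrank, ← e.toLinearEquiv.finrank_eq, ← hc]
  have hQk : ∀ x : Q, algebraMap P k (C x) = q x := fun x => by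
    change eval₂Hom (q : Q →+* k) c (C x) = q x
    simp
  have hXk : ∀ i, algebraMap P k (X i) = c i := fun i => by
    change eval₂Hom (q : Q →+* k) c (X i) = c i
    simp
  have hRC : ∀ x : Q, algebraMap P R (C x) = x ⊗ₜ 1 := fun x => by
    rw [halgPR, aeval_C]; rfl
  have hcomm : ∀ (χ : R →ₐ[P] k) (a : k), χ.toRingHom (algebraMap k R a) = a := fun χ a => by
    change χ ((algebraMap k Q a) ⊗ₜ 1) = _
    rw [← hRC, χ.commutes, hQk, q.commutes]; rfl
  let Θ : (R →ₐ[P] k) → (S →ₐ[k] k) := fun χ =>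
    ({ χ.toRingHom with commutes' := hcomm χ } : R →ₐ[k] k).comp
      (Algebra.TensorProduct.includeRight : S →ₐ[k] R)
  have hΘ : ∀ χ s, Θ χ s = χ (1 ⊗ₜ s) := fun χ s => rfl
  have hfib : ∀ χ : R →ₐ[P] k, ∀ x,
      Algebra.TensorProduct.lift q (Θ χ) (fun _ _ => Commute.all _ _) x = χ x := by
    intro χ x
    induction x with
    | zero => simp
    | add x y hx hy => rw [map_add, hx, hy, map_add]
    | tmul a s =>
      rw [Algebra.TensorProduct.lift_tmul, hΘ, ← hQk, ← χ.commutes, hRC, ← map_mul,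
        Algebra.TensorProduct.tmul_mul_tmul, mul_one, one_mul]
  have hΘinj : Function.Injective Θ := fun χ χ' h => AlgHom.ext fun x => by
    rw [← hfib χ, ← hfib χ', h]
  -- A point of R over (q, c) is a point ψ of S together with q, subject to the perturbed functions
  -- taking the values c.
  have hset : {ψ : S →ₐ[k] k | ∀ i, Algebra.TensorProduct.lift q ψ (fun _ _ => Commute.all _ _)
      (L' i) = c i} = Set.range Θ := by
    ext ψ
    constructor
    · intro hψ
      let χ₀ := Algebra.TensorProduct.lift q ψ (fun _ _ => Commute.all _ _)
      have hχ₀ : ∀ x : P, χ₀ (algebraMap P R x) = algebraMap P k x := by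
        intro x
        induction x using MvPolynomial.induction_on with
        | C a => rw [hRC, hQk, Algebra.TensorProduct.lift_tmul, map_one, mul_one]
        | add x y hx hy => rw [map_add, map_add, hx, hy, map_add]
        | mul_X x i hx =>
          rw [map_mul, map_mul, hx, map_mul, hXk, ← hψ i, halgPR (X i), aeval_X]
      let χ : R →ₐ[P] k := { χ₀.toRingHom with commutes' := hχ₀ }
      refine ⟨χ, AlgHom.ext fun s => ?_⟩
      change χ₀ (1 ⊗ₜ s) = _
      rw [Algebra.TensorProduct.lift_tmul, map_one, one_mul]
    · rintro ⟨χ, rfl⟩ i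
      rw [hfib, ← hXk, ← χ.commutes, halgPR, aeval_X]
  rw [hset, ← Set.image_univ, hΘinj.encard_image, Set.encard_univ]
  exact ENat.card_eq_coe_natCard _

end Family

/-! ### Finiteness of perturbed linear projections -/

section Perturb
open MvPolynomial TensorProduct

/-- The matrix by which the monomials `ν` of one degree enter when the linear forms are perturbed by
`E` in relations with coefficients `p`. -/
noncomputable def perturbMatrix {k Q σ ι M : Type*} [CommRing k] [CommRing Q] [Algebra k Q] [Fintype σ]
    [Fintype ι] (e : M → σ →₀ ℕ) (p : M → ι → MvPolynomial σ k) (E : Matrix ι σ Q) :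
    Matrix M M Q :=
  Matrix.of fun μ ν => ∑ i, ∑ j, E i j * algebraMap k Q (coeff (e ν) (X j * p μ i))

theorem map_perturbMatrix {k Q Q' σ ι M : Type*} [CommRing k] [CommRing Q] [Algebra k Q]
    [CommRing Q'] [Algebra k Q'] [Fintype σ] [Fintype ι] (e : M → σ →₀ ℕ)
    (p : M → ι → MvPolynomial σ k) (E : Matrix ι σ Q) (φ : Q →ₐ[k] Q') :
    (perturbMatrix e p E).map φ = perturbMatrix e p (E.map φ) := by
  ext μ ν
  simp [perturbMatrix]

theorem perturbMatrix_zero {k Q σ ι M : Type*} [CommRing k] [CommRing Q] [Algebra k Q] [Fintype σ]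
    [Fintype ι] (e : M → σ →₀ ℕ) (p : M → ι → MvPolynomial σ k) :
    perturbMatrix (Q := Q) e p 0 = 0 := by
  ext μ ν
  simp [perturbMatrix]

/-- The monomials of one degree satisfy a linear system whose matrix is `1 + perturbMatrix`. -/
theorem one_add_perturbMatrix_mulVec {k Q T σ ι M : Type*} [CommRing k] [CommRing Q] [Algebra k Q]
    [CommRing T] [Algebra k T] [Algebra Q T] [IsScalarTower k Q T] [Fintype σ] [Fintype ι] [Fintype M] [DecidableEq M]
    {m : ℕ} (e : M → σ →₀ ℕ) (hinj : Function.Injective e) (he : ∀ ν : σ →₀ ℕ, ν.degree = m + 1 ↔ ν ∈ Set.range e)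
    (p : M → ι → MvPolynomial σ k) (hp : ∀ μ i, (p μ i).IsHomogeneous m) (v : σ → T) (L : ι → T)
    (hrel : ∀ μ, aeval v (monomial (e μ) (1 : k)) = ∑ i, L i * aeval v (p μ i))
    (E : Matrix ι σ Q) :
    (((1 + perturbMatrix e p E).map (algebraMap Q T)).mulVec
      fun ν => aeval v (monomial (e ν) (1 : k))) =
      fun μ => ∑ i, (L i + ∑ j, E i j • v j) * aeval v (p μ i) := by
  classical
  have hexp : ∀ (μ : M) (i : ι) (j : σ), v j * aeval v (p μ i) =
      ∑ ν, algebraMap k T (coeff (e ν) (X j * p μ i)) * aeval v (monomial (e ν) (1 : k)) := by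
    intro μ i j
    have hhom : (X j * p μ i).IsHomogeneous (m + 1) := by
      rw [add_comm]; exact (isHomogeneous_X k j).mul (hp μ i)
    have h1 : X j * p μ i = ∑ ν, C (coeff (e ν) (X j * p μ i)) * monomial (e ν) (1 : k) := by
      ext s
      simp only [coeff_sum, coeff_C_mul, coeff_monomial]
      by_cases hs : s.degree = m + 1
      · obtain ⟨ν, rfl⟩ := (he s).mp hs
        rw [Finset.sum_eq_single ν]
        · simp
        · intro b _ hb
          rw [if_neg (fun h => hb (hinj h)), mul_zero]
        · simp
      · rw [hhom.coeff_eq_zero hs, Finset.sum_eq_zero]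
        intro ν _
        rw [if_neg (fun h => hs ((he s).mpr ⟨ν, h⟩)), mul_zero]
    conv_lhs => rw [← aeval_X (R := k) v j, ← map_mul, h1, map_sum]
    simp
  ext μ
  simp only [Matrix.mulVec, dotProduct, Matrix.map_apply, Matrix.add_apply, map_add, add_mul,
    Finset.sum_add_distrib]
  congr 1
  · rw [Finset.sum_eq_single μ]
    · simp [hrel μ]
    · intro b _ hb
      simp [Matrix.one_apply_ne (Ne.symm hb)]
    · simp
  · simp only [perturbMatrix, Matrix.of_apply, map_sum, Finset.sum_mul, map_mul]
    rw [Finset.sum_comm]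
    refine Finset.sum_congr rfl fun i _ => ?_
    rw [Finset.sum_comm]
    refine Finset.sum_congr rfl fun j _ => ?_
    rw [smul_mul_assoc, hexp, Finset.smul_sum]
    refine Finset.sum_congr rfl fun ν _ => ?_
    rw [← IsScalarTower.algebraMap_apply, Algebra.smul_def, mul_assoc]

/-- Inverting `1 + perturbMatrix` writes each monomial of degree m + 1 as a combination of the
perturbed forms with coefficients of degree m, which is the input of the monomial criterion. -/
theorem finite_aeval_of_isUnit_det {k Q S σ ι M : Type*} [Field k] [CommRing Q] [Algebra k Q]
    [CommRing S] [Algebra k S] [Fintype σ] [Fintype ι] [Fintype M] [DecidableEq M]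
    {m : ℕ} (e : M → σ →₀ ℕ) (hinj : Function.Injective e)
    (he : ∀ ν : σ →₀ ℕ, ν.degree = m + 1 ↔ ν ∈ Set.range e)
    (p : M → ι → MvPolynomial σ k) (hp : ∀ μ i, (p μ i).IsHomogeneous m) (v : σ → S)
    (hv : Function.Surjective (aeval v : MvPolynomial σ k →ₐ[k] S)) (L : ι → S)
    (hrel : ∀ μ, aeval v (monomial (e μ) (1 : k)) = ∑ i, L i * aeval v (p μ i))
    (E : Matrix ι σ Q) (hE : IsUnit (1 + perturbMatrix e p E).det) :
    (aeval fun i => (1 : Q) ⊗ₜ[k] L i + ∑ j, E i j • ((1 : Q) ⊗ₜ[k] v j) :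
      MvPolynomial ι Q →ₐ[Q] Q ⊗[k] S).toRingHom.Finite := by
  set L' : ι → Q ⊗[k] S := fun i => (1 : Q) ⊗ₜ[k] L i + ∑ j, E i j • ((1 : Q) ⊗ₜ[k] v j) with hL'
  let _ : Algebra (MvPolynomial ι Q) (Q ⊗[k] S) :=
    (aeval L' : MvPolynomial ι Q →ₐ[Q] Q ⊗[k] S).toRingHom.toAlgebra
  have halg : ∀ x, algebraMap (MvPolynomial ι Q) (Q ⊗[k] S) x = aeval L' x := fun x => rfl
  let v' : σ → Q ⊗[k] S := fun j => 1 ⊗ₜ v j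
  have hv' : ∀ r : MvPolynomial σ k, aeval v' r = (1 : Q) ⊗ₜ[k] aeval v r := by
    intro r
    have : (aeval v' : MvPolynomial σ k →ₐ[k] Q ⊗[k] S) =
        (Algebra.TensorProduct.includeRight : S →ₐ[k] Q ⊗[k] S).comp (aeval v) := by
      ext j; simp [v']
    rw [this]; rfl
  have hmon : ∀ s : σ →₀ ℕ, aeval v' (monomial s (1 : MvPolynomial ι Q)) =
      aeval v' (monomial s (1 : k)) := fun s => by
    rw [aeval_monomial, aeval_monomial, map_one, map_one]
  change Module.Finite (MvPolynomial ι Q) (Q ⊗[k] S)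
  refine module_finite_of_monomial_mem v' ?_ (m + 1) fun μ hμ => ?_
  · intro x
    induction x with
    | zero => exact ⟨0, map_zero _⟩
    | add x y hx hy =>
      obtain ⟨a, rfl⟩ := hx
      obtain ⟨b, rfl⟩ := hy
      exact ⟨a + b, map_add _ _ _⟩
    | tmul q s =>
      obtain ⟨r, rfl⟩ := hv s
      refine ⟨C (C q) * map ((C : Q →+* MvPolynomial ι Q).comp (algebraMap k Q)) r, ?_⟩
      rw [map_mul, aeval_C, halg, aeval_C]
      have : (aeval v') (map ((C : Q →+* MvPolynomial ι Q).comp (algebraMap k Q)) r) =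
          aeval v' r := by
        rw [aeval_def, eval₂_map, aeval_def]
        congr 1
        ext a
        rw [RingHom.comp_apply, RingHom.comp_apply, halg, aeval_C,
          ← IsScalarTower.algebraMap_apply]
      rw [this, hv', Algebra.TensorProduct.algebraMap_apply, Algebra.TensorProduct.tmul_mul_tmul]
      simp
  · set N := Submodule.span (MvPolynomial ι Q)
      ((fun ν => aeval v' (monomial ν (1 : MvPolynomial ι Q))) '' {ν : σ →₀ ℕ | ν.degree < m + 1})
    have hNC : ∀ (q : Q), ∀ x ∈ N, algebraMap Q (Q ⊗[k] S) q * x ∈ N := fun q x hx => by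
      have := N.smul_mem (C q) hx
      rwa [Algebra.smul_def, halg, aeval_C] at this
    have hNp : ∀ r : MvPolynomial σ k, r.IsHomogeneous m → aeval v' r ∈ N := by
      intro r hr
      rw [r.as_sum, map_sum]
      refine N.sum_mem fun s hs => ?_
      have hs' : s.degree = m := by
        by_contra h
        exact mem_support_iff.mp hs (hr.coeff_eq_zero h)
      have h1 : aeval v' (monomial s (coeff s r)) =
          algebraMap Q (Q ⊗[k] S) (algebraMap k Q (coeff s r)) * aeval v' (monomial s (1 : MvPolynomial ι Q)) := by
        rw [hmon, aeval_monomial, aeval_monomial, map_one, one_mul, ← IsScalarTower.algebraMap_apply]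
      rw [h1]
      exact hNC _ _ (Submodule.subset_span ⟨s, by simp [hs'], rfl⟩)
    obtain ⟨μ, rfl⟩ := (he μ).mp hμ
    have hsys := one_add_perturbMatrix_mulVec (Q := Q) e hinj he p hp v' (fun i => (1 : Q) ⊗ₜ[k] L i)
      (fun μ => by
        rw [hv', hrel, TensorProduct.tmul_sum]
        refine Finset.sum_congr rfl fun i _ => ?_
        rw [hv', Algebra.TensorProduct.tmul_mul_tmul, one_mul]) E
    set D := 1 + perturbMatrix e p E
    have h2 := congrArg ((D⁻¹).map (algebraMap Q (Q ⊗[k] S))).mulVec hsys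
    rw [Matrix.mulVec_mulVec, ← Matrix.map_mul, Matrix.nonsing_inv_mul _ hE,
      Matrix.map_one _ (map_zero _) (map_one _), Matrix.one_mulVec] at h2
    have h3 := congrFun h2 μ
    rw [hmon, h3]
    simp only [Matrix.mulVec, dotProduct, Matrix.map_apply]
    refine N.sum_mem fun ν _ => hNC _ _ (N.sum_mem fun i _ => ?_)
    have h4 : (1 : Q) ⊗ₜ[k] L i + ∑ j, E i j • v' j = algebraMap (MvPolynomial ι Q) (Q ⊗[k] S) (X i) := by
      rw [halg, aeval_X]
    rw [h4, ← Algebra.smul_def]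
    exact N.smul_mem _ (hNp _ (hp ν i))

/-- If the perturbed forms vanish at v, the invertible linear system forces all monomials of degree
m + 1 to vanish at v, in particular the pure powers of the coordinates. So perturbed forms still
meet the cone only in the vertex. -/
theorem eq_zero_of_isUnit_det {k σ ι M : Type*} [Field k] [Fintype σ] [Fintype ι] [Fintype M]
    [DecidableEq M] {m : ℕ} (e : M → σ →₀ ℕ) (hinj : Function.Injective e)
    (he : ∀ ν : σ →₀ ℕ, ν.degree = m + 1 ↔ ν ∈ Set.range e)
    (p : M → ι → MvPolynomial σ k) (hp : ∀ μ i, (p μ i).IsHomogeneous m) (v : σ → k) (L : ι → k)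
    (hrel : ∀ μ, aeval v (monomial (e μ) (1 : k)) = ∑ i, L i * aeval v (p μ i))
    (E : Matrix ι σ k) (hE : (1 + perturbMatrix e p E).det ≠ 0)
    (h0 : ∀ i, L i + ∑ j, E i j * v j = 0) : v = 0 := by
  have hsys := one_add_perturbMatrix_mulVec (Q := k) e hinj he p hp v L hrel E
  have h1 : (fun μ => ∑ i, (L i + ∑ j, E i j • v j) * aeval v (p μ i)) = 0 := by
    ext μ
    simp [h0]
  rw [h1] at hsys
  have h2 := Matrix.eq_zero_of_mulVec_eq_zero (by simpa using hE) hsys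
  ext j
  obtain ⟨μ, hμ⟩ := (he (Finsupp.single j (m + 1))).mp (by simp)
  have h3 := congrFun h2 μ
  rw [hμ, aeval_monomial, Finsupp.prod_single_index (h := fun i n => v i ^ n) (pow_zero _), map_one, one_mul] at h3
  exact pow_eq_zero_iff (Nat.succ_ne_zero m) |>.mp h3

end Perturb

/-! ### General fibres of a perturbed projection -/

section GenericCard
open MvPolynomial TensorProduct

theorem exists_map_eq_C_pow_mul {ι A Q : Type*} [CommRing A] [CommRing Q] [Algebra A Q] (g : A)
    [IsLocalization.Away g Q] (f : MvPolynomial ι Q) :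
    ∃ (n : ℕ) (f₀ : MvPolynomial ι A), map (algebraMap A Q) f₀ = C (algebraMap A Q g) ^ n * f := by
  let _ : Algebra (MvPolynomial ι A) (MvPolynomial ι Q) := algebraMvPolynomial
  obtain ⟨⟨f₀, ⟨_, _, ⟨n, rfl⟩, rfl⟩⟩, hs⟩ :=
    IsLocalization.surj ((Submonoid.powers g).map (C : A →+* MvPolynomial ι A)) f
  refine ⟨n, f₀, ?_⟩
  rw [mul_comm]
  simpa using hs.symm

/-- The parameter `none` is the deformation variable t, and the matrix is A₀ + tE. Inverting the
determinant g makes the family finite without losing the divisor t = 0, so the count at t = 0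
propagates to general parameters. -/
theorem exists_generic_card {k : Type u} [Field k] [IsAlgClosed k] {σ ι ι' : Type} [Fintype σ]
    [Fintype ι] [Finite ι'] {S : Type u} [CommRing S] [Algebra k S] [Algebra (MvPolynomial ι k) S]
    [IsScalarTower k (MvPolynomial ι k) S]
    [Algebra.FormallyUnramified (FractionRing (MvPolynomial ι k))
      (FractionRing (MvPolynomial ι k) ⊗[MvPolynomial ι k] S)]
    (v : σ → S) (hv : Function.Surjective (aeval v : MvPolynomial σ k →ₐ[k] S))
    (A₀ : Matrix ι σ k)
    (hA₀ : ∀ i, algebraMap (MvPolynomial ι k) S (X i) = ∑ j, A₀ i j • v j) (m : ℕ)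
    (hgen : ∀ μ : σ →₀ ℕ, μ.degree = m + 1 → ∃ p : ι → MvPolynomial σ k,
      (∀ i, (p i).IsHomogeneous m) ∧
      aeval v (monomial μ (1 : k)) = ∑ i, algebraMap (MvPolynomial ι k) S (X i) * aeval v (p i))
    (E : Matrix ι σ (MvPolynomial ι' k)) :
    ∃ F : MvPolynomial ι (MvPolynomial (Option ι') k), F ≠ 0 ∧
      ∀ (x : Option ι' → k) (c : ι → k), eval₂ (eval x) c F ≠ 0 →
        {ψ : S →ₐ[k] k | ∀ i, ∑ j, (A₀ i j + x none * eval (fun a => x (some a)) (E i j)) * ψ (v j) =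
          c i}.encard = Module.finrank (FractionRing (MvPolynomial ι k))
            (FractionRing (MvPolynomial ι k) ⊗[MvPolynomial ι k] S) ∧
        ∀ ψ : S →ₐ[k] k,
          (∀ i, ∑ j, (A₀ i j + x none * eval (fun a => x (some a)) (E i j)) * ψ (v j) = 0) →
            ∀ j, ψ (v j) = 0 := by
  classical
  let M := {μ : σ →₀ ℕ // μ.degree = m + 1}
  have hMfin : Finite M := (Finsupp.finite_of_degree_le (m + 1)).subset
    (fun ν (hν : ν.degree = m + 1) => hν.le) |>.to_subtype
  let _ := Fintype.ofFinite M
  let e : M → σ →₀ ℕ := Subtype.val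
  have hinj : Function.Injective e := Subtype.val_injective
  have he : ∀ ν : σ →₀ ℕ, ν.degree = m + 1 ↔ ν ∈ Set.range e := fun ν => by simp [e, M]
  choose p hp hrel using fun μ : M => hgen μ.1 μ.2
  let Q₀ := MvPolynomial (Option ι') k
  let t : Q₀ := X none
  let 𝔼 : Matrix ι σ Q₀ := Matrix.of fun i j => t * rename some (E i j)
  let g : Q₀ := (1 + perturbMatrix e p 𝔼).det
  have hdetmap : ∀ {Q' : Type u} [CommRing Q'] [Algebra k Q'] (φ : Q₀ →ₐ[k] Q'),
      φ g = (1 + perturbMatrix e p (𝔼.map φ)).det := by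
    intro Q' _ _ φ
    have := AlgHom.map_det φ (1 + perturbMatrix e p 𝔼)
    rw [this, AlgHom.mapMatrix_apply, ← map_perturbMatrix]
    congr 1
    ext a b
    simp [Matrix.one_apply, apply_ite]
  have htprime : Prime t := X_prime
  -- Setting t = 0 turns the perturbation matrix into zero and g into 1.
  have htg : ¬ t ∣ g := by
    intro h
    let φ : Q₀ →ₐ[k] Q₀ := aeval fun o => o.elim 0 fun a => X (some a)
    have hφt : φ t = 0 := aeval_X _ _
    have h1 : φ g = 1 := by
      rw [hdetmap φ]
      have : 𝔼.map φ = 0 := by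
        ext1 i j
        simp [𝔼, hφt]
      rw [this, perturbMatrix_zero, add_zero, Matrix.det_one]
    have h2 := map_dvd φ h
    rw [hφt, h1, zero_dvd_iff] at h2
    exact one_ne_zero h2
  have hg0 : g ≠ 0 := fun h => htg (h ▸ dvd_zero t)
  let Q := Localization.Away g
  have hQinj : Function.Injective (algebraMap Q₀ Q) :=
    IsLocalization.injective Q (powers_le_nonZeroDivisors_of_noZeroDivisors hg0)
  have hQdom : IsDomain Q :=
    IsLocalization.isDomain_localization (powers_le_nonZeroDivisors_of_noZeroDivisors hg0)
  have hQnoeth : IsNoetherianRing Q := IsLocalization.isNoetherianRing (.powers g) Q inferInstance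
  let t' : Q := algebraMap Q₀ Q t
  have ht' : Prime t' := by
    have h0 : t' ≠ 0 := by
      rw [Ne, map_eq_zero_iff _ hQinj]; exact htprime.ne_zero
    rw [← Ideal.span_singleton_prime h0, ← Set.image_singleton, ← Ideal.map_span]
    have hsp : (Ideal.span {t}).IsPrime := (Ideal.span_singleton_prime htprime.ne_zero).mpr htprime
    refine IsLocalization.isPrime_of_isPrime_disjoint (.powers g) Q _ hsp ?_
    rw [Set.disjoint_left]
    rintro _ ⟨n, rfl⟩ hn
    exact htg (htprime.dvd_of_dvd_pow (Ideal.mem_span_singleton.mp hn))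
  let ιQ : Q₀ →ₐ[k] Q := IsScalarTower.toAlgHom k Q₀ Q
  let E' : Matrix ι σ Q := 𝔼.map ιQ
  have hE'u : IsUnit (1 + perturbMatrix e p E').det := by
    rw [← hdetmap]
    exact IsLocalization.Away.algebraMap_isUnit g
  let L : ι → S := fun i => algebraMap (MvPolynomial ι k) S (X i)
  have hfin := finite_aeval_of_isUnit_det (Q := Q) e hinj he p hp v hv L hrel E' hE'u
  obtain ⟨f, hf0, hf⟩ := exists_card_fiber t' ht' _
    (fun i => ∑ j, ιQ (rename some (E i j)) • ((1 : Q) ⊗ₜ[k] v j))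
    (fun i => by
      congr 1
      rw [Finset.smul_sum]
      refine Finset.sum_congr rfl fun j _ => ?_
      rw [smul_smul]
      congr 1
      exact map_mul ιQ _ _) hfin
  obtain ⟨n, f₀, hn⟩ := exists_map_eq_C_pow_mul g f
  have hf₀ : f₀ ≠ 0 := by
    rintro rfl
    rw [map_zero, eq_comm, mul_eq_zero] at hn
    refine hn.elim (fun h => ?_) hf0
    rw [← map_pow, C_eq_zero, ← map_pow, map_eq_zero_iff _ hQinj] at h
    exact hg0 (eq_zero_of_pow_eq_zero h)
  -- The factor g makes the parameter a point of the localization and gives the statement on the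
  -- vertex; `f₀` is the counting condition with powers of g cleared from its denominators.
  refine ⟨C g * f₀, mul_ne_zero (by rwa [Ne, C_eq_zero]) hf₀, fun x c hxc => ?_⟩
  rw [eval₂_mul, eval₂_C] at hxc
  have hgx : aeval x g ≠ 0 := left_ne_zero_of_mul hxc
  have hf₀x := right_ne_zero_of_mul hxc
  let q : Q →ₐ[k] k := IsLocalization.liftAlgHom (M := .powers g) (f := (aeval x : Q₀ →ₐ[k] k))
    (by
      rintro ⟨_, n, rfl⟩
      change IsUnit (aeval x (g ^ n))
      rw [map_pow]
      exact (IsUnit.mk0 _ hgx).pow n)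
  have hq : ∀ y : Q₀, q (algebraMap Q₀ Q y) = aeval x y := fun y =>
    IsLocalization.lift_eq _ y
  have hqc : eval₂ (q : Q →+* k) c f ≠ 0 := by
    have h1 := congrArg (eval₂ (q : Q →+* k) c) hn
    rw [eval₂_map, eval₂_mul, eval₂_pow, eval₂_C] at h1
    have h2 : (q : Q →+* k).comp (algebraMap Q₀ Q) = eval x := by
      ext y
      · exact (hq _).trans (by simp)
      · exact (hq _).trans (by simp)
    rw [h2] at h1
    intro h0
    rw [h0, mul_zero] at h1
    exact hf₀x h1
  have hsum : ∀ (ψ : S →ₐ[k] k) (i : ι),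
      ∑ j, (A₀ i j + x none * eval (fun a => x (some a)) (E i j)) * ψ (v j) =
      ψ (L i) + ∑ j, (𝔼.map (aeval x)) i j * ψ (v j) := by
    intro ψ i
    simp only [L, hA₀, map_sum, map_smul, ← Finset.sum_add_distrib, add_mul, smul_eq_mul]
    refine Finset.sum_congr rfl fun j _ => ?_
    simp [𝔼, t, eval_rename, Function.comp_def]
  constructor
  · rw [← hf q c hqc]
    congr 1
    ext ψ
    refine forall_congr' fun i => ?_
    rw [hsum]
    simp only [map_add, map_sum, Algebra.TensorProduct.lift_tmul, map_one, one_mul]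
    rw [show ∑ j, (𝔼.map (aeval x)) i j * ψ (v j) = ∑ j, Algebra.TensorProduct.lift q ψ
      (fun _ _ => Commute.all _ _) (E' i j • ((1 : Q) ⊗ₜ[k] v j)) from ?_]
    refine Finset.sum_congr rfl fun j _ => ?_
    rw [TensorProduct.smul_tmul', Algebra.TensorProduct.lift_tmul, smul_eq_mul, mul_one]
    congr 1
    exact (hq _).symm
  · intro ψ hψ j
    refine congrFun (eq_zero_of_isUnit_det e hinj he p hp (fun j => ψ (v j)) (fun i => ψ (L i)) (fun μ => ?_)
      (𝔼.map (aeval x)) ?_ fun i => ?_) j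
    · have h1 : ∀ r : MvPolynomial σ k, aeval (fun j => ψ (v j)) r = ψ (aeval v r) := fun r => by
        rw [← AlgHom.comp_apply, comp_aeval]
      rw [h1, hrel, map_sum]
      simp only [map_mul, h1, L]
    · have h2 := hdetmap (aeval x)
      rw [h2] at hgx
      exact hgx
    · rw [← hsum]; exact hψ i

end GenericCard

/-! ### Unramifiedness over the generic point -/

section GenericallyUnramified
open TensorProduct

/-- The primes of K ⊗ S are the primes of S over zero. By incomparability these are minimal, and
their local rings do not change in the localization. -/
theorem formallyUnramified_tensorProduct_of_minimalPrimes {P S K : Type*} [CommRing P] [IsDomain P]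
    [CommRing S] [Algebra P S] [Algebra.IsIntegral P S] [Field K] [Algebra P K]
    [IsFractionRing P K]
    (h : ∀ (q : Ideal S) [q.IsPrime], q ∈ minimalPrimes S → Algebra.IsUnramifiedAt P q) :
    Algebra.FormallyUnramified K (K ⊗[P] S) := by
  let _ : Algebra S (K ⊗[P] S) := Algebra.TensorProduct.rightAlgebra
  rw [Algebra.formallyUnramified_iff_forall]
  rintro ⟨q', hq'⟩
  have := hq'
  set q := q'.comap (algebraMap S (K ⊗[P] S)) with hq
  have hqp : q.IsPrime := Ideal.comap_isPrime _ _
  have hloc : IsLocalization.AtPrime (Localization.AtPrime q') q :=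
    IsLocalization.isLocalization_isLocalization_atPrime_isLocalization
      (Algebra.algebraMapSubmonoid S (nonZeroDivisors P)) _ q'
  have hbot : q.comap (algebraMap P S) = ⊥ := by
    rw [eq_bot_iff]
    intro x hx
    by_contra hx0
    have hx0' : algebraMap P K x ≠ 0 := by
      simpa using hx0
    have h1 : algebraMap P (K ⊗[P] S) x ∈ q' := by
      have := Ideal.mem_comap.1 hx
      rw [hq, Ideal.mem_comap, ← IsScalarTower.algebraMap_apply P S (K ⊗[P] S)] at this
      exact this
    rw [IsScalarTower.algebraMap_apply P K (K ⊗[P] S)] at h1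
    exact hq'.ne_top (Ideal.eq_top_of_isUnit_mem _ h1 ((isUnit_iff_ne_zero.2 hx0').map _))
  have hmin : q ∈ minimalPrimes S := by
    refine ⟨⟨hqp, bot_le⟩, fun q₁ hq₁ hle => ?_⟩
    by_contra hlt
    have := hq₁.1
    have := Ideal.IsIntegral.comap_lt_comap (R := P) (lt_of_le_not_ge hle hlt)
    rw [hbot] at this
    exact not_lt_bot this
  have h1 := h q hmin
  let e : Localization.AtPrime q ≃ₐ[P] Localization.AtPrime q' :=
    (IsLocalization.algEquiv q.primeCompl _ _).restrictScalars P
  have : Algebra.FormallyUnramified P (Localization.AtPrime q') := Algebra.FormallyUnramified.of_equiv e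
  exact Algebra.FormallyUnramified.of_restrictScalars P K _

end GenericallyUnramified

/-! ### Differentials of fields and of polynomial rings -/

section Differentials
open TensorProduct KaehlerDifferential

/-- The differentials of L relative to k(s) vanish, so those relative to k come from k(s), where the
quotient rule reduces them to those of s. -/
theorem kaehlerDifferential_span_image_adjoin {k L : Type*} [Field k] [Field L] [Algebra k L]
    (s : Set L) [Algebra.FormallyUnramified (IntermediateField.adjoin k s) L] :
    Submodule.span L (D k L '' s) = ⊤ := by
  have hmem : ∀ x ∈ IntermediateField.adjoin k s, D k L x ∈ Submodule.span L (D k L '' s) := by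
    intro x hx
    induction hx using IntermediateField.adjoin_induction with
    | mem x hx => exact Submodule.subset_span ⟨x, hx, rfl⟩
    | algebraMap x => simp
    | add x y _ _ hx hy => rw [map_add]; exact add_mem hx hy
    | inv x _ hx => rw [Derivation.leibniz_inv]; exact Submodule.smul_mem _ _ hx
    | mul x y _ _ hx hy =>
      rw [Derivation.leibniz]
      exact add_mem (Submodule.smul_mem _ _ hy) (Submodule.smul_mem _ _ hx)
  rw [eq_top_iff]
  rintro x -
  obtain ⟨y, rfl⟩ := (exact_mapBaseChange_map k (IntermediateField.adjoin k s) L x).1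
    (Subsingleton.elim _ _)
  induction y with
  | zero => simp
  | add a b ha hb => rw [map_add]; exact add_mem ha hb
  | tmul a b =>
    rw [mapBaseChange_tmul]
    refine Submodule.smul_mem _ _ ?_
    have hb : b ∈ Submodule.span (IntermediateField.adjoin k s)
        (Set.range (D k (IntermediateField.adjoin k s))) := by
      rw [span_range_derivation]; trivial
    induction hb using Submodule.span_induction with
    | mem b hb =>
      obtain ⟨c, rfl⟩ := hb
      rw [map_D]
      exact hmem _ c.2
    | zero => simp
    | add b c _ _ hb hc => rw [map_add]; exact add_mem hb hc
    | smul c b _ hb =>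
      rw [map_smul, ← algebraMap_smul L c]
      exact Submodule.smul_mem _ _ hb

/-- Over a perfect field there is a separating transcendence basis; its differentials span, and its
size is the transcendence degree, at most the size of the index set of b. -/
theorem finrank_kaehlerDifferential_le {k : Type*} {L : Type u} [Field k] [PerfectField k] [Field L]
    [Algebra k L] [Algebra.EssFiniteType k L] {ι : Type} [Fintype ι] (b : ι → L)
    [Algebra.IsAlgebraic (Algebra.adjoin k (Set.range b)) L] :
    Module.finrank L Ω[L⁄k] ≤ Fintype.card ι := by
  obtain ⟨s, hs, hsep⟩ := exists_isTranscendenceBasis_and_isSeparable_of_perfectField k L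
  have h1 : Cardinal.mk s ≤ (Fintype.card ι : ℕ) := by
    rw [hs.cardinalMk_eq_trdeg]
    refine (Algebra.IsAlgebraic.trdeg_le_cardinalMk k (Set.range b)).trans ?_
    have := Cardinal.mk_range_le_lift (f := b)
    simpa using this
  have : Algebra.FormallyUnramified (IntermediateField.adjoin k (s : Set L)) L :=
    Algebra.FormallyUnramified.of_isSeparable _ _
  have h2 := kaehlerDifferential_span_image_adjoin (k := k) (s : Set L)
  classical
  rw [← finrank_top, ← h2]
  have h3 : s.card ≤ Fintype.card ι := by simpa using h1
  have := finrank_span_finset_le_card (R := L) (s.image (D k L))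
  rw [Finset.coe_image] at this
  exact this.trans (Finset.card_image_le.trans h3)

theorem formallyUnramified_of_span_eq_top {k P L ι : Type*} [CommRing k] [CommRing P] [CommRing L]
    [Algebra k P] [Algebra k L] [Algebra P L] [IsScalarTower k P L] (x : ι → P)
    (h : Submodule.span L (Set.range fun i => D k L (algebraMap P L (x i))) = ⊤) :
    Algebra.FormallyUnramified P L := by
  rw [Algebra.formallyUnramified_iff, ← Submodule.subsingleton_iff L, ← subsingleton_iff_bot_eq_top, eq_comm, eq_bot_iff,
    ← LinearMap.range_eq_top.2 (map_surjective k P L), LinearMap.range_eq_map, ← h, Submodule.map_span, Submodule.span_le]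
  rintro _ ⟨_, ⟨i, rfl⟩, rfl⟩
  simp

theorem linearIndependent_D_mvPolynomial {ι R T : Type*} [CommRing R] [CommRing T] [Algebra R T]
    [Algebra (MvPolynomial ι R) T] [IsScalarTower R (MvPolynomial ι R) T]
    [Algebra.FormallyEtale (MvPolynomial ι R) T] :
    LinearIndependent T fun i : ι => D R T (algebraMap (MvPolynomial ι R) T (MvPolynomial.X i)) := by
  have h := ((mvPolynomialBasis R ι).baseChange T).map
    (tensorKaehlerEquivOfFormallyEtale R (MvPolynomial ι R) T) |>.linearIndependent
  convert h using 1
  ext i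
  simp [mvPolynomialBasis_apply]

/-- A family of elements that becomes a family of variables in a polynomial ring containing the
algebra has independent differentials at every minimal prime. -/
theorem linearIndependent_D_of_minimalPrimes {ι k R S : Type*} [CommRing k] [CommRing R] [CommRing S]
    [Algebra k R] [Algebra k S] [IsReduced S] (φ : S →ₐ[k] MvPolynomial ι R)
    (hφ : Function.Injective φ) (x : ι → S) (hx : ∀ i, φ (x i) = MvPolynomial.X i) (q : Ideal S)
    [q.IsPrime] (hq : q ∈ minimalPrimes S) :
    LinearIndependent (Localization.AtPrime q)
      fun i => D k (Localization.AtPrime q) (algebraMap S _ (x i)) := by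
  -- A minimal prime is contracted from a prime Q of the larger ring. The local ring at q is a field
  -- since S is reduced, so it embeds into the local ring at Q, where the relation becomes one among
  -- the differentials of variables, relative to R.
  obtain ⟨Q, hQ, hQq⟩ := Ideal.exists_comap_eq_of_mem_minimalPrimes_of_injective (f := φ.toRingHom) hφ q hq
  have : Ring.KrullDimLE 0 (Localization.AtPrime q) := Ring.KrullDimLE.of_isLocalization q hq _
  have hfield : IsField (Localization.AtPrime q) := Ring.KrullDimLE.isField_of_isReduced
  let T := Localization.AtPrime Q
  let f : Localization.AtPrime q →+* T := Localization.localRingHom q Q φ.toRingHom hQq.symm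
  have hf : ∀ s : S, f (algebraMap S _ s) = algebraMap _ T (φ s) := fun s =>
    Localization.localRingHom_to_map q Q φ.toRingHom hQq.symm s
  let _ : Algebra (Localization.AtPrime q) T := f.toAlgebra
  have hT : IsScalarTower k (Localization.AtPrime q) T := IsScalarTower.of_algebraMap_eq fun c => by
    change _ = f _
    rw [IsScalarTower.algebraMap_apply k S (Localization.AtPrime q), hf, AlgHom.commutes,
      IsScalarTower.algebraMap_apply k (MvPolynomial ι R) T]
  have hli : LinearIndependent T fun i : ι => D R T (algebraMap (MvPolynomial ι R) T (MvPolynomial.X i)) :=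
    have : Algebra.FormallyEtale (MvPolynomial ι R) T := Algebra.FormallyEtale.of_isLocalization Q.primeCompl
    linearIndependent_D_mvPolynomial
  have hinj : Function.Injective f := by
    let _ := hfield.toField
    have : Nontrivial T := inferInstance
    exact RingHom.injective f
  rw [linearIndependent_iff'] at hli ⊢
  intro s g hg i hi
  have h2 := congrArg (KaehlerDifferential.map k R (Localization.AtPrime q) T) hg
  rw [map_sum, map_zero] at h2
  refine hinj ?_
  rw [map_zero]
  refine hli s (fun i => f (g i)) ?_ i hi
  rw [← h2]
  refine Finset.sum_congr rfl fun j _ => ?_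
  rw [map_smul, map_D]
  have : algebraMap (Localization.AtPrime q) T (algebraMap S _ (x j)) = algebraMap (MvPolynomial ι R) T (MvPolynomial.X j) := by
    rw [← hx]; exact hf _
  rw [this]
  exact (algebraMap_smul T (g j) _)

end Differentials

/-! ### Choice of general linear forms -/

section LinearForms

theorem finrank_lt_finrank_sup_span_singleton {L M : Type*} [CommRing L] (hL : IsField L)
    [AddCommGroup M] [Module L M] [Module.Finite L M] {N : Submodule L M} {x : M} (hx : x ∉ N) :
    Module.finrank L N < Module.finrank L (N ⊔ Submodule.span L {x} : Submodule L M) := by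
  let _ := hL.toField
  refine Submodule.finrank_lt_finrank_of_lt (lt_of_le_of_ne le_sup_left fun h => hx ?_)
  rw [h]
  exact Submodule.mem_sup_right (Submodule.mem_span_singleton_self x)

theorem eq_top_of_finrank_le {L M : Type*} [CommRing L] (hL : IsField L)
    [AddCommGroup M] [Module L M] [Module.Finite L M] {N : Submodule L M}
    (h : Module.finrank L M ≤ Module.finrank L N) : N = ⊤ := by
  let _ := hL.toField
  exact Submodule.eq_top_of_finrank_eq (le_antisymm (Submodule.finrank_le N) h)

/-- General linear forms cut the dimension down and span given spaces modulo subspaces. -/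
theorem exists_linearForms {k S V Θ : Type*} [Field k] [Infinite k] [CommRing S] [IsNoetherianRing S]
    [Algebra k S] [AddCommGroup V] [Module k V] (w : V →ₗ[k] S) [Finite Θ]
    {L M : Θ → Type*} [∀ θ, CommRing (L θ)] (hL : ∀ θ, IsField (L θ)) [∀ θ, Algebra k (L θ)]
    [∀ θ, AddCommGroup (M θ)] [∀ θ, Module (L θ) (M θ)] [∀ θ, Module k (M θ)]
    [∀ θ, IsScalarTower k (L θ) (M θ)] [∀ θ, Module.Finite (L θ) (M θ)] (δ : ∀ θ, V →ₗ[k] M θ) (d : ℕ) :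
    ∀ (J : Ideal S) (N : ∀ θ, Submodule (L θ) (M θ)), ringKrullDim (S ⧸ J) ≤ d →
      (∀ p : Ideal S, p.IsPrime → J ≤ p → (∀ x, w x ∈ p) → p.IsMaximal) →
      (∀ θ, N θ ⊔ Submodule.span (L θ) (Set.range (δ θ)) = ⊤) →
      (∀ θ, Module.finrank (L θ) (M θ) ≤ Module.finrank (L θ) (N θ) + d) →
      ∃ ℓ : Fin d → V, ringKrullDim (S ⧸ (J ⊔ Ideal.span (Set.range fun i => w (ℓ i)))) ≤ 0 ∧
        ∀ θ, N θ ⊔ Submodule.span (L θ) (Set.range fun i => δ θ (ℓ i)) = ⊤ := by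
  induction d with
  | zero =>
    intro J N hJ _ _ hN
    refine ⟨Fin.elim0, ?_, fun θ => ?_⟩
    · rw [Set.range_eq_empty, Ideal.span_empty, sup_bot_eq]; simpa using hJ
    · rw [Set.range_eq_empty, Submodule.span_empty, sup_bot_eq]
      exact eq_top_of_finrank_le (hL θ) (by simpa using hN θ)
  | succ d ih =>
    intro J N hJ hmax htop hN
    classical
    let preN : ∀ θ, Submodule k V := fun θ => ((N θ).restrictScalars k).comap (δ θ)
    let Q : Ideal S → Submodule k V := fun p => (p.restrictScalars k).comap w
    have hfin : (J.minimalPrimes).Finite := Ideal.finite_minimalPrimes_of_isNoetherianRing S J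
    -- The subspaces to avoid: the forms contained in a nonmaximal minimal prime of J, and the forms
    -- whose image does not enlarge a proper `N θ`. They are finitely many proper subspaces, which
    -- cannot cover V over an infinite field.
    let s : Set (Submodule k V) := (Q '' {p ∈ J.minimalPrimes | ¬ p.IsMaximal}) ∪
      (preN '' {θ | N θ ≠ ⊤})
    have hs : s.Finite := ((hfin.subset fun p hp => hp.1).image Q).union (Set.toFinite _)
    have hnot : (⊤ : Submodule k V) ∉ hs.toFinset := by
      rw [Set.Finite.mem_toFinset]
      rintro (⟨p, ⟨hp, hpm⟩, hpt⟩ | ⟨θ, hθ, hθt⟩)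
      · refine hpm (hmax p hp.1.1 hp.1.2 fun x => ?_)
        have : x ∈ Q p := hpt ▸ Submodule.mem_top
        exact this
      · refine hθ ?_
        rw [← htop θ, eq_comm, sup_eq_left, Submodule.span_le]
        rintro _ ⟨x, rfl⟩
        have : x ∈ preN θ := hθt ▸ Submodule.mem_top
        exact this
    obtain ⟨x, hx⟩ := (Set.ne_univ_iff_exists_notMem _).1
      (Subspace.biUnion_ne_univ_of_top_notMem hnot)
    have hx' : ∀ p ∈ s, x ∉ p := by simpa using hx
    obtain ⟨ℓ, h1, h2⟩ := ih (J ⊔ Ideal.span {w x}) (fun θ => N θ ⊔ Submodule.span (L θ) {δ θ x})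
      (ringKrullDim_quotient_sup_span_singleton_le J (w x) d hJ fun p hp hxp => by
        by_contra hpm
        exact hx' _ (Or.inl ⟨p, ⟨hp, hpm⟩, rfl⟩) hxp)
      (fun p hp hle => hmax p hp (le_sup_left.trans hle))
      (fun θ => by rw [sup_right_comm, htop, top_sup_eq])
      (fun θ => by
        by_cases hθ : N θ = ⊤
        · rw [hθ, top_sup_eq, finrank_top]; omega
        · have := finrank_lt_finrank_sup_span_singleton (hL θ) (x := δ θ x) (N := N θ)
            (hx' _ (Or.inr ⟨θ, hθ, rfl⟩))
          have := hN θ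
          omega)
    refine ⟨Fin.cons x ℓ, ?_, fun θ => ?_⟩
    · have h3 : J ⊔ Ideal.span (Set.range fun i => w (Fin.cons (α := fun _ => V) x ℓ i)) =
          J ⊔ Ideal.span {w x} ⊔ Ideal.span (Set.range fun i => w (ℓ i)) := by
        rw [sup_assoc, ← Ideal.span_union]
        congr 2
        ext y; simp [Fin.exists_fin_succ, eq_comm]
      rw [h3]
      exact h1
    · rw [← h2 θ, sup_assoc, ← Submodule.span_union]
      congr 2
      ext y; simp [Fin.exists_fin_succ, eq_comm]

end LinearForms

/-! ### Coordinate rings of point sets -/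

section CoordRing
open MvPolynomial TensorProduct

variable {k : Type u} [Field k] {σ τ : Type}

/-- The ring of polynomial functions on a subset of affine space. -/
def CoordRing (C : Set (σ → k)) : Type u :=
  MvPolynomial σ k ⧸ vanishingIdeal k C

noncomputable instance (C : Set (σ → k)) : CommRing (CoordRing C) :=
  inferInstanceAs (CommRing (MvPolynomial σ k ⧸ vanishingIdeal k C))

noncomputable instance (C : Set (σ → k)) : Algebra k (CoordRing C) :=
  inferInstanceAs (Algebra k (MvPolynomial σ k ⧸ vanishingIdeal k C))

/-- The function given by a polynomial. -/
noncomputable def toCoordRing (C : Set (σ → k)) : MvPolynomial σ k →ₐ[k] CoordRing C :=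
  Ideal.Quotient.mkₐ k (vanishingIdeal k C)

theorem toCoordRing_surjective (C : Set (σ → k)) : Function.Surjective (toCoordRing C) :=
  Ideal.Quotient.mk_surjective

theorem toCoordRing_eq_zero_iff {C : Set (σ → k)} {f : MvPolynomial σ k} :
    toCoordRing C f = 0 ↔ f ∈ vanishingIdeal k C :=
  Ideal.Quotient.eq_zero_iff_mem

/-- The homomorphism induced by one that kills the vanishing ideal. -/
noncomputable def liftCoordRing {C : Set (σ → k)} {A : Type*} [CommRing A] [Algebra k A]
    (φ : MvPolynomial σ k →ₐ[k] A) (hφ : ∀ f ∈ vanishingIdeal k C, φ f = 0) : CoordRing C →ₐ[k] A :=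
  Ideal.Quotient.liftₐ (vanishingIdeal k C) φ hφ

/-- The coordinate functions. -/
noncomputable def coord (C : Set (σ → k)) (j : σ) : CoordRing C :=
  toCoordRing C (X j)

theorem aeval_coord (C : Set (σ → k)) (f : MvPolynomial σ k) :
    aeval (coord C) f = toCoordRing C f := by
  have : (aeval (coord C) : MvPolynomial σ k →ₐ[k] CoordRing C) = toCoordRing C := by
    ext j; simp [coord]
  rw [this]

theorem aeval_coord_surjective (C : Set (σ → k)) :
    Function.Surjective (aeval (coord C) : MvPolynomial σ k →ₐ[k] CoordRing C) := fun x => by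
  obtain ⟨f, rfl⟩ := toCoordRing_surjective C x
  exact ⟨f, aeval_coord C f⟩

theorem aeval_coord_eq_zero_iff {C : Set (σ → k)} {f : MvPolynomial σ k} :
    aeval (coord C) f = 0 ↔ f ∈ vanishingIdeal k C := by
  rw [aeval_coord, toCoordRing_eq_zero_iff]

/-- Evaluation of functions at a point of the closure. -/
noncomputable def evalAt {C : Set (σ → k)} {c : σ → k} (hc : c ∈ zeroLocus k (vanishingIdeal k C)) :
    CoordRing C →ₐ[k] k :=
  liftCoordRing (aeval c) fun f hf => hc f hf

@[simp]
theorem evalAt_coord {C : Set (σ → k)} {c : σ → k} (hc : c ∈ zeroLocus k (vanishingIdeal k C))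
    (j : σ) : evalAt hc (coord C j) = c j :=
  aeval_X c j

theorem apply_coord_mem_zeroLocus {C : Set (σ → k)} (ψ : CoordRing C →ₐ[k] k) :
    (fun j => ψ (coord C j)) ∈ zeroLocus k (vanishingIdeal k C) := fun f hf => by
  have := congrArg ψ (aeval_coord_eq_zero_iff.2 hf)
  rwa [map_zero, comp_aeval_apply] at this

theorem coordRing_algHom_ext {C : Set (σ → k)} {A : Type*} [CommRing A] [Algebra k A]
    {ψ ψ' : CoordRing C →ₐ[k] A} (h : ∀ j, ψ (coord C j) = ψ' (coord C j)) : ψ = ψ' := by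
  have h1 : ψ.comp (toCoordRing C) = ψ'.comp (toCoordRing C) := MvPolynomial.algHom_ext fun j => h j
  ext x
  obtain ⟨f, rfl⟩ := toCoordRing_surjective C x
  exact DFunLike.congr_fun h1 f

/-- The algebra homomorphisms from the ring of functions to the ground field are the points of the
closure. -/
noncomputable def algHomEquivZeroLocus (C : Set (σ → k)) :
    (CoordRing C →ₐ[k] k) ≃ zeroLocus k (vanishingIdeal k C) where
  toFun ψ := ⟨_, apply_coord_mem_zeroLocus ψ⟩
  invFun c := evalAt c.2
  left_inv ψ := coordRing_algHom_ext fun j => by simp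
  right_inv c := by ext j; simp

theorem subset_zeroLocus_vanishingIdeal (C : Set (σ → k)) : C ⊆ zeroLocus k (vanishingIdeal k C) :=
  zeroLocus_vanishingIdeal_le C

theorem eq_zero_of_forall_evalAt {C : Set (σ → k)} {x : CoordRing C}
    (h : ∀ c (hc : c ∈ C), evalAt (subset_zeroLocus_vanishingIdeal C hc) x = 0) : x = 0 := by
  obtain ⟨f, rfl⟩ := toCoordRing_surjective C x
  rw [toCoordRing_eq_zero_iff]
  intro c hc
  exact h c hc

instance (C : Set (σ → k)) : IsReduced (CoordRing C) where
  eq_zero x := by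
    rintro ⟨m, hm⟩
    refine eq_zero_of_forall_evalAt fun c hc => ?_
    have := congrArg (evalAt (subset_zeroLocus_vanishingIdeal C hc)) hm
    rw [map_pow, map_zero] at this
    exact eq_zero_of_pow_eq_zero this

/-- Functions constructed from functions: to define a homomorphism out of the ring of functions on
`C` into an algebra separated by evaluations, it is enough that the evaluations hit `C`. -/
noncomputable def coordRingLift {C : Set (σ → k)} {A ι : Type*} [CommRing A] [Algebra k A] (e : ι → A →ₐ[k] k)
    (he : ∀ a, (∀ i, e i a = 0) → a = 0) (x : σ → A) (hx : ∀ i, (fun j => e i (x j)) ∈ C) :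
    CoordRing C →ₐ[k] A :=
  liftCoordRing (aeval x) fun f hf => he _ fun i => by
    have h := hf _ (hx i)
    rwa [comp_aeval_apply]

@[simp]
theorem coordRingLift_coord {C : Set (σ → k)} {A ι : Type*} [CommRing A] [Algebra k A] (e : ι → A →ₐ[k] k)
    (he : ∀ a, (∀ i, e i a = 0) → a = 0) (x : σ → A) (hx : ∀ i, (fun j => e i (x j)) ∈ C) (j : σ) :
    coordRingLift e he x hx (coord C j) = x j :=
  aeval_X x j

theorem coordRingLift_injective {C : Set (σ → k)} {A ι : Type*} [CommRing A] [Algebra k A] (e : ι → A →ₐ[k] k)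
    (he : ∀ a, (∀ i, e i a = 0) → a = 0) (x : σ → A) (hx : ∀ i, (fun j => e i (x j)) ∈ C)
    (hC : ∀ c ∈ C, ∃ i, (fun j => e i (x j)) = c) :
    Function.Injective (coordRingLift e he x hx) := by
  rw [injective_iff_map_eq_zero]
  intro a ha
  refine eq_zero_of_forall_evalAt fun c hc => ?_
  obtain ⟨i, rfl⟩ := hC c hc
  have : evalAt (subset_zeroLocus_vanishingIdeal C hc) = (e i).comp (coordRingLift e he x hx) :=
    coordRing_algHom_ext fun j => by simp
  rw [this, AlgHom.comp_apply, ha, map_zero]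

/-- Expand t in a basis of B. Each `f i` yields a vector of B killed by all `g j`, hence zero, so
the coefficients of t are killed by all `f i`. In this way pairs of points separate the functions on
a product. -/
theorem tensorProduct_eq_zero_of_separating {A B ι κ : Type*} [AddCommGroup A] [Module k A]
    [AddCommGroup B] [Module k B] (f : ι → A →ₗ[k] k) (hf : ∀ a, (∀ i, f i a = 0) → a = 0)
    (g : κ → B →ₗ[k] k) (hg : ∀ b, (∀ i, g i b = 0) → b = 0) (t : A ⊗[k] B)
    (ht : ∀ i j, TensorProduct.lid k k (TensorProduct.map (f i) (g j) t) = 0) : t = 0 := by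
  classical
  let b := Module.Basis.ofVectorSpace k B
  obtain ⟨c, rfl⟩ := (TensorProduct.equivFinsuppOfBasisRight (M := A) b).symm.surjective t
  rw [map_eq_zero_iff _ (LinearEquiv.injective _)]
  ext l
  rw [Finsupp.zero_apply]
  refine hf _ fun i => ?_
  have h1 : ∑ m ∈ c.support, f i (c m) • b m = 0 := by
    refine hg _ fun j => ?_
    have := ht i j
    rw [TensorProduct.equivFinsuppOfBasisRight_symm_apply, Finsupp.sum, map_sum, map_sum] at this
    simpa using this
  by_cases hl : l ∈ c.support
  · exact linearIndependent_iff'.1 b.linearIndependent _ _ h1 l hl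
  · rw [Finsupp.notMem_support_iff.1 hl, map_zero]

theorem aeval_smul_of_isHomogeneous {f : MvPolynomial σ k} {m : ℕ} (hf : f.IsHomogeneous m) (s : k)
    (v : σ → k) : aeval (s • v) f = s ^ m * aeval v f := by
  rw [f.as_sum, map_sum, map_sum, Finset.mul_sum]
  refine Finset.sum_congr rfl fun μ hμ => ?_
  have hμ' : μ.degree = m := by
    by_contra h
    exact mem_support_iff.mp hμ (hf.coeff_eq_zero h)
  rw [aeval_monomial, aeval_monomial, ← hμ', Finsupp.degree_apply, Finsupp.prod, Finsupp.prod]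
  simp only [Pi.smul_apply, smul_eq_mul, mul_pow, Finset.prod_mul_distrib, Finset.prod_pow_eq_pow_sum]
  ring

/-- For v in C, f(s v) is a polynomial in s with infinitely many zeros, and its coefficients are the
values at v of the homogeneous components of f. -/
theorem isHomogeneousIdeal_vanishingIdeal [Infinite k] {C : Set (σ → k)}
    (hC : ∀ v ∈ C, ∀ s : k, s ≠ 0 → s • v ∈ C) : IsHomogeneousIdeal (vanishingIdeal k C) := by
  intro f hf m v hv
  let q : Polynomial k := ∑ i ∈ Finset.range (f.totalDegree + 1),
    Polynomial.C (aeval v (homogeneousComponent i f)) * Polynomial.X ^ i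
  have hq : ∀ s : k, s ≠ 0 → q.eval s = 0 := by
    intro s hs
    have h1 := hf _ (hC v hv s hs)
    rw [← sum_homogeneousComponent f, map_sum] at h1
    rw [← h1, Polynomial.eval_finsetSum]
    refine Finset.sum_congr rfl fun i _ => ?_
    rw [aeval_smul_of_isHomogeneous (homogeneousComponent_isHomogeneous i f)]
    rw [Polynomial.eval_mul, Polynomial.eval_C, Polynomial.eval_pow, Polynomial.eval_X, mul_comm]
  have hq0 : q = 0 := Polynomial.eq_zero_of_infinite_isRoot _ (Set.Infinite.mono (s := {0}ᶜ) (fun s hs => hq s hs)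
    (Set.finite_singleton (0 : k)).infinite_compl)
  by_cases hm : m ∈ Finset.range (f.totalDegree + 1)
  · have h4 := congrArg (fun r : Polynomial k => r.coeff m) hq0
    simpa [q, Polynomial.finsetSum_coeff, Polynomial.coeff_C_mul, Polynomial.coeff_X_pow, Finset.mem_range.1 hm] using h4
  · rw [homogeneousComponent_eq_zero _ _ (by simpa [Nat.lt_succ_iff] using hm), map_zero]

theorem finite_of_generatesInDegree [Finite σ] {ι A T : Type*} [Fintype ι] [CommRing A] [CommRing T] [Algebra k A]
    [Algebra k T] [Algebra A T] [IsScalarTower k A T] {I : Ideal (MvPolynomial σ k)}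
    {L : ι → MvPolynomial σ k} {m : ℕ} (hm : GeneratesInDegree I L m) (v : σ → T)
    (hv : Function.Surjective (aeval v : MvPolynomial σ k →ₐ[k] T)) (hI : ∀ f ∈ I, aeval v f = 0)
    (a : ι → A) (ha : ∀ i, algebraMap A T (a i) = aeval v (L i)) : Module.Finite A T := by
  have hmon : ∀ (s : σ →₀ ℕ) (c : k), aeval v (monomial s c) =
      algebraMap k A c • aeval v (monomial s (1 : A)) := fun s c => by
    rw [aeval_monomial, aeval_monomial, map_one, one_mul, Algebra.smul_def,
      ← IsScalarTower.algebraMap_apply]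
  refine module_finite_of_monomial_mem v (fun x => ?_) (m + 1) fun μ hμ => ?_
  · obtain ⟨f, rfl⟩ := hv x
    exact ⟨map (algebraMap k A) f, by rw [aeval_map_algebraMap]⟩
  · obtain ⟨p, hp, hpI⟩ := hm μ hμ
    have h1 := hI _ hpI
    rw [map_sub, sub_eq_zero, hmon, map_one, one_smul, map_sum] at h1
    rw [h1]
    refine Submodule.sum_mem _ fun i _ => ?_
    rw [map_mul, ← ha, ← Algebra.smul_def]
    refine Submodule.smul_mem _ _ ?_
    rw [(p i).as_sum, map_sum]
    refine Submodule.sum_mem _ fun s hs => ?_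
    have hs' : s.degree = m := by
      by_contra h
      exact mem_support_iff.mp hs ((hp i).coeff_eq_zero h)
    rw [hmon]
    exact Submodule.smul_mem _ _ (Submodule.subset_span ⟨s, by simp [hs'], rfl⟩)

end CoordRing

/-! ### The cones over X and Y and the cone of sums -/

section Cones
open MvPolynomial TensorProduct

variable {k : Type u} [Field k] {n : ℕ}

/-- The cone over `X ⊆ 𝔸ⁿ`, without its vertex. -/
def affineCone (X : Set (Fin n → k)) : Set (Fin (n + 1) → k) :=
  {v | ∃ s : k, s ≠ 0 ∧ ∃ x ∈ X, v = s • homogenize x}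

theorem smul_mem_affineCone {X : Set (Fin n → k)} {v : Fin (n + 1) → k} (hv : v ∈ affineCone X)
    {s : k} (hs : s ≠ 0) : s • v ∈ affineCone X := by
  obtain ⟨r, hr, x, hx, rfl⟩ := hv
  exact ⟨s * r, mul_ne_zero hs hr, x, hx, smul_smul _ _ _⟩

theorem apply_zero_ne_zero_of_mem_affineCone {X : Set (Fin n → k)} {v : Fin (n + 1) → k}
    (hv : v ∈ affineCone X) : v 0 ≠ 0 := by
  obtain ⟨r, hr, x, hx, rfl⟩ := hv
  simpa [homogenize] using hr

theorem coord_zero_mem_nonZeroDivisors (X : Set (Fin n → k)) :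
    coord (affineCone X) 0 ∈ nonZeroDivisors (CoordRing (affineCone X)) := by
  rw [mem_nonZeroDivisors_iff_right]
  intro x hx
  refine eq_zero_of_forall_evalAt fun c hc => ?_
  have := congrArg (evalAt (subset_zeroLocus_vanishingIdeal _ hc)) hx
  rw [map_mul, map_zero, evalAt_coord] at this
  exact (mul_eq_zero.1 this).resolve_right (apply_zero_ne_zero_of_mem_affineCone hc)

theorem mk_mem_projectiveClosure {X : Set (Fin n → k)} {v : Fin (n + 1) → k}
    (hv : v ∈ zeroLocus k (vanishingIdeal k (affineCone X))) (hv0 : v ≠ 0) :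
    Projectivization.mk k v hv0 ∈ projectiveClosure X := by
  intro F hF
  obtain ⟨a, ha⟩ := Projectivization.exists_smul_eq_mk_rep k v hv0
  have hle : homogeneousVanishingIdeal (toProj '' X) ≤
      RingHom.ker (eval (Projectivization.mk k v hv0).rep) := by
    refine Ideal.span_le.2 ?_
    rintro F ⟨⟨m, hm⟩, hF⟩
    rw [SetLike.mem_coe, RingHom.mem_ker, ← ha]
    have h1 : F ∈ vanishingIdeal k (affineCone X) := by
      rintro _ ⟨s, hs, x, hx, rfl⟩
      have h2 := hF _ ⟨x, hx, rfl⟩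
      obtain ⟨b, hb⟩ := Projectivization.exists_smul_eq_mk_rep k (homogenize x) (homogenize_ne_zero x)
      rw [toProj, ← hb] at h2
      have h3 : aeval ((b : k) • homogenize x) F = 0 := h2
      rw [aeval_smul_of_isHomogeneous hm] at h3 ⊢
      rw [(mul_eq_zero.1 h3).resolve_left (pow_ne_zero _ b.ne_zero), mul_zero]
    have h4 := hv F h1
    have : aeval ((a : k) • v) F = 0 := by rw [aeval_smul_of_isHomogeneous hm, h4, mul_zero]
    exact this
  exact hle hF

/-- A common point at infinity of the two cones is the vertex. -/
theorem DisjointAtInfinity.eq_zero {X Y : Set (Fin n → k)} (h : DisjointAtInfinity X Y)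
    {v : Fin (n + 1) → k} (hX : v ∈ zeroLocus k (vanishingIdeal k (affineCone X)))
    (hY : v ∈ zeroLocus k (vanishingIdeal k (affineCone Y))) (h0 : v 0 = 0) : v = 0 := by
  by_contra hv
  have h1 : Projectivization.mk k v hv ∈
      projectiveClosure X ∩ projectiveClosure Y ∩ hyperplaneAtInfinity k n := by
    refine ⟨⟨mk_mem_projectiveClosure hX hv, mk_mem_projectiveClosure hY hv⟩, ?_⟩
    obtain ⟨a, ha⟩ := Projectivization.exists_smul_eq_mk_rep k v hv
    change (Projectivization.mk k v hv).rep 0 = 0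
    rw [← ha, Pi.smul_apply, h0, smul_zero]
  rw [h] at h1
  exact h1

theorem smul_mem_zeroLocus_of_isHomogeneousIdeal {σ : Type} {I : Ideal (MvPolynomial σ k)}
    (hI : IsHomogeneousIdeal I) {v : σ → k} (hv : v ∈ zeroLocus k I) (s : k) :
    s • v ∈ zeroLocus k I := by
  intro f hf
  rw [← sum_homogeneousComponent f, map_sum]
  refine Finset.sum_eq_zero fun m _ => ?_
  rw [aeval_smul_of_isHomogeneous (homogeneousComponent_isHomogeneous m f), hv _ (hI f hf m), mul_zero]

theorem isHomogeneousIdeal_affineCone [Infinite k] (X : Set (Fin n → k)) :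
    IsHomogeneousIdeal (vanishingIdeal k (affineCone X)) :=
  isHomogeneousIdeal_vanishingIdeal fun _ hv _ hs => smul_mem_affineCone hv hs

/-- The vector `(a₀, b₀, a₁ + b₁, …, aₙ + bₙ)`. -/
def sumVec {A : Type*} [Add A] (a b : Fin (n + 1) → A) : Fin 2 ⊕ Fin n → A :=
  Sum.elim ![a 0, b 0] fun j => a j.succ + b j.succ

/-- The cone of all `(s, r, s x + r y)` with `s, r` nonzero, `x ∈ X` and `y ∈ Y`. -/
def sumCone (X Y : Set (Fin n → k)) : Set (Fin 2 ⊕ Fin n → k) :=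
  {v | ∃ a ∈ affineCone X, ∃ b ∈ affineCone Y, v = sumVec a b}

theorem smul_sumVec (s : k) (a b : Fin (n + 1) → k) : s • sumVec a b = sumVec (s • a) (s • b) := by
  ext (i | j)
  · fin_cases i <;> rfl
  · simp [sumVec, mul_add]

theorem isHomogeneousIdeal_sumCone [Infinite k] (X Y : Set (Fin n → k)) :
    IsHomogeneousIdeal (vanishingIdeal k (sumCone X Y)) := by
  refine isHomogeneousIdeal_vanishingIdeal ?_
  rintro _ ⟨a, ha, b, hb, rfl⟩ s hs
  exact ⟨_, smul_mem_affineCone ha hs, _, smul_mem_affineCone hb hs, smul_sumVec s a b⟩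

/-- The coordinate ring of the product of the two cones. -/
abbrev ProdRing (X Y : Set (Fin n → k)) : Type u :=
  CoordRing (affineCone X) ⊗[k] CoordRing (affineCone Y)

/-- The coordinates of the two factors. -/
noncomputable def prodCoord (X Y : Set (Fin n → k)) : Fin (n + 1) ⊕ Fin (n + 1) → ProdRing X Y :=
  Sum.elim (fun i => coord _ i ⊗ₜ 1) fun i => 1 ⊗ₜ coord _ i

theorem aeval_sumElim_tmul_surjective {A B σ τ : Type*} [CommRing A] [CommRing B] [Algebra k A]
    [Algebra k B] {a : σ → A} {b : τ → B}
    (ha : Function.Surjective (aeval a : MvPolynomial σ k →ₐ[k] A))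
    (hb : Function.Surjective (aeval b : MvPolynomial τ k →ₐ[k] B)) :
    Function.Surjective (aeval (Sum.elim (fun i => a i ⊗ₜ[k] (1 : B)) fun i => (1 : A) ⊗ₜ[k] b i) :
      MvPolynomial (σ ⊕ τ) k →ₐ[k] A ⊗[k] B) := by
  intro t
  induction t with
  | zero => exact ⟨0, map_zero _⟩
  | add x y hx hy =>
    obtain ⟨f, rfl⟩ := hx
    obtain ⟨g, rfl⟩ := hy
    exact ⟨f + g, map_add _ _ _⟩
  | tmul x y =>
    obtain ⟨f, rfl⟩ := ha x
    obtain ⟨g, rfl⟩ := hb y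
    refine ⟨rename Sum.inl f * rename Sum.inr g, ?_⟩
    have h1 := comp_aeval_apply a (Algebra.TensorProduct.includeLeft : A →ₐ[k] A ⊗[k] B) f
    have h2 := comp_aeval_apply b (Algebra.TensorProduct.includeRight : B →ₐ[k] A ⊗[k] B) g
    simp only [Algebra.TensorProduct.includeLeft_apply, Algebra.TensorProduct.includeRight_apply] at h1 h2
    rw [map_mul, aeval_rename, aeval_rename, Sum.elim_comp_inl, Sum.elim_comp_inr, ← h1, ← h2,
      Algebra.TensorProduct.tmul_mul_tmul, mul_one, one_mul]

theorem aeval_prodCoord_surjective (X Y : Set (Fin n → k)) :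
    Function.Surjective (aeval (prodCoord X Y) : MvPolynomial _ k →ₐ[k] ProdRing X Y) :=
  aeval_sumElim_tmul_surjective (aeval_coord_surjective _) (aeval_coord_surjective _)

/-- Evaluation at a pair of points of the cones. -/
noncomputable def prodEval (X Y : Set (Fin n → k)) (c : affineCone X × affineCone Y) :
    ProdRing X Y →ₐ[k] k :=
  Algebra.TensorProduct.lift (evalAt (subset_zeroLocus_vanishingIdeal _ c.1.2))
    (evalAt (subset_zeroLocus_vanishingIdeal _ c.2.2)) fun _ _ => Commute.all _ _

theorem prodEval_separating (X Y : Set (Fin n → k)) (t : ProdRing X Y)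
    (h : ∀ c, prodEval X Y c t = 0) : t = 0 := by
  refine tensorProduct_eq_zero_of_separating
    (fun c : affineCone X => (evalAt (subset_zeroLocus_vanishingIdeal _ c.2)).toLinearMap)
    (fun a ha => eq_zero_of_forall_evalAt fun c hc => ha ⟨c, hc⟩)
    (fun c : affineCone Y => (evalAt (subset_zeroLocus_vanishingIdeal _ c.2)).toLinearMap)
    (fun a ha => eq_zero_of_forall_evalAt fun c hc => ha ⟨c, hc⟩) t fun a b => ?_
  rw [← h (a, b)]
  refine LinearMap.congr_fun (f := (TensorProduct.lid k k).toLinearMap ∘ₗ TensorProduct.map _ _)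
    (g := (prodEval X Y (a, b)).toLinearMap) (TensorProduct.ext' fun x y => ?_) t
  simp [prodEval]

/-- The functions `u₀, u₁, w₁, …, wₙ` on the product of the cones. -/
noncomputable def prodSumCoord (X Y : Set (Fin n → k)) : Fin 2 ⊕ Fin n → ProdRing X Y :=
  sumVec (prodCoord X Y ∘ Sum.inl) (prodCoord X Y ∘ Sum.inr)

theorem apply_prodSumCoord {X Y : Set (Fin n → k)} {A : Type*} [CommRing A] [Algebra k A] (e : ProdRing X Y →ₐ[k] A) (j) :
    e (prodSumCoord X Y j) = sumVec (fun i => e (prodCoord X Y (Sum.inl i))) (fun i => e (prodCoord X Y (Sum.inr i))) j := by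
  rcases j with i | j
  · fin_cases i <;> simp [prodSumCoord, sumVec]
  · simp [prodSumCoord, sumVec]

theorem prodEval_prodSumCoord (X Y : Set (Fin n → k)) (c : affineCone X × affineCone Y) (j) :
    prodEval X Y c (prodSumCoord X Y j) = sumVec c.1.1 c.2.1 j := by
  rw [apply_prodSumCoord]
  simp [prodEval, prodCoord]

/-- The comparison map from functions on the cone of sums to functions on the product. -/
noncomputable def sumToProd (X Y : Set (Fin n → k)) : CoordRing (sumCone X Y) →ₐ[k] ProdRing X Y :=
  coordRingLift (prodEval X Y) (prodEval_separating X Y) (prodSumCoord X Y) fun c =>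
    ⟨c.1.1, c.1.2, c.2.1, c.2.2, funext (prodEval_prodSumCoord X Y c)⟩

theorem sumToProd_coord (X Y : Set (Fin n → k)) (j) :
    sumToProd X Y (coord _ j) = prodSumCoord X Y j :=
  coordRingLift_coord ..

theorem sumToProd_injective (X Y : Set (Fin n → k)) : Function.Injective (sumToProd X Y) := by
  refine coordRingLift_injective _ _ _ _ ?_
  rintro _ ⟨a, ha, b, hb, rfl⟩
  exact ⟨(⟨a, ha⟩, ⟨b, hb⟩), funext (prodEval_prodSumCoord X Y _)⟩

theorem algHom_finite_of_generatesInDegree {σ : Type} [Finite σ] {ι A T : Type*} [Fintype ι]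
    [CommRing A] [CommRing T] [Algebra k A] [Algebra k T] {I : Ideal (MvPolynomial σ k)}
    {L : ι → MvPolynomial σ k} {m : ℕ} (hm : GeneratesInDegree I L m) (v : σ → T)
    (hv : Function.Surjective (aeval v : MvPolynomial σ k →ₐ[k] T)) (hI : ∀ f ∈ I, aeval v f = 0)
    (φ : A →ₐ[k] T) (a : ι → A) (ha : ∀ i, φ (a i) = aeval v (L i)) : φ.Finite := by
  let _ := φ.toRingHom.toAlgebra
  have : IsScalarTower k A T := IsScalarTower.of_algebraMap_eq fun c => (φ.commutes c).symm
  exact finite_of_generatesInDegree hm v hv hI a ha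

/-- Disjointness at infinity says that the forms u₀, u₁, w₁, …, wₙ on the product of the cones
vanish together only at the vertex; the graded criterion then gives finiteness. -/
theorem algHom_finite_of_disjointAtInfinity [IsAlgClosed k] {X Y : Set (Fin n → k)}
    (hXY : DisjointAtInfinity X Y) {A T ι : Type*} [CommRing A] [CommRing T] [Algebra k A]
    [Algebra k T] (φ : A →ₐ[k] T) (c : Fin (n + 1) ⊕ Fin (n + 1) → T)
    (hc : Function.Surjective (aeval c : MvPolynomial _ k →ₐ[k] T)) (e : ι → T →ₐ[k] k)
    (he : ∀ t, (∀ i, e i t = 0) → t = 0)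
    (heX : ∀ i, (fun j => e i (c (Sum.inl j))) ∈ affineCone X)
    (heY : ∀ i, (fun j => e i (c (Sum.inr j))) ∈ affineCone Y) (a : Fin 2 ⊕ Fin n → A)
    (ha : ∀ j, φ (a j) = sumVec (c ∘ Sum.inl) (c ∘ Sum.inr) j) : φ.Finite := by
  have : Infinite k := IsAlgClosed.instInfinite
  let C : Set (Fin (n + 1) ⊕ Fin (n + 1) → k) := {v | v ∘ Sum.inl ∈ affineCone X ∧ v ∘ Sum.inr ∈ affineCone Y}
  let L : Fin 2 ⊕ Fin n → MvPolynomial (Fin (n + 1) ⊕ Fin (n + 1)) k :=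
    sumVec (fun i => MvPolynomial.X (Sum.inl i)) fun i => MvPolynomial.X (Sum.inr i)
  have hLv : ∀ (v : Fin (n + 1) ⊕ Fin (n + 1) → k) (j), aeval v (L j) = sumVec (v ∘ Sum.inl) (v ∘ Sum.inr) j := by
    rintro v (i | j)
    · fin_cases i <;> simp [sumVec, L]
    · simp [sumVec, L]
  obtain ⟨m, hm⟩ := exists_generatesInDegree (I := vanishingIdeal k C) (L := L)
    (isHomogeneousIdeal_vanishingIdeal fun v hv s hs =>
      ⟨smul_mem_affineCone hv.1 hs, smul_mem_affineCone hv.2 hs⟩)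
    (by
      rintro (i | j)
      · fin_cases i <;> exact isHomogeneous_X _ _
      · exact (isHomogeneous_X _ _).add (isHomogeneous_X _ _))
    (by
      intro v hv h0
      have hva : v ∘ Sum.inl ∈ zeroLocus k (vanishingIdeal k (affineCone X)) := fun f hf => by
        have := hv (rename Sum.inl f) fun c hc => by
          rw [aeval_rename]; exact hf _ hc.1
        rwa [aeval_rename] at this
      have hvb : v ∘ Sum.inr ∈ zeroLocus k (vanishingIdeal k (affineCone Y)) := fun f hf => by
        have := hv (rename Sum.inr f) fun c hc => by
          rw [aeval_rename]; exact hf _ hc.2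
        rwa [aeval_rename] at this
      have h0' : ∀ j, sumVec (v ∘ Sum.inl) (v ∘ Sum.inr) j = 0 := fun j => (hLv v j).symm.trans (h0 j)
      have ha0 : v (Sum.inl 0) = 0 := h0' (Sum.inl 0)
      have hb0 : v (Sum.inr 0) = 0 := h0' (Sum.inl 1)
      -- A common zero has second component minus the first. The closed cone over X is stable under
      -- the scalar -1, so this component lies in both cones and at infinity.
      have hab : v ∘ Sum.inr = (-1 : k) • (v ∘ Sum.inl) := by
        ext j
        refine Fin.cases ?_ (fun j => ?_) j
        · simp [ha0, hb0]
        · have : v (Sum.inl j.succ) + v (Sum.inr j.succ) = 0 := h0' (Sum.inr j)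
          simpa using eq_neg_of_add_eq_zero_right this
      have hva' : v ∘ Sum.inr ∈ zeroLocus k (vanishingIdeal k (affineCone X)) := by
        rw [hab]
        exact smul_mem_zeroLocus_of_isHomogeneousIdeal (isHomogeneousIdeal_affineCone X) hva _
      have hb : v ∘ Sum.inr = 0 := hXY.eq_zero hva' hvb hb0
      have ha : v ∘ Sum.inl = 0 := by
        rw [hb] at hab
        simpa using hab.symm
      ext (j | j)
      · exact congrFun ha j
      · exact congrFun hb j)
  refine algHom_finite_of_generatesInDegree hm c hc ?_ φ a ?_
  · intro f hf
    refine he _ fun i => ?_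
    rw [comp_aeval_apply]
    exact hf _ ⟨heX i, heY i⟩
  · intro j
    rw [ha]
    rcases j with i | j
    · fin_cases i <;> simp [sumVec, L]
    · simp [sumVec, L]

theorem finite_sumToProd [IsAlgClosed k] {X Y : Set (Fin n → k)} (hXY : DisjointAtInfinity X Y) :
    AlgHom.Finite (A := CoordRing (sumCone X Y)) (B := ProdRing X Y) (sumToProd X Y) := by
  refine algHom_finite_of_disjointAtInfinity hXY (sumToProd X Y) (prodCoord X Y)
    (aeval_prodCoord_surjective X Y) (prodEval X Y) (prodEval_separating X Y) (fun c => ?_)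
    (fun c => ?_) (coord _) (sumToProd_coord X Y)
  · convert c.1.2
    simp [prodEval, prodCoord]
  · convert c.2.2
    simp [prodEval, prodCoord]

end Cones

/-! ### The locus at infinity of the cone of sums has codimension at least two -/

section Dimension
open MvPolynomial TensorProduct

theorem one_tmul_mem_nonZeroDivisors {k A B : Type*} [Field k] [CommRing A] [CommRing B] [Algebra k A]
    [Algebra k B] {b : B} (hb : b ∈ nonZeroDivisors B) :
    (1 : A) ⊗ₜ[k] b ∈ nonZeroDivisors (A ⊗[k] B) := by
  rw [mem_nonZeroDivisors_iff_right] at hb ⊢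
  have h1 : Function.Injective (LinearMap.mulRight k b) := by
    rw [injective_iff_map_eq_zero]
    exact fun x hx => hb x hx
  have h2 := Module.Flat.lTensor_preserves_injective_linearMap (M := A) _ h1
  intro x hx
  refine (injective_iff_map_eq_zero _).1 h2 x ?_
  rw [← hx]
  refine LinearMap.congr_fun (f := LinearMap.lTensor A (LinearMap.mulRight k b))
    (g := LinearMap.mulRight k ((1 : A) ⊗ₜ[k] b)) (TensorProduct.ext' fun x y => ?_) x
  simp

theorem tmul_one_mem_nonZeroDivisors {k A B : Type*} [Field k] [CommRing A] [CommRing B] [Algebra k A]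
    [Algebra k B] {a : A} (ha : a ∈ nonZeroDivisors A) :
    a ⊗ₜ[k] (1 : B) ∈ nonZeroDivisors (A ⊗[k] B) := by
  rw [mem_nonZeroDivisors_iff_right] at ha ⊢
  have h1 : Function.Injective (LinearMap.mulRight k a) := by
    rw [injective_iff_map_eq_zero]
    exact fun x hx => ha x hx
  have h2 := Module.Flat.rTensor_preserves_injective_linearMap (M := B) _ h1
  intro x hx
  refine (injective_iff_map_eq_zero _).1 h2 x ?_
  rw [← hx]
  refine LinearMap.congr_fun (f := LinearMap.rTensor B (LinearMap.mulRight k a))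
    (g := LinearMap.mulRight k (a ⊗ₜ[k] (1 : B))) (TensorProduct.ext' fun x y => ?_) x
  simp

/-- The two elements live in different factors: after dividing by a, the element b is still regular
by flatness over the field, so each of the two quotients lowers the dimension. -/
theorem ringKrullDim_tensorProduct_quotient_add_two_le {k A B : Type*} [Field k] [CommRing A]
    [CommRing B] [Algebra k A] [Algebra k B] {a : A} (ha : a ∈ nonZeroDivisors A) {b : B}
    (hb : b ∈ nonZeroDivisors B) (J : Ideal (A ⊗[k] B)) (haJ : a ⊗ₜ 1 ∈ J) (hbJ : 1 ⊗ₜ b ∈ J) :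
    ringKrullDim ((A ⊗[k] B) ⧸ J) + 2 ≤ ringKrullDim (A ⊗[k] B) := by
  let A' := A ⧸ Ideal.span {a}
  let f : A ⊗[k] B →ₐ[k] A' ⊗[k] B :=
    Algebra.TensorProduct.map (Ideal.Quotient.mkₐ k _) (AlgHom.id k B)
  have hf : Function.Surjective f :=
    TensorProduct.map_surjective Ideal.Quotient.mk_surjective Function.surjective_id
  have h1 : ringKrullDim (A' ⊗[k] B) + 1 ≤ ringKrullDim (A ⊗[k] B) := by
    refine ringKrullDim_succ_le_of_surjective f.toRingHom hf
      (tmul_one_mem_nonZeroDivisors (k := k) (B := B) ha) ?_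
    change f (a ⊗ₜ 1) = 0
    have : Ideal.Quotient.mk (Ideal.span {a}) a = 0 :=
      Ideal.Quotient.eq_zero_iff_mem.2 (Ideal.mem_span_singleton_self a)
    rw [Algebra.TensorProduct.map_tmul, Ideal.Quotient.mkₐ_eq_mk, this, zero_tmul]
  let g₁ : A' →ₐ[k] (A ⊗[k] B) ⧸ J := Ideal.Quotient.liftₐ _
    ((Ideal.Quotient.mkₐ k J).comp Algebra.TensorProduct.includeLeft) (by
      intro x hx
      obtain ⟨y, rfl⟩ := Ideal.mem_span_singleton.1 hx
      rw [map_mul]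
      have : ((Ideal.Quotient.mkₐ k J).comp Algebra.TensorProduct.includeLeft) a = 0 :=
        Ideal.Quotient.eq_zero_iff_mem.2 haJ
      rw [this, zero_mul])
  let g : A' ⊗[k] B →ₐ[k] (A ⊗[k] B) ⧸ J := Algebra.TensorProduct.lift g₁
    ((Ideal.Quotient.mkₐ k J).comp Algebra.TensorProduct.includeRight) fun _ _ => Commute.all _ _
  have hg : Function.Surjective g := by
    have h2 : g.comp f = Ideal.Quotient.mkₐ k J := by
      ext x
      · change g₁ (Ideal.Quotient.mk _ x) * Ideal.Quotient.mk J ((1 : A) ⊗ₜ (1 : B)) =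
          Ideal.Quotient.mk J (x ⊗ₜ 1)
        rw [← Algebra.TensorProduct.one_def, map_one, mul_one]
        rfl
      · simp [g, f]
    have h3 : Function.Surjective (g.comp f) := by
      rw [h2]; exact Ideal.Quotient.mk_surjective
    exact Function.Surjective.of_comp h3
  have h4 : ringKrullDim ((A ⊗[k] B) ⧸ J) + 1 ≤ ringKrullDim (A' ⊗[k] B) := by
    refine ringKrullDim_succ_le_of_surjective g.toRingHom hg
      (one_tmul_mem_nonZeroDivisors (k := k) (A := A') hb) ?_
    change g (1 ⊗ₜ b) = 0
    simp only [g, Algebra.TensorProduct.lift_tmul, map_one, one_mul]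
    exact Ideal.Quotient.eq_zero_iff_mem.2 hbJ
  calc ringKrullDim ((A ⊗[k] B) ⧸ J) + 2 = ringKrullDim ((A ⊗[k] B) ⧸ J) + 1 + 1 := by
        rw [add_assoc]; norm_num
    _ ≤ ringKrullDim (A' ⊗[k] B) + 1 := by gcongr
    _ ≤ _ := h1

/-- A prime of T lying over a prime that contains J contains the extension of J, so lying over
persists for the quotients. -/
theorem ringKrullDim_quotient_le_of_isIntegral {S T : Type*} [CommRing S] [CommRing T] (f : S →+* T)
    (hf : f.IsIntegral) (hi : Function.Injective f) (J : Ideal S) :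
    ringKrullDim (S ⧸ J) ≤ ringKrullDim (T ⧸ J.map f) := by
  let g : S ⧸ J →+* T ⧸ J.map f := Ideal.quotientMap _ f Ideal.le_comap_map
  have hg : g.IsIntegral := by
    intro x
    obtain ⟨t, rfl⟩ := Ideal.Quotient.mk_surjective x
    obtain ⟨p, hp, hp0⟩ := hf t
    refine ⟨p.map (Ideal.Quotient.mk J), hp.map _, ?_⟩
    rw [Polynomial.eval₂_map]
    have : g.comp (Ideal.Quotient.mk J) = (Ideal.Quotient.mk _).comp f := by
      ext x; simp [g]
    rw [this, ← Polynomial.hom_eval₂, hp0, map_zero]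
  refine ringKrullDim_le_of_isIntegral_of_comap_surjective g hg ?_
  intro p
  obtain ⟨Q, hQ⟩ := RingHom.IsIntegral.comap_surjective hf hi
    (PrimeSpectrum.comap (Ideal.Quotient.mk J) p)
  have hJQ : J.map f ≤ Q.asIdeal := by
    rw [Ideal.map_le_iff_le_comap]
    intro x hx
    have : x ∈ (PrimeSpectrum.comap (Ideal.Quotient.mk J) p).asIdeal := by
      rw [PrimeSpectrum.comap_asIdeal, Ideal.mem_comap, Ideal.Quotient.eq_zero_iff_mem.2 hx]
      exact zero_mem _
    rw [← hQ] at this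
    exact this
  have hQr : Q ∈ Set.range (PrimeSpectrum.comap (Ideal.Quotient.mk (J.map f))) := by
    rw [range_comap_of_surjective _ _ Ideal.Quotient.mk_surjective, Ideal.mk_ker]
    exact hJQ
  obtain ⟨Q', rfl⟩ := hQr
  refine ⟨Q', PrimeSpectrum.comap_injective_of_surjective _ Ideal.Quotient.mk_surjective ?_⟩
  rw [← hQ, ← PrimeSpectrum.comap_comp_apply, ← PrimeSpectrum.comap_comp_apply]
  congr 1

variable {k : Type u} [Field k] [IsAlgClosed k] {n : ℕ} {X Y : Set (Fin n → k)}

theorem isIntegral_sumToProd (hXY : DisjointAtInfinity X Y) :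
    RingHom.IsIntegral (R := CoordRing (sumCone X Y)) (A := ProdRing X Y) (sumToProd X Y).toRingHom :=
  (finite_sumToProd hXY).to_isIntegral

/-- The vertex ideal of the projection of the cone of sums to its first two coordinates. -/
noncomputable def infinityIdeal (X Y : Set (Fin n → k)) : Ideal (CoordRing (sumCone X Y)) :=
  Ideal.span (Set.range fun i => coord (sumCone X Y) (Sum.inl i))

/-- The bound is transferred from the product of the cones, which is finite over the cone of sums
and where u₀ and u₁ are regular elements of separate factors. -/
theorem ringKrullDim_quotient_infinityIdeal_add_two_le (hXY : DisjointAtInfinity X Y) :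
    ringKrullDim (CoordRing (sumCone X Y) ⧸ infinityIdeal X Y) + 2 ≤
      ringKrullDim (CoordRing (sumCone X Y)) := by
  have h1 := ringKrullDim_quotient_le_of_isIntegral _ (isIntegral_sumToProd hXY)
    (sumToProd_injective X Y) (infinityIdeal X Y)
  have h2 := ringKrullDim_eq_of_isIntegral_of_injective _ (isIntegral_sumToProd hXY)
    (sumToProd_injective X Y)
  rw [h2]
  refine (add_le_add_left h1 2).trans (ringKrullDim_tensorProduct_quotient_add_two_le
    (coord_zero_mem_nonZeroDivisors X) (coord_zero_mem_nonZeroDivisors Y) _ ?_ ?_)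
  · have h3 : prodSumCoord X Y (Sum.inl 0) ∈ (infinityIdeal X Y).map (sumToProd X Y).toRingHom := by
      rw [← sumToProd_coord]
      exact Ideal.mem_map_of_mem (sumToProd X Y).toRingHom (Ideal.subset_span ⟨0, rfl⟩)
    exact h3
  · have h3 : prodSumCoord X Y (Sum.inl 1) ∈ (infinityIdeal X Y).map (sumToProd X Y).toRingHom := by
      rw [← sumToProd_coord]
      exact Ideal.mem_map_of_mem (sumToProd X Y).toRingHom (Ideal.subset_span ⟨1, rfl⟩)
    exact h3

end Dimension

/-! ### Noether normalization and the rank of the differentials -/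

section Projection
open MvPolynomial TensorProduct KaehlerDifferential

theorem finrank_kaehlerDifferential_le_of_isIntegral {k : Type*} {S : Type u} [Field k]
    [PerfectField k] [CommRing S] [Algebra k S] [Algebra.FiniteType k S] {ι : Type} [Fintype ι]
    (g : MvPolynomial ι k →ₐ[k] S) (hg : g.toRingHom.IsIntegral) (q : Ideal S) [q.IsPrime]
    (hq : IsField (Localization.AtPrime q)) :
    Module.finrank (Localization.AtPrime q) Ω[Localization.AtPrime q⁄k] ≤ Fintype.card ι := by
  let _ := hq.toField
  let b : ι → Localization.AtPrime q := fun i => algebraMap S _ (g (X i))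
  have hfin : Algebra.EssFiniteType k (Localization.AtPrime q) :=
    have := Algebra.EssFiniteType.of_isLocalization (Localization.AtPrime q) q.primeCompl
    Algebra.EssFiniteType.comp k S _
  have hint : ∀ s : S, IsAlgebraic (Algebra.adjoin k (Set.range b)) (algebraMap S (Localization.AtPrime q) s) := by
    intro s
    refine IsIntegral.isAlgebraic ?_
    obtain ⟨p, hp, hps⟩ := hg s
    let φ : MvPolynomial ι k →ₐ[k] Algebra.adjoin k (Set.range b) :=
      aeval fun i => ⟨b i, Algebra.subset_adjoin ⟨i, rfl⟩⟩
    refine ⟨p.map φ.toRingHom, hp.map _, ?_⟩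
    rw [Polynomial.eval₂_map]
    have : (algebraMap (Algebra.adjoin k (Set.range b)) (Localization.AtPrime q)).comp φ.toRingHom =
        (algebraMap S (Localization.AtPrime q)).comp g.toRingHom := by
      refine MvPolynomial.ringHom_ext (fun c => ?_) fun i => ?_
      · change algebraMap _ (Localization.AtPrime q) (φ (C c)) = algebraMap S _ (g (C c))
        rw [← algebraMap_eq, AlgHom.commutes, AlgHom.commutes, ← IsScalarTower.algebraMap_apply,
          ← IsScalarTower.algebraMap_apply]
      · change algebraMap _ (Localization.AtPrime q) (φ (X i)) = algebraMap S _ (g (X i))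
        rw [aeval_X]
        rfl
    rw [this, ← Polynomial.hom_eval₂, hps, map_zero]
  have halg : Algebra.IsAlgebraic (Algebra.adjoin k (Set.range b)) (Localization.AtPrime q) := by
    refine ⟨fun x => ?_⟩
    obtain ⟨a, s, rfl⟩ := IsLocalization.exists_mk'_eq q.primeCompl x
    have : IsLocalization.mk' (Localization.AtPrime q) a s =
        algebraMap S _ a * (algebraMap S (Localization.AtPrime q) s)⁻¹ := by
      rw [IsLocalization.mk'_eq_iff_eq_mul, mul_assoc, inv_mul_cancel₀, mul_one]
      exact (IsLocalization.map_units (Localization.AtPrime q) s).ne_zero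
    rw [this]
    exact (hint a).mul (hint s).inv
  exact finrank_kaehlerDifferential_le b

theorem span_D_localization_eq_top {k S σ : Type*} [CommRing k] [CommRing S] [Algebra k S] (v : σ → S)
    (hv : Function.Surjective (aeval v : MvPolynomial σ k →ₐ[k] S)) (q : Ideal S) [q.IsPrime] :
    Submodule.span (Localization.AtPrime q)
      (Set.range fun j => D k (Localization.AtPrime q) (algebraMap S _ (v j))) = ⊤ := by
  rw [eq_top_iff, ← span_range_map_derivation_of_isLocalization k S (Localization.AtPrime q) q.primeCompl,
    Submodule.span_le]
  rintro _ ⟨s, rfl⟩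
  obtain ⟨f, rfl⟩ := hv s
  rw [Function.comp_apply, map_D]
  induction f using MvPolynomial.induction_on with
  | C a => 
    rw [aeval_C, ← IsScalarTower.algebraMap_apply, Derivation.map_algebraMap]
    exact zero_mem _
  | add p q hp hq => 
    rw [map_add, map_add, map_add]; exact add_mem hp hq
  | mul_X p i hp => 
    rw [map_mul, map_mul, Derivation.leibniz, aeval_X]
    exact add_mem (Submodule.smul_mem _ _ (Submodule.subset_span ⟨i, rfl⟩)) (Submodule.smul_mem _ _ hp)

/-- A nonzero kernel would make S integral over a proper quotient of the polynomial ring, which has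
smaller dimension. -/
theorem algHom_injective_of_ringKrullDim_eq {k S ι : Type*} [Field k] [CommRing S] [Algebra k S]
    [Fintype ι] (g : MvPolynomial ι k →ₐ[k] S) (hg : g.toRingHom.IsIntegral)
    (hS : ringKrullDim S = Fintype.card ι) : Function.Injective g := by
  rw [injective_iff_map_eq_zero]
  intro f hf
  by_contra hf0
  let I := RingHom.ker g.toRingHom
  have h1 : ringKrullDim S ≤ ringKrullDim (MvPolynomial ι k ⧸ I) := by
    refine ringKrullDim_le_of_isIntegral (RingHom.kerLift g.toRingHom) ?_
    exact RingHom.IsIntegral.tower_top (Ideal.Quotient.mk I) _ hg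
  have h2 : ringKrullDim (MvPolynomial ι k ⧸ I) + 1 ≤ ringKrullDim (MvPolynomial ι k) :=
    ringKrullDim_succ_le_of_surjective (Ideal.Quotient.mk I) Ideal.Quotient.mk_surjective
      (mem_nonZeroDivisors_of_ne_zero hf0) (Ideal.Quotient.eq_zero_iff_mem.2 hf)
  rw [MvPolynomial.ringKrullDim_of_isNoetherianRing, ringKrullDim_eq_zero_of_field, zero_add] at h2
  rw [hS] at h1
  have h3 := (add_le_add_left h1 1).trans h2
  rw [Nat.card_eq_fintype_card] at h3
  have h4 : ((Fintype.card ι + 1 : ℕ) : WithBot ℕ∞) ≤ (Fintype.card ι : ℕ) := by exact_mod_cast h3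
  have := Nat.cast_le.1 h4
  omega

theorem exists_ringKrullDim_eq {k S : Type*} [Field k] [CommRing S] [Nontrivial S] [Algebra k S]
    [Algebra.FiniteType k S] : ∃ (s : ℕ) (g : MvPolynomial (Fin s) k →ₐ[k] S), ringKrullDim S = s ∧
      g.toRingHom.IsIntegral := by
  obtain ⟨s, g, hi, hf⟩ := exists_finite_inj_algHom_of_fg k S
  refine ⟨s, g, ?_, RingHom.Finite.to_isIntegral hf⟩
  rw [← ringKrullDim_eq_of_isIntegral_of_injective g.toRingHom (RingHom.Finite.to_isIntegral hf) hi,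
    MvPolynomial.ringKrullDim_of_isNoetherianRing, ringKrullDim_eq_zero_of_field, zero_add, Nat.card_fin]

end Projection

/-! ### The generic point of the cone of sums -/

section SumCone
open MvPolynomial TensorProduct KaehlerDifferential

variable {k : Type u} [Field k] {n : ℕ}

/-- Evaluation of polynomials in two variables over the functions on `X × Y`. -/
noncomputable def pairEval (X Y : Set (Fin n → k)) (c : (X × Y) × (Fin 2 → {s : k // s ≠ 0})) :
    MvPolynomial (Fin 2) (X × Y → k) →ₐ[k] k :=
  (aeval fun i => (c.2 i).1).comp (mapAlgHom (Pi.evalAlgHom k (fun _ : X × Y => k) c.1))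

theorem pairEval_separating [Infinite k] (X Y : Set (Fin n → k)) (f : MvPolynomial (Fin 2) (X × Y → k))
    (h : ∀ c, pairEval X Y c f = 0) : f = 0 := by
  ext m p
  have h1 : map (Pi.evalRingHom (fun _ : X × Y => k) p) f = 0 := by
    refine funext_set (fun _ => {s : k | s ≠ 0}) ?_ ?_
    · exact fun _ => (Set.finite_singleton (0 : k)).infinite_compl
    · intro x hx
      rw [map_zero]
      exact h (p, fun i => ⟨x i, hx i trivial⟩)
  have h2 := congrArg (coeff m) h1
  rwa [coeff_map] at h2

/-- The generic point `(s, r, s x + r y)`. -/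
noncomputable def genericVec (X Y : Set (Fin n → k)) :
    Fin 2 ⊕ Fin n → MvPolynomial (Fin 2) (X × Y → k) :=
  Sum.elim MvPolynomial.X fun j => MvPolynomial.X 0 * C (fun p => p.1.1 j) +
    MvPolynomial.X 1 * C (fun p => p.2.1 j)

theorem pairEval_genericVec (X Y : Set (Fin n → k)) (c) :
    (fun j => pairEval X Y c (genericVec X Y j)) =
      sumVec ((c.2 0).1 • homogenize c.1.1.1) ((c.2 1).1 • homogenize c.1.2.1) := by
  ext (i | j)
  · fin_cases i <;> simp [pairEval, genericVec, sumVec, homogenize]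
  · simp [pairEval, genericVec, sumVec, homogenize]

/-- Evaluation at the generic point embeds the coordinate ring into a polynomial ring in s and r
over the functions on X × Y, with u₀ and u₁ going to the variables. Independence therefore holds on
every component and in every characteristic. -/
theorem linearIndependent_D_coord_inl [Infinite k] (X Y : Set (Fin n → k))
    (q : Ideal (CoordRing (sumCone X Y))) [q.IsPrime] (hq : q ∈ minimalPrimes _) :
    LinearIndependent (Localization.AtPrime q) fun i : Fin 2 =>
      D k (Localization.AtPrime q) (algebraMap _ _ (coord (sumCone X Y) (Sum.inl i))) := by
  refine linearIndependent_D_of_minimalPrimes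
    (coordRingLift (pairEval X Y) (pairEval_separating X Y) (genericVec X Y) fun c => ?_)
    (coordRingLift_injective _ _ _ _ ?_) _ (fun i => coordRingLift_coord ..) q hq
  · rw [pairEval_genericVec]
    exact ⟨_, ⟨_, (c.2 0).2, _, c.1.1.2, rfl⟩, _, ⟨_, (c.2 1).2, _, c.1.2.2, rfl⟩, rfl⟩
  · rintro _ ⟨_, ⟨s, hs, x, hx, rfl⟩, _, ⟨r, hr, y, hy, rfl⟩, rfl⟩
    exact ⟨((⟨x, hx⟩, ⟨y, hy⟩), ![⟨s, hs⟩, ⟨r, hr⟩]), pairEval_genericVec X Y _⟩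

theorem zero_mem_zeroLocus_of_isHomogeneousIdeal {σ : Type} {I : Ideal (MvPolynomial σ k)}
    (hI : IsHomogeneousIdeal I) (hne : (zeroLocus k I).Nonempty) : (0 : σ → k) ∈ zeroLocus k I := by
  obtain ⟨v, hv⟩ := hne
  simpa using smul_mem_zeroLocus_of_isHomogeneousIdeal hI hv 0

theorem sumCone_nonempty {X Y : Set (Fin n → k)} (hX : X.Nonempty) (hY : Y.Nonempty) :
    (sumCone X Y).Nonempty := by
  obtain ⟨x, hx⟩ := hX
  obtain ⟨y, hy⟩ := hY
  exact ⟨_, _, ⟨1, one_ne_zero, x, hx, rfl⟩, _, ⟨1, one_ne_zero, y, hy, rfl⟩, rfl⟩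

instance {σ : Type} [Finite σ] (C : Set (σ → k)) : Algebra.FiniteType k (CoordRing C) :=
  Algebra.FiniteType.of_surjective (toCoordRing C) (toCoordRing_surjective C)

instance {σ : Type} [Finite σ] (C : Set (σ → k)) : IsNoetherianRing (CoordRing C) :=
  Algebra.FiniteType.isNoetherianRing k _

theorem coordRing_nontrivial {σ : Type} {C : Set (σ → k)} (hC : C.Nonempty) :
    Nontrivial (CoordRing C) := by
  obtain ⟨c, hc⟩ := hC
  exact (evalAt (subset_zeroLocus_vanishingIdeal C hc)).toRingHom.domain_nontrivial

theorem isMaximal_of_coord_mem {σ : Type} {C : Set (σ → k)} {p : Ideal (CoordRing C)} (hp : p.IsPrime)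
    (h : ∀ j, coord C j ∈ p) : p.IsMaximal := by
  have hs : Function.Surjective (algebraMap k (CoordRing C ⧸ p)) := by
    intro x
    obtain ⟨x, rfl⟩ := Ideal.Quotient.mk_surjective x
    obtain ⟨f, rfl⟩ := aeval_coord_surjective C x
    refine ⟨aeval (0 : σ → k) f, ?_⟩
    have h1 := comp_aeval_apply (coord C) (Ideal.Quotient.mkₐ k p) f
    have h2 : (fun j => Ideal.Quotient.mkₐ k p (coord C j)) = fun j => algebraMap k (CoordRing C ⧸ p) 0 := by
      ext j
      rw [map_zero]
      exact Ideal.Quotient.eq_zero_iff_mem.2 (h j)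
    rw [h2] at h1
    refine Eq.trans ?_ h1.symm
    exact comp_aeval_apply (0 : σ → k) (Algebra.ofId k (CoordRing C ⧸ p)) f
  have hi : Function.Injective (algebraMap k (CoordRing C ⧸ p)) :=
    have := Ideal.Quotient.nontrivial_iff.2 hp.ne_top
    (algebraMap k (CoordRing C ⧸ p)).injective
  exact Ideal.Quotient.maximal_of_isField _
    (MulEquiv.isField (Field.toIsField k) (RingEquiv.ofBijective _ ⟨hi, hs⟩).symm.toMulEquiv)

/-- A cone with a nonzero point on which given linear forms vanish has positive dimension modulo
these forms. -/
theorem eq_zero_of_ringKrullDim_quotient_le_zero [Infinite k] {σ : Type} {C : Set (σ → k)}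
    (hC : IsHomogeneousIdeal (vanishingIdeal k C)) (J : Ideal (CoordRing C))
    (hJ : ringKrullDim (CoordRing C ⧸ J) ≤ 0) {ι : Type*} (L : ι → MvPolynomial σ k)
    (hL : ∀ i, (L i).IsHomogeneous 1) (hJL : J = Ideal.span (Set.range fun i => toCoordRing C (L i)))
    {v : σ → k} (hv : v ∈ zeroLocus k (vanishingIdeal k C)) (h0 : ∀ i, aeval v (L i) = 0) : v = 0 := by
  by_contra hne
  obtain ⟨j, hj⟩ := Function.ne_iff.1 hne
  -- Restriction to the line through v maps the coordinate ring onto k[T] and kills J, so the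
  -- quotient would have dimension at least one.
  let g : MvPolynomial σ k →ₐ[k] Polynomial k := aeval fun j => Polynomial.C (v j) * Polynomial.X
  have hgeval : ∀ f t, (g f).eval t = aeval (t • v) f := by
    intro f t
    have h1 := comp_aeval_apply (fun j => Polynomial.C (v j) * Polynomial.X) (Polynomial.aeval t) f
    have h2 : (fun i => Polynomial.aeval t (Polynomial.C (v i) * Polynomial.X)) = t • v := by
      ext i
      rw [Polynomial.coe_aeval_eq_eval, Polynomial.eval_mul, Polynomial.eval_C, Polynomial.eval_X,
        Pi.smul_apply, smul_eq_mul, mul_comm]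
    rw [h2] at h1
    exact h1
  let χ : CoordRing C →ₐ[k] Polynomial k := liftCoordRing g fun f hf => Polynomial.funext fun t => by
    rw [hgeval, Polynomial.eval_zero]
    exact smul_mem_zeroLocus_of_isHomogeneousIdeal hC hv t f hf
  have hχ : Function.Surjective χ := by
    have h1 : Polynomial.X ∈ χ.range := by
      refine ⟨algebraMap k _ (v j)⁻¹ * coord C j, ?_⟩
      have h2 : χ (coord C j) = Polynomial.C (v j) * Polynomial.X := aeval_X _ j
      change χ (_ * _) = _
      rw [map_mul, AlgHom.commutes, h2, ← mul_assoc, Polynomial.algebraMap_eq, ← Polynomial.C_mul,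
        inv_mul_cancel₀ hj, Polynomial.C_1, one_mul]
    have h3 : Algebra.adjoin k {(Polynomial.X : Polynomial k)} ≤ χ.range := by
      rw [Algebra.adjoin_le_iff]; simpa using h1
    rw [Polynomial.adjoin_X, top_le_iff, AlgHom.range_eq_top] at h3
    exact h3
  have hker : J ≤ RingHom.ker χ.toRingHom := by
    rw [hJL, Ideal.span_le]
    rintro _ ⟨i, rfl⟩
    change g (L i) = 0
    refine Polynomial.funext fun t => ?_
    rw [hgeval, aeval_smul_of_isHomogeneous (hL i), h0, mul_zero, Polynomial.eval_zero]
  have h4 := ringKrullDim_le_of_surjective (Ideal.Quotient.lift J χ.toRingHom hker)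
    (Ideal.Quotient.lift_surjective_of_surjective _ _ hχ)
  have h5 := h4.trans hJ
  rw [Polynomial.ringKrullDim_of_isNoetherianRing, ringKrullDim_eq_zero_of_field] at h5
  exact absurd h5 (by decide)

end SumCone

/-! ### A finite, generically unramified projection that keeps u₀ and u₁ -/

section GoodProjection
open MvPolynomial TensorProduct KaehlerDifferential

variable {k : Type u} [Field k] {n : ℕ}

/-- The linear form given by a row of a matrix. -/
noncomputable def rowForm {ι σ : Type} [Fintype σ] (A : Matrix ι σ k) (i : ι) : MvPolynomial σ k :=
  ∑ j, C (A i j) * X j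

theorem rowForm_isHomogeneous {ι σ : Type} [Fintype σ] (A : Matrix ι σ k) (i : ι) :
    (rowForm A i).IsHomogeneous 1 :=
  IsHomogeneous.sum _ _ _ fun j _ => by simpa using (isHomogeneous_C σ (A i j)).mul (isHomogeneous_X k j)

theorem aeval_rowForm {ι σ : Type} [Fintype σ] {T : Type*} [CommRing T] [Algebra k T] (A : Matrix ι σ k) (i : ι)
    (v : σ → T) : aeval v (rowForm A i) = ∑ j, A i j • v j := by
  simp [rowForm, Algebra.smul_def]

/-- The projection matrix with rows `u₀`, `u₁` and the given forms in `w₁, …, wₙ`. -/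
def coneMatrix {d : ℕ} (ℓ : Fin d → Fin n → k) : Matrix (Fin 2 ⊕ Fin d) (Fin 2 ⊕ Fin n) k :=
  Matrix.fromBlocks 1 0 0 (Matrix.of ℓ)

/-- The linear combinations of `w₁, …, wₙ`. -/
noncomputable def coordCombination (X Y : Set (Fin n → k)) :
    (Fin n → k) →ₗ[k] CoordRing (sumCone X Y) :=
  Fintype.linearCombination k fun j => coord (sumCone X Y) (Sum.inr j)

theorem toCoordRing_rowForm_inl {d : ℕ} (ℓ : Fin d → Fin n → k) (X Y : Set (Fin n → k)) (i : Fin 2) :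
    toCoordRing (sumCone X Y) (rowForm (coneMatrix ℓ) (Sum.inl i)) = coord _ (Sum.inl i) := by
  rw [← aeval_coord, aeval_rowForm]
  simp [coneMatrix, Matrix.one_apply]

theorem toCoordRing_rowForm_inr {d : ℕ} (ℓ : Fin d → Fin n → k) (X Y : Set (Fin n → k)) (i : Fin d) :
    toCoordRing (sumCone X Y) (rowForm (coneMatrix ℓ) (Sum.inr i)) = coordCombination X Y (ℓ i) := by
  rw [← aeval_coord, aeval_rowForm]
  simp [coneMatrix, coordCombination, Fintype.linearCombination_apply]

/-- The d forms in w have two tasks at once: to cut the locus u₀ = u₁ = 0, of dimension at most d,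
down to the vertex, and to complete du₀, du₁ to spanning sets of the differentials at all minimal
primes. General forms do both. -/
theorem exists_good_projection [IsAlgClosed k] {X Y : Set (Fin n → k)} (hX : X.Nonempty)
    (hY : Y.Nonempty) (hXY : DisjointAtInfinity X Y) :
    ∃ (d : ℕ) (ℓ : Fin d → Fin n → k) (m : ℕ),
      ringKrullDim (CoordRing (sumCone X Y)) = (d + 2 : ℕ) ∧
      GeneratesInDegree (vanishingIdeal k (sumCone X Y)) (rowForm (coneMatrix ℓ)) m ∧
      ∀ (q : Ideal (CoordRing (sumCone X Y))) [q.IsPrime], q ∈ minimalPrimes _ →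
        Submodule.span (Localization.AtPrime q) (Set.range fun i => D k (Localization.AtPrime q)
          (algebraMap _ _ (toCoordRing (sumCone X Y) (rowForm (coneMatrix ℓ) i)))) = ⊤ := by
  have : Infinite k := IsAlgClosed.instInfinite
  set S := CoordRing (sumCone X Y) with hSdef
  have hnt : Nontrivial S := coordRing_nontrivial (sumCone_nonempty hX hY)
  obtain ⟨s, g, hs, hg⟩ := exists_ringKrullDim_eq (k := k) (S := S)
  have hdim := ringKrullDim_quotient_infinityIdeal_add_two_le hXY
  have hmem0 := zero_mem_zeroLocus_of_isHomogeneousIdeal (isHomogeneousIdeal_sumCone X Y)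
    ((sumCone_nonempty hX hY).mono (subset_zeroLocus_vanishingIdeal _))
  have hntJ : Nontrivial (S ⧸ infinityIdeal X Y) := by
    rw [Ideal.Quotient.nontrivial_iff]
    have hle : infinityIdeal X Y ≤ RingHom.ker (evalAt hmem0).toRingHom := by
      refine Ideal.span_le.2 ?_
      rintro _ ⟨i, rfl⟩
      exact evalAt_coord hmem0 _
    intro h
    rw [h, top_le_iff] at hle
    exact RingHom.ker_ne_top _ hle
  -- The vertex lies on u₀ = u₁ = 0, so this locus has dimension at least zero and the whole cone at
  -- least two.
  obtain ⟨d, rfl⟩ : ∃ d, s = d + 2 := by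
    have h1 : (0 : WithBot ℕ∞) ≤ ringKrullDim (S ⧸ infinityIdeal X Y) := ringKrullDim_nonneg_of_nontrivial
    have h2 : ((2 : ℕ) : WithBot ℕ∞) ≤ (s : ℕ) := by
      rw [← hs]
      refine le_trans ?_ hdim
      simpa using add_le_add_left h1 2
    exact ⟨s - 2, by have := Nat.cast_le.1 h2; omega⟩
  have hJd : ringKrullDim (S ⧸ infinityIdeal X Y) ≤ d := by
    have h1 : ringKrullDim (S ⧸ infinityIdeal X Y) + 2 ≤ d + 2 := by
      refine hdim.trans (hs.le.trans ?_)
      push_cast; rfl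
    exact ENat.WithBot.add_le_add_natCast_right_iff (c := 2).1 h1
  let Θ := {q : Ideal S // q ∈ minimalPrimes S}
  have hΘ : Finite Θ := (Ideal.finite_minimalPrimes_of_isNoetherianRing S ⊥).to_subtype
  have hprime : ∀ θ : Θ, θ.1.IsPrime := fun θ => θ.2.1.1
  have hfield : ∀ θ : Θ, IsField (Localization.AtPrime θ.1) := fun θ =>
    have : Ring.KrullDimLE 0 (Localization.AtPrime θ.1) := Ring.KrullDimLE.of_isLocalization θ.1 θ.2 _
    Ring.KrullDimLE.isField_of_isReduced
  have hfin : ∀ θ : Θ, Module.Finite (Localization.AtPrime θ.1) Ω[Localization.AtPrime θ.1⁄k] := fun θ => by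
    have := Algebra.EssFiniteType.of_isLocalization (Localization.AtPrime θ.1) θ.1.primeCompl
    have : Algebra.EssFiniteType k (Localization.AtPrime θ.1) := Algebra.EssFiniteType.comp k S _
    infer_instance
  let N : ∀ θ : Θ, Submodule (Localization.AtPrime θ.1) Ω[Localization.AtPrime θ.1⁄k] := fun θ =>
    Submodule.span _ (Set.range fun i : Fin 2 => D k (Localization.AtPrime θ.1)
      (algebraMap S _ (coord (sumCone X Y) (Sum.inl i))))
  let δ : ∀ θ : Θ, (Fin n → k) →ₗ[k] Ω[Localization.AtPrime θ.1⁄k] := fun θ =>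
    (D k (Localization.AtPrime θ.1)).toLinearMap ∘ₗ
      (IsScalarTower.toAlgHom k S (Localization.AtPrime θ.1)).toLinearMap ∘ₗ coordCombination X Y
  have hδ : ∀ θ x, δ θ x = D k (Localization.AtPrime θ.1) (algebraMap S _ (coordCombination X Y x)) :=
    fun θ x => rfl
  have hsingle : ∀ j, coordCombination X Y (Pi.single j 1) = coord (sumCone X Y) (Sum.inr j) := fun j => by
    simp [coordCombination]
  -- The differentials have rank at most d + 2 at each minimal prime, and du₀, du₁ contribute
  -- exactly two, so d forms are enough.
  obtain ⟨ℓ, hℓ1, hℓ2⟩ := exists_linearForms (coordCombination X Y) hfield δ d (infinityIdeal X Y) N hJd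
    (fun p hp hle hw => isMaximal_of_coord_mem hp (by
      rintro (i | j)
      · exact hle (Ideal.subset_span ⟨i, rfl⟩)
      · rw [← hsingle]; exact hw _))
    (fun θ => by
      rw [eq_top_iff, ← span_D_localization_eq_top (k := k) (coord (sumCone X Y)) (aeval_coord_surjective _) θ.1,
        Submodule.span_le]
      rintro _ ⟨i | j, rfl⟩
      · exact Submodule.mem_sup_left (Submodule.subset_span ⟨i, rfl⟩)
      · refine Submodule.mem_sup_right (Submodule.subset_span ⟨Pi.single j 1, ?_⟩)
        rw [hδ, hsingle])
    (fun θ => by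
      have h1 := finrank_kaehlerDifferential_le_of_isIntegral g hg θ.1 (hfield θ)
      have h2 := finrank_span_eq_card (linearIndependent_D_coord_inl X Y θ.1 θ.2)
      rw [Fintype.card_fin] at h1 h2
      change _ ≤ Module.finrank _ (N θ) + d
      rw [h2]
      omega)
  have hmax : ∃ m, GeneratesInDegree (vanishingIdeal k (sumCone X Y)) (rowForm (coneMatrix ℓ)) m := by
    refine exists_generatesInDegree (isHomogeneousIdeal_sumCone X Y) (rowForm_isHomogeneous _) ?_
    intro v hv h0
    refine eq_zero_of_ringKrullDim_quotient_le_zero (isHomogeneousIdeal_sumCone X Y) _ hℓ1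
      (rowForm (coneMatrix ℓ)) (rowForm_isHomogeneous _) ?_ hv h0
    rw [infinityIdeal, ← Ideal.span_union]
    congr 1
    ext x
    simp [toCoordRing_rowForm_inl, toCoordRing_rowForm_inr]
  obtain ⟨m, hm⟩ := hmax
  refine ⟨d, ℓ, m, hs, hm, fun q _ hq => ?_⟩
  rw [← hℓ2 ⟨q, hq⟩, ← Submodule.span_union]
  congr 1
  ext x
  simp [toCoordRing_rowForm_inl, toCoordRing_rowForm_inr, hδ]
  rfl

end GoodProjection

/-! ### Points of the cone of sums and closedness of αX + Y -/

section Points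
open MvPolynomial TensorProduct

/-- Points lift along injective integral homomorphisms. -/
theorem exists_algHom_comp_eq {k A B : Type*} [Field k] [IsAlgClosed k] [CommRing A] [CommRing B]
    [Algebra k A] [Algebra k B] (φ : A →ₐ[k] B) (hφ : φ.toRingHom.IsIntegral)
    (hi : Function.Injective φ) (χ : A →ₐ[k] k) : ∃ ψ : B →ₐ[k] k, ∀ a, ψ (φ a) = χ a := by
  have hmax : (RingHom.ker χ.toRingHom).IsMaximal :=
    RingHom.ker_isMaximal_of_surjective _ fun c => ⟨algebraMap k A c, χ.commutes c⟩
  obtain ⟨⟨Q, hQ⟩, hQc⟩ := RingHom.IsIntegral.comap_surjective hφ hi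
    ⟨RingHom.ker χ.toRingHom, hmax.isPrime⟩
  have hker : ∀ a, φ a ∈ Q ↔ χ a = 0 := fun a => by
    have := congrArg (fun p : PrimeSpectrum A => a ∈ p.asIdeal) hQc
    exact iff_of_eq this
  have hmk : ∀ a, algebraMap k (B ⧸ Q) (χ a) = Ideal.Quotient.mk Q (φ a) := fun a => by
    have h1 : φ (a - algebraMap k A (χ a)) ∈ Q := by
      rw [hker, map_sub, AlgHom.commutes]; exact sub_self _
    rw [map_sub, AlgHom.commutes] at h1
    exact (Ideal.Quotient.mk_eq_mk_iff_sub_mem _ _).2 h1 |>.symm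
  have hint : Algebra.IsIntegral k (B ⧸ Q) := by
    refine ⟨fun x => ?_⟩
    obtain ⟨b, rfl⟩ := Ideal.Quotient.mk_surjective x
    obtain ⟨p, hp, hp0⟩ := hφ b
    refine ⟨p.map χ.toRingHom, hp.map _, ?_⟩
    rw [Polynomial.eval₂_map]
    have : (algebraMap k (B ⧸ Q)).comp χ.toRingHom = (Ideal.Quotient.mk Q).comp φ.toRingHom :=
      RingHom.ext hmk
    rw [this, ← Polynomial.hom_eval₂, hp0, map_zero]
  have hbij := IsAlgClosed.algebraMap_bijective_of_isIntegral (k := k) (K := B ⧸ Q)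
  let e := (AlgEquiv.ofBijective (Algebra.ofId k (B ⧸ Q)) hbij).symm
  refine ⟨e.toAlgHom.comp (Ideal.Quotient.mkₐ k Q), fun a => ?_⟩
  change e (Ideal.Quotient.mk Q (φ a)) = χ a
  rw [← hmk, AlgEquiv.symm_apply_eq]
  rfl

variable {k : Type u} [Field k] {n : ℕ}

theorem exists_homogenization (f : MvPolynomial (Fin n) k) :
    ∃ (N : ℕ) (F : MvPolynomial (Fin (n + 1)) k), ∀ v : Fin (n + 1) → k, v 0 ≠ 0 →
      aeval v F = v 0 ^ N * aeval (fun j => v j.succ / v 0) f := by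
  induction f using MvPolynomial.induction_on with
  | C a => exact ⟨0, C a, fun v _ => by simp⟩
  | add p q hp hq =>
    obtain ⟨N₁, F₁, h₁⟩ := hp
    obtain ⟨N₂, F₂, h₂⟩ := hq
    refine ⟨N₁ + N₂, F₁ * X 0 ^ N₂ + F₂ * X 0 ^ N₁, fun v hv => ?_⟩
    rw [map_add, map_mul, map_mul, h₁ v hv, h₂ v hv, map_pow, map_pow, aeval_X, map_add]
    ring
  | mul_X p j hp =>
    obtain ⟨N, F, h⟩ := hp
    refine ⟨N + 1, F * X j.succ, fun v hv => ?_⟩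
    rw [map_mul, h v hv, aeval_X, map_mul, aeval_X]
    field_simp
    ring

/-- Homogenized equations of X vanish on the cone, hence on its closure, and may be dehomogenized
where the first coordinate is nonzero. -/
theorem div_mem_of_mem_zeroLocus_affineCone {X : Set (Fin n → k)} (hX : IsAffineVariety X)
    {v : Fin (n + 1) → k} (hv : v ∈ zeroLocus k (vanishingIdeal k (affineCone X))) (h0 : v 0 ≠ 0) :
    (fun j => v j.succ / v 0) ∈ X := by
  obtain ⟨I, rfl⟩ := hX
  intro f hf
  obtain ⟨N, F, hF⟩ := exists_homogenization f
  have h1 : F ∈ vanishingIdeal k (affineCone (zeroLocus k I)) := by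
    rintro _ ⟨s, hs, x, hx, rfl⟩
    rw [hF _ (by simpa [homogenize] using hs)]
    have : (fun j : Fin n => (s • homogenize x) j.succ / (s • homogenize x) 0) = x := by
      ext j
      simp [homogenize, hs]
    rw [this, hx f hf, mul_zero]
  have h2 := hv F h1
  rw [hF v h0] at h2
  exact (mul_eq_zero.1 h2).resolve_left (pow_ne_zero _ h0)

/-- A point of the closure lifts to a pair of points of the closed cones, by lying over. Their first
coordinates are α and 1, both nonzero, so the pair gives actual points of X and Y. -/
theorem mem_zeroLocus_sumCone_iff [IsAlgClosed k] {X Y : Set (Fin n → k)} (hX : IsAffineVariety X)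
    (hY : IsAffineVariety Y) (hXY : DisjointAtInfinity X Y) (α : kˣ) (w : Fin n → k) :
    Sum.elim ![(α : k), 1] w ∈ zeroLocus k (vanishingIdeal k (sumCone X Y)) ↔ w ∈ α • X + Y := by
  constructor
  · intro hw
    obtain ⟨ψ, hψ⟩ := exists_algHom_comp_eq (B := ProdRing X Y) (sumToProd X Y) (isIntegral_sumToProd hXY)
      (sumToProd_injective X Y) (evalAt hw)
    let p : Fin (n + 1) → k := fun j => ψ (prodCoord X Y (Sum.inl j))
    let q : Fin (n + 1) → k := fun j => ψ (prodCoord X Y (Sum.inr j))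
    have hpq : sumVec p q = Sum.elim ![(α : k), 1] w := by
      ext j
      have h1 := hψ (coord _ j)
      rw [sumToProd_coord, apply_prodSumCoord, evalAt_coord] at h1
      exact h1
    have hp0 : p 0 = α := congrFun hpq (Sum.inl 0)
    have hq0 : q 0 = 1 := congrFun hpq (Sum.inl 1)
    have hp : p ∈ zeroLocus k (vanishingIdeal k (affineCone X)) :=
      apply_coord_mem_zeroLocus (ψ.comp (Algebra.TensorProduct.includeLeft :
        CoordRing (affineCone X) →ₐ[k] ProdRing X Y))
    have hq : q ∈ zeroLocus k (vanishingIdeal k (affineCone Y)) :=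
      apply_coord_mem_zeroLocus (ψ.comp (Algebra.TensorProduct.includeRight :
        CoordRing (affineCone Y) →ₐ[k] ProdRing X Y))
    have hx := div_mem_of_mem_zeroLocus_affineCone hX hp (by rw [hp0]; exact α.ne_zero)
    have hy := div_mem_of_mem_zeroLocus_affineCone hY hq (by rw [hq0]; exact one_ne_zero)
    refine Set.mem_add.2 ⟨_, Set.smul_mem_smul_set hx, _, hy, ?_⟩
    ext j
    have h2 : p j.succ + q j.succ = w j := congrFun hpq (Sum.inr j)
    rw [Pi.add_apply, Pi.smul_apply, hp0, hq0, Units.smul_def, smul_eq_mul,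
      mul_div_cancel₀ _ α.ne_zero, div_one, h2]
  · intro hw
    obtain ⟨_, ⟨x, hx, rfl⟩, y, hy, rfl⟩ := Set.mem_add.1 hw
    refine subset_zeroLocus_vanishingIdeal _ ⟨_, ⟨α, α.ne_zero, x, hx, rfl⟩, _, ⟨1, one_ne_zero, y, hy, rfl⟩, ?_⟩
    ext (i | j)
    · fin_cases i <;> simp [sumVec, homogenize]
    · simp [sumVec, homogenize]

theorem minkowskiSum_eq [IsAlgClosed k] {X Y : Set (Fin n → k)} (hX : IsAffineVariety X)
    (hY : IsAffineVariety Y) (hXY : DisjointAtInfinity X Y) (α : kˣ) :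
    minkowskiSum (α • X) Y = α • X + Y := by
  refine Set.Subset.antisymm ?_ (subset_zeroLocus_vanishingIdeal _)
  intro w hw
  rw [← mem_zeroLocus_sumCone_iff hX hY hXY]
  intro f hf
  let g : MvPolynomial (Fin n) k := aeval (Sum.elim ![C (α : k), 1] MvPolynomial.X) f
  have hg : ∀ w : Fin n → k, aeval w g = aeval (Sum.elim ![(α : k), 1] w) f := fun w => by
    rw [comp_aeval_apply]
    congr 2
    ext (i | j)
    · fin_cases i <;> simp
    · simp
  rw [← hg]
  refine hw g fun w' hw' => ?_
  rw [hg]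
  exact (mem_zeroLocus_sumCone_iff hX hY hXY α w').2 hw' f hf

end Points

/-! ### The common fibre cardinality -/

section Structure
open MvPolynomial TensorProduct KaehlerDifferential

variable {k : Type u} [Field k] {n : ℕ}

/-- The projection of a set defined by the rows of a matrix, on coordinate rings. -/
noncomputable def projHom {ι σ : Type} [Fintype σ] (A : Matrix ι σ k) (C : Set (σ → k)) :
    MvPolynomial ι k →ₐ[k] CoordRing C :=
  aeval fun i => toCoordRing C (rowForm A i)

theorem projHom_X {ι σ : Type} [Fintype σ] (A : Matrix ι σ k) (C : Set (σ → k)) (i : ι) :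
    projHom A C (X i) = toCoordRing C (rowForm A i) :=
  aeval_X _ i

theorem evalAt_toCoordRing {σ : Type} {C : Set (σ → k)} {c : σ → k}
    (hc : c ∈ zeroLocus k (vanishingIdeal k C)) (f : MvPolynomial σ k) :
    evalAt hc (toCoordRing C f) = aeval c f :=
  rfl

theorem exists_mem_zeroLocus_mulVec_eq [IsAlgClosed k] {ι σ : Type} [Fintype σ] {A : Matrix ι σ k}
    {C : Set (σ → k)} (hfin : (projHom A C).Finite) (hinj : Function.Injective (projHom A C))
    (c : ι → k) : ∃ v ∈ zeroLocus k (vanishingIdeal k C), A.mulVec v = c := by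
  obtain ⟨ψ, hψ⟩ := exists_algHom_comp_eq (projHom A C) (RingHom.Finite.to_isIntegral hfin) hinj (aeval c)
  refine ⟨_, apply_coord_mem_zeroLocus ψ, ?_⟩
  ext i
  have h1 := hψ (X i)
  rw [projHom_X, aeval_X, ← aeval_coord, comp_aeval_apply, aeval_rowForm] at h1
  simpa [Matrix.mulVec, dotProduct] using h1

/-- The number of points in the general fibre of perturbations of a linear projection. -/
theorem exists_generic_encard [IsAlgClosed k] {ι σ : Type} [Fintype σ] [Fintype ι] {C : Set (σ → k)}
    {A : Matrix ι σ k} {m : ℕ} (hm : GeneratesInDegree (vanishingIdeal k C) (rowForm A) m)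
    (hspan : ∀ (q : Ideal (CoordRing C)) [q.IsPrime], q ∈ minimalPrimes _ →
        Submodule.span (Localization.AtPrime q) (Set.range fun i => D k (Localization.AtPrime q)
          (algebraMap _ _ (toCoordRing C (rowForm A i)))) = ⊤) :
    ∃ e : ℕ, ∀ (ι' : Type) [Finite ι'] (E : Matrix ι σ (MvPolynomial ι' k)),
      ∃ F : MvPolynomial ι (MvPolynomial (Option ι') k), F ≠ 0 ∧
        ∀ (x : Option ι' → k) (c : ι → k), eval₂ (eval x) c F ≠ 0 →
          {v ∈ zeroLocus k (vanishingIdeal k C) |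
            (A + x none • E.map (eval fun a => x (some a))).mulVec v = c}.encard = e ∧
          ∀ v ∈ zeroLocus k (vanishingIdeal k C),
            (A + x none • E.map (eval fun a => x (some a))).mulVec v = 0 → v = 0 := by
  let S := CoordRing C
  let _ : Algebra (MvPolynomial ι k) S := (projHom A C).toRingHom.toAlgebra
  have htower : IsScalarTower k (MvPolynomial ι k) S :=
    IsScalarTower.of_algebraMap_eq fun c => ((projHom A C).commutes c).symm
  have hX : ∀ i, algebraMap (MvPolynomial ι k) S (X i) = toCoordRing C (rowForm A i) := projHom_X A C
  have hrow : ∀ i, toCoordRing C (rowForm A i) = ∑ j, A i j • coord C j := fun i => by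
    rw [← aeval_coord, aeval_rowForm]
  have hfin : Module.Finite (MvPolynomial ι k) S :=
    finite_of_generatesInDegree hm (coord C) (aeval_coord_surjective C)
      (fun f hf => aeval_coord_eq_zero_iff.2 hf) X fun i => by rw [hX, aeval_coord]
  have hunr : Algebra.FormallyUnramified (FractionRing (MvPolynomial ι k))
      (FractionRing (MvPolynomial ι k) ⊗[MvPolynomial ι k] S) := by
    refine formallyUnramified_tensorProduct_of_minimalPrimes fun q hq hqm => ?_
    refine formallyUnramified_of_span_eq_top (k := k) (X : ι → MvPolynomial ι k) ?_
    rw [← hspan q hqm]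
    congr 2
    ext i
    rw [IsScalarTower.algebraMap_apply (MvPolynomial ι k) S, hX]
  -- The number is the generic rank of the unperturbed projection and is fixed before the
  -- perturbation E; this lets different families be compared.
  refine ⟨Module.finrank (FractionRing (MvPolynomial ι k))
    (FractionRing (MvPolynomial ι k) ⊗[MvPolynomial ι k] S), fun ι' _ E => ?_⟩
  obtain ⟨F, hF0, hF⟩ := exists_generic_card (coord C) (aeval_coord_surjective C) A
    (fun i => (hX i).trans (hrow i)) m (fun μ hμ => by
      obtain ⟨p, hp, hpI⟩ := hm μ hμ
      refine ⟨p, hp, ?_⟩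
      have := aeval_coord_eq_zero_iff.2 hpI
      rw [map_sub, sub_eq_zero, map_sum] at this
      rw [this]
      refine Finset.sum_congr rfl fun i _ => ?_
      rw [map_mul, hX, aeval_coord C (rowForm A i)]) E
  refine ⟨F, hF0, fun x c hxc => ?_⟩
  obtain ⟨h1, h2⟩ := hF x c hxc
  have hmul : ∀ (v : σ → k) (c : ι → k), (A + x none • E.map (eval fun a => x (some a))).mulVec v = c ↔
      ∀ i, ∑ j, (A i j + x none * eval (fun a => x (some a)) (E i j)) * v j = c i := fun v c => by
    rw [funext_iff]; rfl
  constructor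
  · rw [← h1]
    refine (Set.encard_congr ?_).symm
    refine ((algHomEquivZeroLocus C).subtypeEquiv (q := fun v => (A + x none •
      E.map (eval fun a => x (some a))).mulVec v.1 = c) fun ψ => ((hmul _ c)).symm).trans ?_
    exact Equiv.subtypeSubtypeEquivSubtypeInter (· ∈ zeroLocus k (vanishingIdeal k C))
      fun v => (A + x none • E.map (eval fun a => x (some a))).mulVec v = c
  · intro v hv h0
    ext j
    have := h2 (evalAt hv) (by simpa using (hmul v 0).1 h0) j
    simpa using this

end Structure

/-! ### The degree of αX + Y -/

section AffineDegree
open MvPolynomial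

variable {k : Type u} [Field k] {n : ℕ} {X Y : Set (Fin n → k)}

theorem coneMatrix_mulVec_eq_iff {d : ℕ} (ℓ : Fin d → Fin n → k) (v : Fin 2 ⊕ Fin n → k) (a b : k)
    (c : Fin d → k) : (coneMatrix ℓ).mulVec v = Sum.elim ![a, b] c ↔
      v = Sum.elim ![a, b] (v ∘ Sum.inr) ∧ (Matrix.of ℓ).mulVec (v ∘ Sum.inr) = c := by
  rw [coneMatrix, Matrix.fromBlocks_mulVec, Matrix.zero_mulVec, Matrix.zero_mulVec, add_zero, zero_add,
    Matrix.one_mulVec, Sum.elim_eq_iff]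
  refine and_congr_left fun _ => ?_
  constructor
  · intro h
    rw [← h, Sum.elim_comp_inl_inr]
  · intro h
    rw [h, Sum.elim_comp_inl]

/-- The slice inherits from the good projection a finite map to affine d-space, which is onto
because every fibre over (α, 1, c) contains a point of the cone. -/
theorem hasAffineDim_add [IsAlgClosed k] (hX : IsAffineVariety X) (hY : IsAffineVariety Y)
    (hXY : DisjointAtInfinity X Y) {d : ℕ} {ℓ : Fin d → Fin n → k}
    (hfin : (projHom (coneMatrix ℓ) (sumCone X Y)).Finite)
    (hinj : Function.Injective (projHom (coneMatrix ℓ) (sumCone X Y))) (α : kˣ) :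
    HasAffineDim (α • X + Y) d := by
  have : Infinite k := IsAlgClosed.instInfinite
  set M := α • X + Y with hM
  let x : Fin 2 ⊕ Fin n → CoordRing M := Sum.elim ![algebraMap k _ (α : k), 1] (coord M)
  have hx : ∀ (w) (hw : w ∈ zeroLocus k (vanishingIdeal k M)) (f : MvPolynomial (Fin 2 ⊕ Fin n) k),
      evalAt hw (aeval x f) = aeval (Sum.elim ![(α : k), 1] w) f := fun w hw f => by
    rw [comp_aeval_apply]
    congr 2
    ext (i | j)
    · fin_cases i <;> simp [x]
    · simp [x]
  let θ : CoordRing (sumCone X Y) →ₐ[k] CoordRing M := liftCoordRing (aeval x) fun f hf =>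
    eq_zero_of_forall_evalAt fun w hw => by
      rw [hx]
      exact (mem_zeroLocus_sumCone_iff hX hY hXY α w).2 hw f hf
  have hθc : ∀ j, θ (coord _ j) = x j := fun j => aeval_X x j
  have hθ : Function.Surjective θ := fun y => by
    obtain ⟨f, rfl⟩ := aeval_coord_surjective M y
    refine ⟨aeval (fun j => coord (sumCone X Y) (Sum.inr j)) f, ?_⟩
    rw [comp_aeval_apply]
    congr 2
    ext j
    exact hθc _
  let ρ := projHom (Matrix.of ℓ) M
  let π : MvPolynomial (Fin 2 ⊕ Fin d) k →ₐ[k] MvPolynomial (Fin d) k :=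
    aeval (Sum.elim ![C (α : k), 1] MvPolynomial.X)
  have hcomp : ρ.comp π = θ.comp (projHom (coneMatrix ℓ) (sumCone X Y)) := by
    refine MvPolynomial.algHom_ext fun i => ?_
    rw [AlgHom.comp_apply, AlgHom.comp_apply, aeval_X, projHom_X]
    rcases i with i | i
    · rw [toCoordRing_rowForm_inl, hθc]
      fin_cases i
      · exact ρ.commutes (α : k)
      · exact map_one ρ
    · rw [Sum.elim_inr, projHom_X, ← aeval_coord, ← aeval_coord, comp_aeval_apply, aeval_rowForm,
        aeval_rowForm, Fintype.sum_sum_type]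
      simp [coneMatrix, hθc, x]
  have hρfin : ρ.Finite := by
    refine AlgHom.Finite.of_comp_finite (f := π) ?_
    rw [hcomp]
    exact AlgHom.Finite.comp (AlgHom.Finite.of_surjective θ hθ) hfin
  have hρinj : Function.Injective ρ := by
    rw [injective_iff_map_eq_zero]
    intro f hf
    refine MvPolynomial.funext fun c => ?_
    obtain ⟨v, hv, hvc⟩ := exists_mem_zeroLocus_mulVec_eq hfin hinj (Sum.elim ![(α : k), 1] c)
    obtain ⟨h1, h2⟩ := (coneMatrix_mulVec_eq_iff ℓ v _ _ c).1 hvc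
    rw [h1] at hv
    have hw := subset_zeroLocus_vanishingIdeal _ ((mem_zeroLocus_sumCone_iff hX hY hXY α _).1 hv)
    have h3 := congrArg (evalAt hw) hf
    rw [map_zero] at h3
    change evalAt hw (aeval _ f) = 0 at h3
    rw [comp_aeval_apply] at h3
    rw [map_zero, ← h3]
    change aeval c f = _
    congr 2
    ext i
    rw [evalAt_toCoordRing, aeval_rowForm, ← h2]
    rfl
  have hdim := ringKrullDim_eq_of_isIntegral_of_injective ρ.toRingHom (RingHom.Finite.to_isIntegral hρfin) hρinj
  rw [MvPolynomial.ringKrullDim_of_isNoetherianRing, ringKrullDim_eq_zero_of_field, zero_add,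
    Nat.card_fin] at hdim
  exact hdim.symm

/-- The witness also has two prescribed coordinates nonzero: the deformation parameter is inverted
later to realise arbitrary matrices, and the entry of c to normalise a scaling. -/
theorem exists_eval₂_ne_zero [Infinite k] {ι ι' : Type} [Finite ι] [Finite ι']
    {F : MvPolynomial ι (MvPolynomial (Option ι') k)} (hF : F ≠ 0) (i : ι) :
    ∃ (x : Option ι' → k) (c : ι → k), x none ≠ 0 ∧ c i ≠ 0 ∧ eval₂ (eval x) c F ≠ 0 := by
  obtain ⟨μ, hμ⟩ := ne_zero_iff.1 hF
  obtain ⟨x, hx⟩ : ∃ x, eval x (coeff μ F * X none) ≠ 0 := by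
    by_contra! h
    exact mul_ne_zero hμ (X_ne_zero _) (MvPolynomial.funext fun x => by rw [h, map_zero])
  rw [map_mul, eval_X] at hx
  have hF' : map (eval x) F ≠ 0 := by
    refine ne_zero_iff.2 ⟨μ, ?_⟩
    rw [coeff_map]
    exact left_ne_zero_of_mul hx
  obtain ⟨c, hc⟩ : ∃ c, eval c (map (eval x) F * X i) ≠ 0 := by
    by_contra! h
    exact mul_ne_zero hF' (X_ne_zero _) (MvPolynomial.funext fun c => by rw [h, map_zero])
  rw [map_mul, eval_X, eval_map] at hc
  exact ⟨x, c, right_ne_zero_of_mul hx, right_ne_zero_of_mul hc, left_ne_zero_of_mul hc⟩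

theorem algHom_eval₂_aeval {ι ι' R : Type*} [CommRing R] [Algebra k R] (φ : R →ₐ[k] k) (x : ι' → R)
    (c : ι → R) (F : MvPolynomial ι (MvPolynomial ι' k)) :
    φ (eval₂ (aeval x : MvPolynomial ι' k →ₐ[k] R).toRingHom c F) =
      eval₂ (eval fun a => φ (x a)) (fun i => φ (c i)) F := by
  rw [← AlgHom.coe_toRingHom φ, ← AlgHom.toRingHom_eq_coe, hom_eval₂]
  congr 1
  refine MvPolynomial.ringHom_ext (fun a => ?_) fun a => ?_ <;> simp

theorem coneMatrix_add_smul {d : ℕ} (ℓ : Fin d → Fin n → k) (t : k) (ε : Fin d × Fin n → k) :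
    coneMatrix ℓ + t • (Matrix.fromBlocks 0 0 0 (Matrix.of fun i j => MvPolynomial.X (i, j)) :
      Matrix (Fin 2 ⊕ Fin d) (Fin 2 ⊕ Fin n) (MvPolynomial (Fin d × Fin n) k)).map (eval ε) =
      coneMatrix fun i j => ℓ i j + t * ε (i, j) := by
  ext (i | i) (j | j) <;> simp [coneMatrix]

/-- The point w is sent to β(α, 1, w) in the cone. The scalar β is needed because the value u₁ = 1
need not belong to a generic right-hand side; the constant column of B moves to the right-hand side.
-/
theorem encard_affine_section [IsAlgClosed k] (hX : IsAffineVariety X) (hY : IsAffineVariety Y)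
    (hXY : DisjointAtInfinity X Y) {d : ℕ} (B : Matrix (Fin d) (Fin (n + 1)) k) (α : kˣ) {β : k}
    (hβ : β ≠ 0) :
    {w ∈ α • X + Y | homogenize w ∈ LinearMap.ker B.mulVecLin}.encard =
      {v ∈ zeroLocus k (vanishingIdeal k (sumCone X Y)) |
        (coneMatrix fun i j => B i j.succ).mulVec v =
          Sum.elim ![α * β, β] fun i => -β * B i 0}.encard := by
  have : Infinite k := IsAlgClosed.instInfinite
  let g : (Fin n → k) → Fin 2 ⊕ Fin n → k := fun w => β • Sum.elim ![(α : k), 1] w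
  have hg : Function.Injective g := fun w w' h => by
    ext j
    have := congrFun h (Sum.inr j)
    exact mul_left_cancel₀ hβ this
  have hgw : ∀ w, g w = Sum.elim ![α * β, β] (β • w) := fun w => by
    ext (i | j)
    · fin_cases i <;> simp [g, mul_comm]
    · simp [g]
  have hker : ∀ w, homogenize w ∈ LinearMap.ker B.mulVecLin ↔
      (Matrix.of fun i (j : Fin n) => B i j.succ).mulVec (β • w) = fun i => -β * B i 0 := fun w => by
    rw [LinearMap.mem_ker, Matrix.mulVecLin_apply, Matrix.mulVec_smul, funext_iff, funext_iff]
    refine forall_congr' fun i => ?_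
    simp only [Matrix.mulVec, dotProduct, Fin.sum_univ_succ, homogenize, Fin.cons_zero, Fin.cons_succ,
      mul_one, Pi.zero_apply, Pi.smul_apply, Matrix.of_apply, smul_eq_mul]
    rw [neg_mul, ← mul_neg, mul_right_inj' hβ, add_comm, add_eq_zero_iff_eq_neg]
  rw [← hg.encard_image]
  congr 1
  ext v
  constructor
  · rintro ⟨w, ⟨hw, hwB⟩, rfl⟩
    refine ⟨smul_mem_zeroLocus_of_isHomogeneousIdeal (isHomogeneousIdeal_sumCone X Y)
      ((mem_zeroLocus_sumCone_iff hX hY hXY α w).2 hw) β, ?_⟩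
    rw [coneMatrix_mulVec_eq_iff, hgw]
    exact ⟨rfl, (hker w).1 hwB⟩
  · rintro ⟨hv, hvc⟩
    rw [coneMatrix_mulVec_eq_iff] at hvc
    have hgv : g (β⁻¹ • (v ∘ Sum.inr)) = v := by
      rw [hgw, smul_smul, mul_inv_cancel₀ hβ, one_smul, ← hvc.1]
    refine ⟨β⁻¹ • (v ∘ Sum.inr), ⟨?_, ?_⟩, hgv⟩
    · rw [← mem_zeroLocus_sumCone_iff hX hY hXY]
      have h1 := smul_mem_zeroLocus_of_isHomogeneousIdeal (isHomogeneousIdeal_sumCone X Y) hv β⁻¹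
      rw [← hgv, smul_smul, inv_mul_cancel₀ hβ, one_smul] at h1
      exact h1
    · rw [hker, smul_smul, mul_inv_cancel₀ hβ, one_smul]
      exact hvc.2

theorem eventually_hasAffineDegree_add [IsAlgClosed k] (hX : IsAffineVariety X) (hY : IsAffineVariety Y)
    (hXY : DisjointAtInfinity X Y) {d e : ℕ} {ℓ : Fin d → Fin n → k}
    (hdim : ∀ α : kˣ, HasAffineDim (α • X + Y) d)
    {F : MvPolynomial (Fin 2 ⊕ Fin d) (MvPolynomial (Option (Fin d × Fin n)) k)} (hF0 : F ≠ 0)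
    (hF : ∀ (x : Option (Fin d × Fin n) → k) (c : Fin 2 ⊕ Fin d → k), eval₂ (eval x) c F ≠ 0 →
      {v ∈ zeroLocus k (vanishingIdeal k (sumCone X Y)) |
        (coneMatrix fun i j => ℓ i j + x none * x (some (i, j))).mulVec v = c}.encard = e) :
    ∀ᶠ α : kˣ in Filter.cofinite, HasAffineDegree (α • X + Y) e := by
  have : Infinite k := IsAlgClosed.instInfinite
  obtain ⟨x, c, hx, hβ, hxc⟩ := exists_eval₂_ne_zero hF0 (Sum.inl 1)
  set τ := x none with hτ
  set β := c (Sum.inl 1) with hβdef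
  -- The genericity condition at the witness, with only the first entry αβ of the right-hand side
  -- varying. It is nonzero since α = c₀ / β recovers the witness, and its roots are the exceptional
  -- α.
  let h : Polynomial k := eval₂ (aeval fun a => Polynomial.C (x a) :
    MvPolynomial _ k →ₐ[k] Polynomial k).toRingHom
    (Sum.elim ![Polynomial.X * Polynomial.C β, Polynomial.C β] fun i => Polynomial.C (c (Sum.inr i))) F
  have hh : ∀ α : k, h.eval α = eval₂ (eval x) (Sum.elim ![α * β, β] fun i => c (Sum.inr i)) F := fun α => by
    refine (algHom_eval₂_aeval (Polynomial.aeval α) _ _ F).trans ?_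
    congr 1
    · simp
    · ext (i | i)
      · fin_cases i
        · simpa using mul_comm _ _
        · simp
      · simp
  have hh0 : h ≠ 0 := by
    intro h0
    refine hxc ?_
    have h1 := hh (c (Sum.inl 0) / β)
    rw [h0, Polynomial.eval_zero, div_mul_cancel₀ _ hβ] at h1
    rw [h1]
    congr 1
    ext (i | i)
    · fin_cases i <;> rfl
    · rfl
  have hroots : {α : kˣ | h.eval (α : k) = 0}.Finite := by
    refine Set.Finite.of_finite_image (f := Units.val) ?_ Units.val_injective.injOn
    refine (Polynomial.finite_setOfPred_isRoot hh0).subset ?_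
    rintro _ ⟨α, hα, rfl⟩
    exact hα
  refine Filter.mem_cofinite.2 (hroots.subset fun α hα => ?_)
  by_contra hα0
  refine hα ⟨d, hdim α, ?_⟩
  -- The parameters are solved for in terms of B: the w-block ℓ + τε is B without its first column,
  -- and the right-hand side is -β times that column.
  let G : MvPolynomial (Fin d × Fin (n + 1)) k := eval₂ (aeval fun a : Option (Fin d × Fin n) =>
      a.elim (C τ) fun ij => C τ⁻¹ * (MvPolynomial.X (ij.1, ij.2.succ) - C (ℓ ij.1 ij.2)) :
        MvPolynomial _ k →ₐ[k] MvPolynomial (Fin d × Fin (n + 1)) k).toRingHom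
    (Sum.elim ![C (α * β), C β] fun i => -C β * MvPolynomial.X (i, 0)) F
  have hG : ∀ B : Fin d × Fin (n + 1) → k, eval B G = eval₂ (eval fun a : Option (Fin d × Fin n) =>
      a.elim τ fun ij => τ⁻¹ * (B (ij.1, ij.2.succ) - ℓ ij.1 ij.2))
      (Sum.elim ![α * β, β] fun i => -β * B (i, 0)) F := fun B => by
    refine (algHom_eval₂_aeval (aeval B) _ _ F).trans ?_
    congr 1
    · congr 1
      ext (_ | ij) <;> simp
    · ext (i | i)
      · fin_cases i <;> simp
      · simp
  refine ⟨G, fun hG0 => ?_, fun B _ hB => ?_⟩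
  · refine hα0 ?_
    -- The matrix B that reproduces the parameters of the witness; if G were zero, α would be a root
    -- of h.
    have h1 := hG fun ij => Fin.cases (motive := fun _ => k) (-β⁻¹ * c (Sum.inr ij.1))
      (fun j => ℓ ij.1 j + τ * x (some (ij.1, j))) ij.2
    rw [hG0, map_zero] at h1
    change h.eval (α : k) = 0
    rw [hh, h1]
    congr 1
    · congr 1
      ext (_ | ij)
      · rfl
      · simp [hx]
    · ext (i | i)
      · rfl
      · simp [hβ]
  · refine (encard_affine_section hX hY hXY B α hβ).trans ?_
    rw [hG] at hB
    have h2 := hF _ _ hB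
    simp only [Option.elim_none, Option.elim_some, mul_inv_cancel_left₀ hx, add_sub_cancel] at h2
    exact h2

end AffineDegree

/-! ### Invariance under linear changes of coordinates -/

section LinearChange
open MvPolynomial

variable {k : Type u} [Field k] {σ τ : Type} [Fintype σ] [DecidableEq σ]

/-- The pullback of polynomials along a linear map. -/
noncomputable def linearPullback (Φ : (σ → k) →ₗ[k] (τ → k)) : MvPolynomial τ k →ₐ[k] MvPolynomial σ k :=
  aeval (rowForm (LinearMap.toMatrix' Φ))

theorem aeval_linearPullback (Φ : (σ → k) →ₗ[k] (τ → k)) (t : σ → k) (f : MvPolynomial τ k) :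
    aeval t (linearPullback Φ f) = aeval (Φ t) f := by
  rw [linearPullback, comp_aeval_apply]
  congr 2
  ext l
  rw [aeval_rowForm]
  conv_rhs => rw [← LinearMap.toMatrix'_mulVec Φ t]
  rfl

variable [Fintype τ] [DecidableEq τ]

theorem mem_zeroLocus_image_iff (Φ : (σ → k) ≃ₗ[k] (τ → k)) (C : Set (σ → k)) (v : τ → k) :
    v ∈ zeroLocus k (vanishingIdeal k (Φ '' C)) ↔ Φ.symm v ∈ zeroLocus k (vanishingIdeal k C) := by
  constructor
  · intro hv f hf
    have h1 := hv (linearPullback Φ.symm.toLinearMap f) (by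
      rintro _ ⟨c, hc, rfl⟩
      rw [aeval_linearPullback, LinearEquiv.coe_coe, LinearEquiv.symm_apply_apply]
      exact hf c hc)
    rwa [aeval_linearPullback] at h1
  · intro hv f hf
    have h1 := hv (linearPullback Φ.toLinearMap f) (fun c hc => by
      rw [aeval_linearPullback]
      exact hf _ ⟨c, hc, rfl⟩)
    rwa [aeval_linearPullback, LinearEquiv.coe_coe, LinearEquiv.apply_symm_apply] at h1

theorem ringKrullDim_coordRing_le_image (Φ : (σ → k) ≃ₗ[k] (τ → k)) (C : Set (σ → k)) :
    ringKrullDim (CoordRing C) ≤ ringKrullDim (CoordRing (Φ '' C)) := by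
  let g : CoordRing (Φ '' C) →ₐ[k] CoordRing C :=
    liftCoordRing ((toCoordRing C).comp (linearPullback Φ.toLinearMap)) fun f hf => by
      rw [AlgHom.comp_apply, toCoordRing_eq_zero_iff]
      intro c hc
      rw [aeval_linearPullback]
      exact hf _ ⟨c, hc, rfl⟩
  refine ringKrullDim_le_of_surjective g.toRingHom fun y => ?_
  obtain ⟨f, rfl⟩ := toCoordRing_surjective C y
  refine ⟨toCoordRing _ (linearPullback Φ.symm.toLinearMap f), ?_⟩
  change toCoordRing C (linearPullback Φ.toLinearMap (linearPullback Φ.symm.toLinearMap f)) = _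
  rw [← sub_eq_zero, ← map_sub, toCoordRing_eq_zero_iff]
  intro c _
  rw [map_sub, aeval_linearPullback, aeval_linearPullback]
  simp

theorem ringKrullDim_coordRing_image (Φ : (σ → k) ≃ₗ[k] (τ → k)) (C : Set (σ → k)) :
    ringKrullDim (CoordRing (Φ '' C)) = ringKrullDim (CoordRing C) := by
  refine le_antisymm ?_ (ringKrullDim_coordRing_le_image Φ C)
  have := ringKrullDim_coordRing_le_image Φ.symm (Φ '' C)
  rwa [← Set.image_comp, show (Φ.symm ∘ Φ) = id from funext Φ.symm_apply_apply, Set.image_id] at this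

end LinearChange

/-! ### Projective closures and their affine cones -/

section ProjectiveCone
open MvPolynomial

variable {k : Type u} [Field k] {N : ℕ}

theorem eval_rep_eq_zero_iff {F : MvPolynomial (Fin (N + 1)) k} {m : ℕ} (hF : F.IsHomogeneous m)
    {v : Fin (N + 1) → k} (hv : v ≠ 0) :
    eval (Projectivization.mk k v hv).rep F = 0 ↔ aeval v F = 0 := by
  obtain ⟨a, ha⟩ := Projectivization.exists_smul_eq_mk_rep k v hv
  rw [← ha]
  change aeval ((a : k) • v) F = 0 ↔ _
  rw [aeval_smul_of_isHomogeneous hF, mul_eq_zero, or_iff_right (pow_ne_zero _ a.ne_zero)]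

/-- Passing to the closure adds no point at which a vanishing form becomes nonzero, so the ideal of
the join may be computed on the lines themselves. -/
theorem homogeneousVanishingIdeal_projZariskiClosure (Z : Set (ℙ k (Fin (N + 1) → k))) :
    homogeneousVanishingIdeal (projZariskiClosure Z) = homogeneousVanishingIdeal Z := by
  refine le_antisymm (Ideal.span_mono ?_) (Ideal.span_mono ?_)
  · rintro F ⟨hF, h⟩
    refine ⟨hF, fun p hp => h p fun G hG => ?_⟩
    have hle : homogeneousVanishingIdeal Z ≤ RingHom.ker (eval p.rep) :=
      Ideal.span_le.2 fun G hG => hG.2 p hp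
    exact hle hG
  · rintro F ⟨hF, h⟩
    exact ⟨hF, fun p hp => hp F (Ideal.subset_span ⟨hF, h⟩)⟩

theorem homogeneousVanishingIdeal_eq_vanishingIdeal {Z : Set (ℙ k (Fin (N + 1) → k))}
    {C : Set (Fin (N + 1) → k)} (hC : IsHomogeneousIdeal (vanishingIdeal k C))
    (h : ∀ F m, F.IsHomogeneous m → ((∀ p ∈ Z, eval p.rep F = 0) ↔ F ∈ vanishingIdeal k C)) :
    homogeneousVanishingIdeal Z = vanishingIdeal k C := by
  refine le_antisymm (Ideal.span_le.2 ?_) fun f hf => ?_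
  · rintro F ⟨⟨m, hm⟩, hF⟩
    exact (h F m hm).1 hF
  · rw [← sum_homogeneousComponent f]
    refine Ideal.sum_mem _ fun m _ => Ideal.subset_span ?_
    have hm := homogeneousComponent_isHomogeneous m f
    exact ⟨⟨m, hm⟩, (h _ m hm).2 (hC f hf m)⟩

theorem rep_mem_zeroLocus_of_mem_projectiveClosure [Infinite k] {X : Set (Fin N → k)}
    {p : ℙ k (Fin (N + 1) → k)} (hp : p ∈ projectiveClosure X) :
    p.rep ∈ zeroLocus k (vanishingIdeal k (affineCone X)) := by
  intro f hf
  rw [← sum_homogeneousComponent f, map_sum]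
  refine Finset.sum_eq_zero fun m _ => hp _ (Ideal.subset_span ⟨⟨m, homogeneousComponent_isHomogeneous m f⟩, ?_⟩)
  rintro _ ⟨x, hx, rfl⟩
  rw [toProj, eval_rep_eq_zero_iff (homogeneousComponent_isHomogeneous m f)]
  exact isHomogeneousIdeal_affineCone X f hf m _ ⟨1, one_ne_zero, x, hx, (one_smul _ _).symm⟩

theorem toProj_mem_projectiveClosure {X : Set (Fin N → k)} {x : Fin N → k} (hx : x ∈ X) :
    toProj x ∈ projectiveClosure X := by
  intro F hF
  have hle : homogeneousVanishingIdeal (toProj '' X) ≤ RingHom.ker (eval (toProj x).rep) :=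
    Ideal.span_le.2 fun G hG => hG.2 _ ⟨x, hx, rfl⟩
  exact hle hF

/-- A polynomial that vanishes on all sums from two sets vanishes on the sums from their
closures. -/
theorem aeval_add_eq_zero_of_mem_zeroLocus {σ : Type} {A B : Set (σ → k)} {f : MvPolynomial σ k}
    (h : ∀ a ∈ A, ∀ b ∈ B, aeval (a + b) f = 0) {a b : σ → k}
    (ha : a ∈ zeroLocus k (vanishingIdeal k A)) (hb : b ∈ zeroLocus k (vanishingIdeal k B)) :
    aeval (a + b) f = 0 := by
  let T : (σ → k) → MvPolynomial σ k := fun c => aeval (fun j => X j + C (c j)) f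
  have hT : ∀ c v, aeval v (T c) = aeval (v + c) f := fun c v => by
    rw [comp_aeval_apply]
    congr 2
    ext j
    simp
  have h1 : ∀ b ∈ B, aeval (a + b) f = 0 := fun b hb => by
    rw [← hT]
    exact ha _ fun a' ha' => by rw [hT]; exact h a' ha' b hb
  rw [add_comm, ← hT]
  exact hb _ fun b' hb' => by rw [hT, add_comm]; exact h1 b' hb'

/-- A cone is met by a linear subspace in as many lines as there are points on an affine hyperplane
that misses the intersection only at the vertex. -/
theorem encard_projective_section {C : Set (Fin (N + 1) → k)} (hC : ∀ v ∈ C, ∀ s : k, s • v ∈ C)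
    (W : Submodule k (Fin (N + 1) → k)) (η : (Fin (N + 1) → k) →ₗ[k] k)
    (h0 : ∀ v ∈ C, v ∈ W → η v = 0 → v = 0) :
    {p : ℙ k (Fin (N + 1) → k) | p.rep ∈ C ∧ p.submodule ≤ W}.encard =
      {v ∈ C | v ∈ W ∧ η v = 1}.encard := by
  -- The representative normalised by η = 1; η cannot vanish on a point of the section, by `h0`.
  let g : ℙ k (Fin (N + 1) → k) → Fin (N + 1) → k := fun p => (η p.rep)⁻¹ • p.rep
  have hsub : ∀ p : ℙ k (Fin (N + 1) → k), p.submodule ≤ W ↔ p.rep ∈ W := fun p => by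
    rw [Projectivization.submodule_eq, Submodule.span_singleton_le_iff_mem]
  have hne : ∀ p : ℙ k (Fin (N + 1) → k), p.rep ∈ C → p.rep ∈ W → η p.rep ≠ 0 := fun p hp hW h =>
    p.rep_nonzero (h0 _ hp hW h)
  have hmk : ∀ (p : ℙ k (Fin (N + 1) → k)) (hp : η p.rep ≠ 0) (hv : g p ≠ 0),
      Projectivization.mk k (g p) hv = p := fun p hp hv => by
    conv_rhs => rw [← p.mk_rep]
    rw [Projectivization.mk_eq_mk_iff']
    exact ⟨(η p.rep)⁻¹, rfl⟩
  have hg0 : ∀ p : ℙ k (Fin (N + 1) → k), η p.rep ≠ 0 → g p ≠ 0 := fun p hp =>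
    smul_ne_zero (inv_ne_zero hp) p.rep_nonzero
  have hinj : Set.InjOn g {p | p.rep ∈ C ∧ p.submodule ≤ W} := by
    intro p hp q hq hpq
    have hp' := hne p hp.1 ((hsub p).1 hp.2)
    have hq' := hne q hq.1 ((hsub q).1 hq.2)
    rw [← hmk p hp' (hg0 p hp'), ← hmk q hq' (hg0 q hq')]
    congr 1
  rw [← hinj.encard_image]
  congr 1
  ext v
  constructor
  · rintro ⟨p, hp, rfl⟩
    have hW := (hsub p).1 hp.2
    refine ⟨hC _ hp.1 _, W.smul_mem _ hW, ?_⟩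
    rw [map_smul, smul_eq_mul, inv_mul_cancel₀ (hne p hp.1 hW)]
  · rintro ⟨hv, hW, h1⟩
    have hv0 : v ≠ 0 := fun h => by rw [h, map_zero] at h1; exact zero_ne_one h1
    obtain ⟨a, ha⟩ := Projectivization.exists_smul_eq_mk_rep k v hv0
    refine ⟨Projectivization.mk k v hv0, ⟨?_, ?_⟩, ?_⟩
    · rw [← ha]; exact hC v hv a
    · rw [hsub, ← ha]; exact W.smul_mem _ hW
    · change (η (Projectivization.mk k v hv0).rep)⁻¹ • (Projectivization.mk k v hv0).rep = v
      rw [← ha, Units.smul_def, map_smul, h1, smul_eq_mul, mul_one, smul_smul, inv_mul_cancel₀ a.ne_zero,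
        one_smul]

end ProjectiveCone

/-! ### The join as a linear image of the cone of sums -/

section Join
open MvPolynomial

variable {k : Type u} [Field k] {n : ℕ}

/-- The linear coordinates `(u₀ + u₁, w₁, …, wₙ, z₀ u₀ + z₁ u₁)`. -/
noncomputable def joinEquiv (n : ℕ) {z₀ z₁ : k} (hz : z₀ ≠ z₁) :
    (Fin 2 ⊕ Fin n → k) ≃ₗ[k] (Fin (n + 1 + 1) → k) where
  toFun t := Fin.cons (α := fun _ => k) (t (Sum.inl 0) + t (Sum.inl 1))
    (Fin.snoc (α := fun _ => k) (fun j => t (Sum.inr j)) (z₀ * t (Sum.inl 0) + z₁ * t (Sum.inl 1)))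
  map_add' t t' := by
    ext i
    refine Fin.cases ?_ (fun i => Fin.lastCases ?_ (fun i => ?_) i) i <;>
      simp only [Fin.cons_zero, Fin.cons_succ, Fin.snoc_last, Fin.snoc_castSucc, Pi.add_apply] <;> ring
  map_smul' s t := by
    ext i
    refine Fin.cases ?_ (fun i => Fin.lastCases ?_ (fun i => ?_) i) i <;>
      simp only [Fin.cons_zero, Fin.cons_succ, Fin.snoc_last, Fin.snoc_castSucc, Pi.smul_apply,
        smul_eq_mul, RingHom.id_apply] <;> ring
  invFun v := Sum.elim ![(z₁ * v 0 - v (Fin.last n).succ) / (z₁ - z₀),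
    (v (Fin.last n).succ - z₀ * v 0) / (z₁ - z₀)] fun j => v j.castSucc.succ
  left_inv t := by
    have h : z₁ - z₀ ≠ 0 := sub_ne_zero.2 hz.symm
    ext (i | j)
    · fin_cases i <;>
        simp only [Fin.cons_zero, Fin.cons_succ, Fin.snoc_last, Sum.elim_inl, Fin.zero_eta,
          Fin.mk_one, Matrix.cons_val_zero, Matrix.cons_val_one] <;> field_simp <;> ring
    · simp only [Fin.cons_succ, Fin.snoc_castSucc, Sum.elim_inr]
  right_inv v := by
    have h : z₁ - z₀ ≠ 0 := sub_ne_zero.2 hz.symm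
    ext i
    refine Fin.cases ?_ (fun i => Fin.lastCases ?_ (fun i => ?_) i) i <;>
      simp only [Fin.cons_zero, Fin.cons_succ, Fin.snoc_last, Fin.snoc_castSucc, Sum.elim_inl,
        Sum.elim_inr, Matrix.cons_val_zero, Matrix.cons_val_one]
    · field_simp
      ring
    · field_simp
      ring

theorem joinEquiv_sumVec {z₀ z₁ : k} (hz : z₀ ≠ z₁) (s r : k) (x y : Fin n → k) :
    joinEquiv n hz (sumVec (s • homogenize x) (r • homogenize y)) =
      s • homogenize (Fin.snoc (α := fun _ => k) x z₀) + r • homogenize (Fin.snoc (α := fun _ => k) y z₁) := by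
  ext i
  change Fin.cons (α := fun _ => k) _ (Fin.snoc (α := fun _ => k) _ _) i = _
  refine Fin.cases ?_ (fun i => Fin.lastCases ?_ (fun i => ?_) i) i <;>
    simp only [homogenize, sumVec, Fin.cons_zero, Fin.cons_succ, Fin.snoc_last, Fin.snoc_castSucc,
      Pi.smul_apply, Pi.add_apply, smul_eq_mul, Sum.elim_inl, Sum.elim_inr, Matrix.cons_val_zero,
      Matrix.cons_val_one]
  ring

theorem toProj_snoc_ne {z₀ z₁ : k} (hz : z₀ ≠ z₁) (x y : Fin n → k) :
    toProj (Fin.snoc (α := fun _ => k) x z₀) ≠ toProj (Fin.snoc (α := fun _ => k) y z₁) := by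
  intro h
  rw [toProj, toProj, Projectivization.mk_eq_mk_iff'] at h
  obtain ⟨a, ha⟩ := h
  have h1 := congrFun ha 0
  have h2 := congrFun ha (Fin.last _)
  simp only [homogenize, Fin.cons_snoc_eq_snoc_cons] at h2
  simp [homogenize] at h1 h2
  rw [h1, one_mul] at h2
  exact hz h2.symm

/-- A vector on a line joining affine points of the two slices is s(1, x, z₀) + r(1, y, z₁), the
image of (s, r, s x + r y). Lines through points of the closures, and zero coefficients, satisfy the
same equations by continuity in each summand. -/
theorem homogeneousVanishingIdeal_setJoin [Infinite k] (X Y : Set (Fin n → k)) {z₀ z₁ : k} (hz : z₀ ≠ z₁) :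
    homogeneousVanishingIdeal (setJoin (projectiveClosure (slice X z₀)) (projectiveClosure (slice Y z₁))) =
      vanishingIdeal k (joinEquiv n hz '' sumCone X Y) := by
  refine homogeneousVanishingIdeal_eq_vanishingIdeal (isHomogeneousIdeal_vanishingIdeal ?_) ?_
  · rintro _ ⟨_, ⟨a, ha, b, hb, rfl⟩, rfl⟩ s hs
    exact ⟨_, ⟨_, smul_mem_affineCone ha hs, _, smul_mem_affineCone hb hs, smul_sumVec s a b⟩, map_smul _ _ _⟩
  · intro F m hF
    constructor
    · rintro h _ ⟨_, ⟨_, ⟨s, hs, x, hx, rfl⟩, _, ⟨r, hr, y, hy, rfl⟩, rfl⟩, rfl⟩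
      have hne : joinEquiv n hz (sumVec (s • homogenize x) (r • homogenize y)) ≠ 0 := by
        rw [Ne, LinearEquiv.map_eq_zero_iff]
        intro h0
        have := congrFun h0 (Sum.inl 0)
        simp [sumVec, homogenize, hs] at this
      rw [← eval_rep_eq_zero_iff hF hne]
      refine h _ ⟨toProj (Fin.snoc x z₀), toProj_mem_projectiveClosure ⟨x, hx, rfl⟩,
        toProj (Fin.snoc y z₁), toProj_mem_projectiveClosure ⟨y, hy, rfl⟩, toProj_snoc_ne hz x y, ?_⟩
      rw [toProj, toProj, Projectivization.submodule_mk, Projectivization.submodule_mk,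
        Projectivization.submodule_mk, Submodule.span_singleton_le_iff_mem, joinEquiv_sumVec]
      exact Submodule.add_mem_sup (Submodule.smul_mem _ _ (Submodule.mem_span_singleton_self _))
        (Submodule.smul_mem _ _ (Submodule.mem_span_singleton_self _))
    · rintro h p ⟨a, ha, b, hb, -, hp⟩
      have hp' : p.rep ∈ a.submodule ⊔ b.submodule := hp (by
        rw [Projectivization.submodule_eq]; exact Submodule.mem_span_singleton_self _)
      obtain ⟨a', ha', b', hb', hab⟩ := Submodule.mem_sup.1 hp'
      rw [Projectivization.submodule_eq, Submodule.mem_span_singleton] at ha' hb'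
      obtain ⟨s, rfl⟩ := ha'
      obtain ⟨r, rfl⟩ := hb'
      rw [← hab]
      -- The summands lie only in the closures of the two cones, so it is enough to test sums of
      -- points of the cones.
      refine aeval_add_eq_zero_of_mem_zeroLocus (A := affineCone (slice X z₀)) (B := affineCone (slice Y z₁)) ?_
        (smul_mem_zeroLocus_of_isHomogeneousIdeal (isHomogeneousIdeal_affineCone _)
          (rep_mem_zeroLocus_of_mem_projectiveClosure ha) s)
        (smul_mem_zeroLocus_of_isHomogeneousIdeal (isHomogeneousIdeal_affineCone _)
          (rep_mem_zeroLocus_of_mem_projectiveClosure hb) r)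
      rintro _ ⟨s, hs, _, ⟨x, hx, rfl⟩, rfl⟩ _ ⟨r, hr, _, ⟨y, hy, rfl⟩, rfl⟩
      exact h _ ⟨_, ⟨_, ⟨s, hs, x, hx, rfl⟩, _, ⟨r, hr, y, hy, rfl⟩, rfl⟩, joinEquiv_sumVec hz s r x y⟩

theorem hasProjDim_join [Infinite k] (X Y : Set (Fin n → k)) {z₀ z₁ : k} (hz : z₀ ≠ z₁) {d : ℕ}
    (hd : ringKrullDim (CoordRing (sumCone X Y)) = (d + 2 : ℕ)) :
    HasProjDim (join (projectiveClosure (slice X z₀)) (projectiveClosure (slice Y z₁))) (d + 1) := by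
  rw [HasProjDim, join, homogeneousVanishingIdeal_projZariskiClosure, homogeneousVanishingIdeal_setJoin X Y hz]
  refine (ringKrullDim_coordRing_image (joinEquiv n hz) (sumCone X Y)).trans (hd.trans ?_)
  push_cast
  rw [add_assoc]
  norm_num

theorem mem_join_iff [Infinite k] (X Y : Set (Fin n → k)) {z₀ z₁ : k} (hz : z₀ ≠ z₁)
    (p : ℙ k (Fin (n + 1 + 1) → k)) :
    p ∈ join (projectiveClosure (slice X z₀)) (projectiveClosure (slice Y z₁)) ↔
      (joinEquiv n hz).symm p.rep ∈ zeroLocus k (vanishingIdeal k (sumCone X Y)) := by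
  rw [← mem_zeroLocus_image_iff, ← homogeneousVanishingIdeal_setJoin X Y hz]
  rfl

/-- A system of linear equations with a nonzero right-hand side is equivalent to a homogeneous one
and one affine-linear equation. -/
theorem mulVec_elim_eq_smul_iff {ι κ σ : Type} [Fintype σ] (e : ι ≃ Option κ) (A : Matrix κ σ k)
    (η : σ → k) {c : ι → k} (hc : c (e.symm none) ≠ 0) (v : σ → k) (s : k) :
    (Matrix.of fun i j => (e i).elim 0 (fun l => A l j) + c i * η j).mulVec v = s • c ↔
      A.mulVec v = 0 ∧ dotProduct η v = s := by
  have h1 : ∀ i, (Matrix.of fun i j => (e i).elim 0 (fun l => A l j) + c i * η j).mulVec v i =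
      (e i).elim 0 (A.mulVec v) + c i * dotProduct η v := fun i => by
    rw [Matrix.mulVec, dotProduct]
    simp only [Matrix.of_apply, add_mul, Finset.sum_add_distrib, dotProduct, Finset.mul_sum, mul_assoc]
    congr 1
    cases e i with
    | none => simp
    | some l => rfl
  rw [funext_iff]
  simp only [h1, Pi.smul_apply, smul_eq_mul]
  constructor
  · intro h
    have h2 := h (e.symm none)
    rw [Equiv.apply_symm_apply, Option.elim_none, zero_add, mul_comm] at h2
    have h3 := mul_right_cancel₀ hc h2
    refine ⟨?_, h3⟩
    ext l
    have h4 := h (e.symm (some l))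
    rwa [Equiv.apply_symm_apply, Option.elim_some, h3, mul_comm s, add_eq_right] at h4
  · rintro ⟨h2, h3⟩ i
    rw [h2, h3, mul_comm]
    cases e i <;> simp

end Join

/-! ### The degree of the join -/

section ProjectiveDegree
open MvPolynomial

variable {k : Type u} [Field k] {n : ℕ}

theorem encard_join_section [Infinite k] (X Y : Set (Fin n → k)) {z₀ z₁ : k} (hz : z₀ ≠ z₁) {d : ℕ}
    (A : Matrix (Fin (d + 1)) (Fin (n + 1 + 1)) k) (η : Fin 2 ⊕ Fin n → k)
    (h0 : ∀ t ∈ zeroLocus k (vanishingIdeal k (sumCone X Y)),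
      (A * LinearMap.toMatrix' (joinEquiv n hz).toLinearMap).mulVec t = 0 → dotProduct η t = 0 → t = 0) :
    {p ∈ join (projectiveClosure (slice X z₀)) (projectiveClosure (slice Y z₁)) |
      p.submodule ≤ LinearMap.ker A.mulVecLin}.encard =
    {t ∈ zeroLocus k (vanishingIdeal k (sumCone X Y)) |
      (A * LinearMap.toMatrix' (joinEquiv n hz).toLinearMap).mulVec t = 0 ∧ dotProduct η t = 1}.encard := by
  set Φ := joinEquiv n hz with hΦ
  let C : Set (Fin (n + 1 + 1) → k) := {v | Φ.symm v ∈ zeroLocus k (vanishingIdeal k (sumCone X Y))}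
  let η' : (Fin (n + 1 + 1) → k) →ₗ[k] k := Fintype.linearCombination k η ∘ₗ Φ.symm.toLinearMap
  have hη' : ∀ v, η' v = dotProduct η (Φ.symm v) := fun v => by
    simp [η', Fintype.linearCombination_apply, dotProduct, mul_comm]
  have hA : ∀ t, (A * LinearMap.toMatrix' Φ.toLinearMap).mulVec t = 0 ↔ Φ t ∈ LinearMap.ker A.mulVecLin := fun t => by
    rw [← Matrix.mulVec_mulVec, LinearMap.toMatrix'_mulVec, LinearMap.mem_ker, Matrix.mulVecLin_apply]
    rfl
  have h1 := encard_projective_section (C := C) (fun v hv s => by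
    change Φ.symm (s • v) ∈ zeroLocus k (vanishingIdeal k (sumCone X Y))
    rw [map_smul]
    exact smul_mem_zeroLocus_of_isHomogeneousIdeal (isHomogeneousIdeal_sumCone X Y) hv s)
    (LinearMap.ker A.mulVecLin) η' (fun v hv hvA hvη => by
      refine (LinearEquiv.map_eq_zero_iff Φ.symm).1 (h0 _ hv ?_ ?_)
      · rwa [hA, LinearEquiv.apply_symm_apply]
      · rwa [hη'] at hvη)
  have h2 : {p | p ∈ join (projectiveClosure (slice X z₀)) (projectiveClosure (slice Y z₁)) ∧
      p.submodule ≤ LinearMap.ker A.mulVecLin} = {p | p.rep ∈ C ∧ p.submodule ≤ LinearMap.ker A.mulVecLin} := by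
    ext p
    rw [Set.mem_ofPred_eq, mem_join_iff X Y hz]
    rfl
  rw [h2, h1, ← Φ.injective.encard_image]
  congr 1
  ext v
  constructor
  · rintro ⟨hv, hvA, hvη⟩
    refine ⟨Φ.symm v, ⟨hv, ?_, ?_⟩, Φ.apply_symm_apply v⟩
    · rwa [hA, LinearEquiv.apply_symm_apply]
    · rwa [hη'] at hvη
  · rintro ⟨t, ⟨ht, htA, htη⟩, rfl⟩
    refine ⟨?_, (hA t).1 htA, ?_⟩
    · change Φ.symm (Φ t) ∈ zeroLocus k (vanishingIdeal k (sumCone X Y))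
      rwa [LinearEquiv.symm_apply_apply]
    · rwa [hη', LinearEquiv.symm_apply_apply]

/-- The d + 1 homogeneous equations of the linear space and the normalisation η = 1 form d + 2
equations, whose solutions are a fibre of a perturbed projection over c. The vertex clause of `hF`
ensures that η is nonzero on the section. -/
theorem hasProjDegree_join [Infinite k] (X Y : Set (Fin n → k)) {z₀ z₁ : k} (hz : z₀ ≠ z₁) {d e : ℕ}
    (hd : ringKrullDim (CoordRing (sumCone X Y)) = (d + 2 : ℕ))
    (A₀ : Matrix (Fin 2 ⊕ Fin d) (Fin 2 ⊕ Fin n) k)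
    {F : MvPolynomial (Fin 2 ⊕ Fin d) (MvPolynomial (Option ((Fin 2 ⊕ Fin d) × (Fin 2 ⊕ Fin n))) k)}
    (hF0 : F ≠ 0)
    (hF : ∀ (x : Option ((Fin 2 ⊕ Fin d) × (Fin 2 ⊕ Fin n)) → k) (c : Fin 2 ⊕ Fin d → k),
      eval₂ (eval x) c F ≠ 0 →
      {v ∈ zeroLocus k (vanishingIdeal k (sumCone X Y)) |
        (Matrix.of fun i j => A₀ i j + x none * x (some (i, j))).mulVec v = c}.encard = e ∧
      ∀ v ∈ zeroLocus k (vanishingIdeal k (sumCone X Y)),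
        (Matrix.of fun i j => A₀ i j + x none * x (some (i, j))).mulVec v = 0 → v = 0) :
    HasProjDegree (join (projectiveClosure (slice X z₀)) (projectiveClosure (slice Y z₁))) e := by
  refine ⟨d + 1, hasProjDim_join X Y hz hd, ?_⟩
  -- There are d + 2 rows: one, at `none`, for the normalisation, and d + 1 for the linear space.
  obtain ⟨ε⟩ : Nonempty (Fin 2 ⊕ Fin d ≃ Option (Fin (d + 1))) :=
    Fintype.card_eq.1 (by simp; omega)
  obtain ⟨x, c, hx, hc, hxc⟩ := exists_eval₂_ne_zero hF0 (ε.symm none)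
  set τ := x none with hτ
  set M := LinearMap.toMatrix' (joinEquiv n hz).toLinearMap with hM
  have hMN : LinearMap.toMatrix' (joinEquiv n hz).symm.toLinearMap * M = 1 := by
    rw [hM, ← LinearMap.toMatrix'_comp, LinearEquiv.symm_comp, LinearMap.toMatrix'_id]
  let A₁ : Matrix (Fin 2 ⊕ Fin d) (Fin 2 ⊕ Fin n) k := Matrix.of fun i j => A₀ i j + τ * x (some (i, j))
  -- Chosen so that the row at `none` of the witness matrix is exactly c · η.
  let η : Fin 2 ⊕ Fin n → k := fun j => (c (ε.symm none))⁻¹ * A₁ (ε.symm none) j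
  let G : MvPolynomial (Fin (d + 1) × Fin (n + 1 + 1)) k :=
    eval₂ (aeval fun a : Option ((Fin 2 ⊕ Fin d) × (Fin 2 ⊕ Fin n)) => a.elim (C τ) fun ij =>
      C τ⁻¹ * ((ε ij.1).elim 0 (fun l => ∑ r, MvPolynomial.X (l, r) * C (M r ij.2)) +
        C (c ij.1 * η ij.2) - C (A₀ ij.1 ij.2)) :
        MvPolynomial _ k →ₐ[k] MvPolynomial (Fin (d + 1) × Fin (n + 1 + 1)) k).toRingHom
    (fun i => C (c i)) F
  have hG : ∀ A : Matrix (Fin (d + 1)) (Fin (n + 1 + 1)) k, eval (fun ij => A ij.1 ij.2) G =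
      eval₂ (eval fun a : Option ((Fin 2 ⊕ Fin d) × (Fin 2 ⊕ Fin n)) => a.elim τ fun ij =>
        τ⁻¹ * ((ε ij.1).elim 0 (fun l => (A * M) l ij.2) + c ij.1 * η ij.2 - A₀ ij.1 ij.2)) c F := fun A => by
    refine (algHom_eval₂_aeval (aeval fun ij : Fin (d + 1) × Fin (n + 1 + 1) => A ij.1 ij.2) _ _ F).trans ?_
    congr 1
    · congr 1
      ext (_ | ij)
      · simp
      · simp only [Option.elim_some, map_mul, map_sub, map_add, aeval_C, Algebra.algebraMap_self,
          RingHom.id_apply]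
        congr 3
        cases ε ij.1 with
        | none => simp
        | some l => simp [Matrix.mul_apply]
    · simp
  refine ⟨G, fun hG0 => hxc ?_, fun A _ hA => ?_⟩
  · let At : Matrix (Fin (d + 1)) (Fin 2 ⊕ Fin n) k :=
      Matrix.of fun l j => A₁ (ε.symm (some l)) j - c (ε.symm (some l)) * η j
    have h1 := hG (At * LinearMap.toMatrix' (joinEquiv n hz).symm.toLinearMap)
    rw [hG0, map_zero, Matrix.mul_assoc, hMN, Matrix.mul_one] at h1
    rw [h1]
    congr 2
    ext (_ | ⟨i, j⟩)
    · rfl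
    · have h2 : (ε i).elim 0 (fun l => At l j) + c i * η j = A₁ i j := by
        obtain ⟨o, rfl⟩ := ε.symm.surjective i
        rw [Equiv.apply_symm_apply]
        cases o with
        | none => simp [η, hc]
        | some l => simp [At]
      simp only [Option.elim_some]
      rw [h2]
      simp [A₁, hx]
  · rw [hG] at hA
    obtain ⟨h1, h2⟩ := hF _ _ hA
    have h3 : (Matrix.of fun i j => A₀ i j + τ * (τ⁻¹ * ((ε i).elim 0 (fun l => (A * M) l j) +
        c i * η j - A₀ i j))) = Matrix.of fun i j => (ε i).elim 0 (fun l => (A * M) l j) + c i * η j := by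
      ext i j
      simp [hx]
    simp only [Option.elim_none, Option.elim_some, h3] at h1 h2
    refine (encard_join_section X Y hz A η fun t ht htA htη => h2 t ht ?_).trans ?_
    · rw [← zero_smul k c]
      exact (mulVec_elim_eq_smul_iff ε _ η hc t 0).2 ⟨htA, htη⟩
    · rw [← h1]
      congr 1
      ext t
      refine and_congr_right fun _ => ?_
      have := mulVec_elim_eq_smul_iff ε (A * M) η hc t 1
      rw [one_smul] at this
      exact this.symm

end ProjectiveDegree

end MinkowskiJoin

open MinkowskiJoin in
theorem proposition3p11 {k : Type*} [Field k] [IsAlgClosed k] (hchar : ringChar k ≠ 2)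
    {n : ℕ} (X Y : Set (Fin n → k)) (hX : IsAffineVariety X) (hY : IsAffineVariety Y)
    (hXne : X.Nonempty) (hYne : Y.Nonempty) (hXY : DisjointAtInfinity X Y)
    (z₀ z₁ : k) (hz : z₀ ≠ z₁) :
    ∃ δ : ℕ,
      HasProjDegree (join (projectiveClosure (slice X z₀)) (projectiveClosure (slice Y z₁))) δ ∧
      ∀ᶠ α : kˣ in Filter.cofinite, HasAffineDegree (minkowskiSum (α • X) Y) δ := by
  have : Infinite k := IsAlgClosed.instInfinite
  obtain ⟨d, ℓ, m, hd, hm, hspan⟩ := exists_good_projection hXne hYne hXY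
  have hfin : (projHom (coneMatrix ℓ) (sumCone X Y)).Finite :=
    algHom_finite_of_generatesInDegree hm (coord _) (aeval_coord_surjective _)
      (fun f hf => aeval_coord_eq_zero_iff.2 hf) (projHom (coneMatrix ℓ) (sumCone X Y)) MvPolynomial.X
      fun i => by rw [projHom_X, aeval_coord]
  have hinj : Function.Injective (projHom (coneMatrix ℓ) (sumCone X Y)) :=
    algHom_injective_of_ringKrullDim_eq _ (RingHom.Finite.to_isIntegral hfin) (by
      rw [hd, Fintype.card_sum, Fintype.card_fin, Fintype.card_fin, add_comm])
  obtain ⟨e, he⟩ := exists_generic_encard hm hspan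
  refine ⟨e, ?_, ?_⟩
  -- All entries are perturbed, because the linear spaces that cut the join are arbitrary.
  · obtain ⟨F, hF0, hF⟩ := he ((Fin 2 ⊕ Fin d) × (Fin 2 ⊕ Fin n))
      (Matrix.of fun i j => MvPolynomial.X (i, j))
    refine hasProjDegree_join X Y hz hd (coneMatrix ℓ) hF0 fun x c hxc => ?_
    have h1 : coneMatrix ℓ + x none • (Matrix.of fun i j => MvPolynomial.X (i, j)).map
        (MvPolynomial.eval fun a => x (some a)) =
        Matrix.of fun i j => coneMatrix ℓ i j + x none * x (some (i, j)) := by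
      ext i j
      simp
    have h2 := hF x c hxc
    rwa [h1] at h2
  -- Only the w-block is perturbed, so the rows u₀ and u₁ stay and the fibres remain inside slices
  -- of the cone.
  · obtain ⟨F, hF0, hF⟩ := he (Fin d × Fin n)
      (Matrix.fromBlocks 0 0 0 (Matrix.of fun i j => MvPolynomial.X (i, j)))
    have h1 := eventually_hasAffineDegree_add hX hY hXY (e := e) (ℓ := ℓ)
      (hasAffineDim_add hX hY hXY hfin hinj) hF0 fun x c hxc => by
        have h2 := (hF x c hxc).1
        rwa [coneMatrix_add_smul] at h2
    filter_upwards [h1] with α hα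
    rwa [minkowskiSum_eq hX hY hXY]
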